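/- Let $R\subset\mathfrak a^*$ be a reduced crystallographic root system spanning $\mathfrak a^*$, with Weyl group $W$, positive roots $R^+$, simple roots $\Pi$, weight lattice $P=\{\lambda\in\mathfrak a^*\mid\lambda(\alpha^\vee)\in\mathbb Z\ \forall\alpha\in R\}$, dominant weights $P^+$, and $\mathfrak h=\mathfrak a\otimes\mathbb C$. Let $k=(k_\alpha)_{\alpha\in R}$ be a $W$-invariant family of real numbers $k_\alpha\ge 0$ and $\rho(k)=\frac12\sum_{\alpha>0}k_\alpha\alpha$. Let $I$ be a set of simple reflections, $W_I\subset W$ the parabolic subgroup it generates, $R_I^+$ its positive roots, $W^I=\{v\in W\mid v(R_I^+)\subset R^+\}$ and $P_I^+=\{\lambda\in P\mid\lambda(\alpha^\vee)\ge 0\ \forall\alpha\in R_I^+\}$. On $\mathbb C[P]$ put the inner product $(f,g)_k=\int_T\overline f\,g\prod_{\alpha\in R}|e^{\alpha/2}-e^{-\alpha/2}|^{k_\alpha}\,dt$, where $T=i\mathfrak a/2\pi i Q^\vee$, $Q^\vee$ is the coroot lattice and $dt$ is the normalized Haar measure. For $\lambda\in P$ let $\lambda_+$ be the dominant weight in $W\lambda$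 and $\overline v(\lambda)$ the shortest $v\in W$ with $v\lambda_+=\lambda$; write $\lambda\le\mu$ if $\mu_+-\lambda_+\in\sum_{\alpha\in\Pi}\mathbb Z_{\ge0}\alpha$ and, in case $\lambda_+=\mu_+$, $\overline v(\lambda)\le\overline v(\mu)$ in the Bruhat order. With $m_I(\mu)=\sum_{\nu\in W_I\mu}e^\nu$, the Jacobi polynomial $p_I(\lambda,k)$, $\lambda\in P_I^+$, is the unique element of $m_I(\lambda)+\mathrm{span}\{m_I(\mu)\mid\mu\in P_I^+,\ \mu<\lambda\}$ with $(p_I(\lambda,k),m_I(\mu))_k=0$ for all $\mu\in P_I^+$, $\mu<\lambda$. Identify $\mathbb C[W/W_I]$ with the space spanned by the characteristic functions $\delta_{wW_I}$, let $W$ act diagonally on $\mathbb C[P]\otimes\mathbb C[W/W_I]$, and put $\Gamma(f)=\sum_{u\in W^I}u(f\otimes\delta_{W_I})$ and $P_I(\lambda,k)=\Gamma(p_I(\lambda,k))$. The Cherednik operators $D_\xi(k)=\partial_\xi+\sum_{\alpha>0}k_\alpha\alpha(\xi)\frac1{1-e^{-\alpha}}(1-s_\alpha)-\rho(k)(\xi)$,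 $\xi\in\mathfrak h$, commute; let $S'(\mathfrak h)^{W_I}=\{q(D(k))\mid q\in S(\mathfrak h)^{W_I}\}$. Let $\mathcal R$ be the algebra generated by the functions $\frac1{1-e^{-\alpha}}$, $\alpha\in R^+$, let $\mathbb D_{I,\mathcal R}=\mathcal R\otimes\mathrm{End}(\mathbb C[W/W_I])\otimes S(\mathfrak h)$ be the algebra of matrix-valued differential operators with coefficients in $\mathcal R\otimes\mathrm{End}(\mathbb C[W/W_I])$, and let $\sum_w D_w\otimes w\in\mathbb D_{I,\mathcal R}\otimes\mathbb C[W]$ act by $\Phi\mapsto\sum_w D_w(w\Phi)$. Put $\gamma(D)=\sum_{u\in W^I}(u\circ D\circ u^{-1})\otimes E_{uW_I,uW_I}$, where $E_{c,c}$ is the projection onto $\mathbb C\delta_c$, and $\beta(\sum_w D_w\otimes w)=\sum_w D_w$. Then the following hold. 1. For each $D\in S'(\mathfrak h)^{W_I}$, $\gamma(D)$ is the action of exactly one element of $\mathbb D_{I,\mathcal R}\otimes\mathbb C[W]$, so that $\mathbb D(I,k)=\beta(\gamma(S'(\mathfrak h)^{W_I}))\subset\mathbb D_{I,\mathcal R}$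 is well defined. 2. $\mathbb D(I,k)$ is a commutative subalgebra of $\mathbb D_{I,\mathcal R}$, and its elements map $(\mathbb C[P]\otimes\mathbb C[W/W_I])^W$ into itself. 3. The polynomials $p_I(\lambda,k)$ exist and are unique, and the $P_I(\lambda,k)$, $\lambda\in P_I^+$, form a basis of $(\mathbb C[P]\otimes\mathbb C[W/W_I])^W$. They are determined up to scaling as the simultaneous eigenfunctions of $\mathbb D(I,k)$: for each $\lambda\in P_I^+$ there is a function $\chi_\lambda:\mathbb D(I,k)\to\mathbb C$ with $D\,P_I(\lambda,k)=\chi_\lambda(D)P_I(\lambda,k)$ for all $D\in\mathbb D(I,k)$, every $\Phi\in(\mathbb C[P]\otimes\mathbb C[W/W_I])^W$ with $D\Phi=\chi_\lambda(D)\Phi$ for all $D\in\mathbb D(I,k)$ is a scalar multiple of $P_I(\lambda,k)$, and every non-zero simultaneous eigenfunction of $\mathbb D(I,k)$ in $(\mathbb C[P]\otimes\mathbb C[W/W_I])^W$ is a scalar multiple of $P_I(\lambda,k)$ for exactly one $\lambda\in P_I^+$. -/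

import Mathlib

noncomputable section

namespace JacobiPoly

section FractionFieldDerivation

variable {A : Type*} [CommRing A] [IsDomain A] [Algebra ℂ A]

/-- The ring homomorphism `a ↦ a + ε d(a)` into the dual numbers over the fraction field. -/
def dualNumberHom (d : Derivation ℂ A A) :
    A →+* TrivSqZeroExt (FractionRing A) (FractionRing A) where
  toFun a := TrivSqZeroExt.inl (algebraMap A (FractionRing A) a) +
    TrivSqZeroExt.inr (algebraMap A (FractionRing A) (d a))
  map_one' := by ext <;> simp
  map_mul' a b := by
    ext
    · simp
    · rw [d.leibniz]
      simp only [TrivSqZeroExt.snd_add, TrivSqZeroExt.snd_mul, TrivSqZeroExt.snd_inl,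
        TrivSqZeroExt.snd_inr, TrivSqZeroExt.fst_add, TrivSqZeroExt.fst_inl,
        TrivSqZeroExt.fst_inr, map_add, map_mul, smul_eq_mul, op_smul_eq_smul,
        zero_add, add_zero]
  map_zero' := by ext <;> simp
  map_add' a b := by
    ext
    · simp
    · simp only [TrivSqZeroExt.snd_add, TrivSqZeroExt.snd_inl, TrivSqZeroExt.snd_inr, map_add,
        zero_add]

theorem isUnit_dualNumberHom (d : Derivation ℂ A A) (s : nonZeroDivisors A) :
    IsUnit (dualNumberHom d s) := by
  rw [TrivSqZeroExt.isUnit_iff_isUnit_fst]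
  simp [dualNumberHom]

/-- The underlying ring homomorphism of the extension of `d` to the fraction field. -/
def fracDualNumberHom (d : Derivation ℂ A A) :
    FractionRing A →+* TrivSqZeroExt (FractionRing A) (FractionRing A) :=
  IsLocalization.lift (M := nonZeroDivisors A) (isUnit_dualNumberHom d)

theorem fracDualNumberHom_algebraMap (d : Derivation ℂ A A) (a : A) :
    fracDualNumberHom d (algebraMap A (FractionRing A) a) = dualNumberHom d a :=
  IsLocalization.lift_eq _ a

theorem fst_fracDualNumberHom (d : Derivation ℂ A A) (x : FractionRing A) :
    (fracDualNumberHom d x).fst = x := by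
  have h : (TrivSqZeroExt.fstHom ℂ (FractionRing A) (FractionRing A)).toRingHom.comp
      (fracDualNumberHom d) = RingHom.id _ := by
    refine IsLocalization.ringHom_ext (nonZeroDivisors A) ?_
    ext a
    simp [fracDualNumberHom_algebraMap, dualNumberHom]
  exact congrArg (fun f => f x) h

theorem fracDualNumberHom_const (d : Derivation ℂ A A) (c : ℂ) :
    (fracDualNumberHom d (algebraMap ℂ (FractionRing A) c)).snd = 0 := by
  rw [IsScalarTower.algebraMap_apply ℂ A (FractionRing A), fracDualNumberHom_algebraMap]
  simp [dualNumberHom]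

/-- The unique extension of a derivation of a domain to its fraction field. -/
def fracDerivation (d : Derivation ℂ A A) :
    Derivation ℂ (FractionRing A) (FractionRing A) :=
  Derivation.mk'
    { toFun := fun x => (fracDualNumberHom d x).snd
      map_add' := fun x y => by simp
      map_smul' := fun c x => by
        rw [Algebra.smul_def, map_mul, TrivSqZeroExt.snd_mul, fracDualNumberHom_const]
        simp [fst_fracDualNumberHom, Algebra.smul_def] }
    (fun a b => by
      simp [TrivSqZeroExt.snd_mul, fst_fracDualNumberHom, mul_comm])

theorem fracDerivation_algebraMap (d : Derivation ℂ A A) (a : A) :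
    fracDerivation d (algebraMap A (FractionRing A) a) =
      algebraMap A (FractionRing A) (d a) := by
  change (fracDualNumberHom d (algebraMap A (FractionRing A) a)).snd = _
  rw [fracDualNumberHom_algebraMap]
  exact (TrivSqZeroExt.snd_add _ _).trans
    (by rw [TrivSqZeroExt.snd_inl, TrivSqZeroExt.snd_inr, zero_add])

theorem fracDerivation_unique {D E : Derivation ℂ (FractionRing A) (FractionRing A)}
    (h : ∀ a : A, D (algebraMap A (FractionRing A) a) = E (algebraMap A (FractionRing A) a)) :
    D = E := by
  ext x
  obtain ⟨a, s, hs, rfl⟩ := IsFractionRing.div_surjective (A := A) x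
  have hs' : algebraMap A (FractionRing A) s ≠ 0 := by
    simpa using nonZeroDivisors.ne_zero hs
  have key : ∀ F : Derivation ℂ (FractionRing A) (FractionRing A),
      F (algebraMap A (FractionRing A) a) =
        (algebraMap A (FractionRing A) a / algebraMap A (FractionRing A) s) *
            F (algebraMap A (FractionRing A) s) +
          algebraMap A (FractionRing A) s *
            F (algebraMap A (FractionRing A) a / algebraMap A (FractionRing A) s) := by
    intro F
    conv_lhs => rw [← div_mul_cancel₀ (algebraMap A (FractionRing A) a) hs']
    rw [F.leibniz]
    simp
  have h1 := key D
  have h2 := key E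
  rw [h, h] at h1
  exact mul_left_cancel₀ hs' (by linear_combination h2 - h1)

end FractionFieldDerivation

variable {ι M N : Type*} [AddCommGroup M] [Module ℝ M] [AddCommGroup N] [Module ℝ N]

theorem coroot'_weyl_smul (P : RootPairing ι ℝ M N) (w : P.weylGroup) (i : ι) (x : M) :
    P.coroot' i (w • x) = P.coroot' ((w : P.Aut).indexEquiv.symm i) x := by
  have h := RootPairing.Hom.weight_coweight_transpose_apply P P (P.coroot i) (w : P.Aut).toHom
  have h2 := LinearMap.congr_fun h x
  rw [RootPairing.Hom.coroot_coweightMap_apply] at h2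
  exact h2

/-- The weight lattice `P = {x | x(α^∨) ∈ ℤ for all roots α}`. -/
def weightLattice (P : RootPairing ι ℝ M N) : AddSubgroup M where
  carrier := {x | ∀ i, ∃ n : ℤ, P.coroot' i x = n}
  add_mem' {x y} hx hy i := by
    obtain ⟨m, hm⟩ := hx i
    obtain ⟨n, hn⟩ := hy i
    exact ⟨m + n, by rw [map_add, hm, hn]; push_cast; rfl⟩
  zero_mem' i := ⟨0, by simp⟩
  neg_mem' {x} hx i := by
    obtain ⟨m, hm⟩ := hx i
    exact ⟨-m, by rw [map_neg, hm]; push_cast; rfl⟩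

/-- The action of the Weyl group on the weight lattice. -/
instance (P : RootPairing ι ℝ M N) : DistribMulAction P.weylGroup (weightLattice P) where
  smul w x := ⟨w • (x : M), fun i => by
    rw [coroot'_weyl_smul]
    exact x.2 _⟩
  one_smul x := Subtype.ext (one_smul _ (x : M))
  mul_smul v w x := Subtype.ext (mul_smul v w (x : M))
  smul_zero w := Subtype.ext (smul_zero w)
  smul_add w x y := Subtype.ext (smul_add w (x : M) (y : M))

theorem coe_weyl_smul (P : RootPairing ι ℝ M N) (w : P.weylGroup) (x : weightLattice P) :
    ((w • x : weightLattice P) : M) = w • (x : M) :=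
  rfl

/-- The roots, as elements of the weight lattice. -/
def rootWeight (P : RootPairing ι ℝ M N) [P.IsCrystallographic] (i : ι) : weightLattice P :=
  ⟨P.root i, fun j => by
    obtain ⟨n, hn⟩ := P.exists_value (S := ℤ) i j
    exact ⟨n, by simpa using hn.symm⟩⟩

instance (P : RootPairing ι ℝ M N) : UniqueSums (weightLattice P) := by
  let _ : Module ℚ M := Module.compHom M (algebraMap ℚ ℝ)
  have : TwoUniqueSums M := inferInstance
  exact UniqueSums.of_injective_addHom (weightLattice P).subtype.toAddHom
    Subtype.val_injective inferInstance

instance [Finite ι] (P : RootPairing ι ℝ M N) [P.IsRootSystem] : Finite P.weylGroup := by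
  refine Finite.of_injective (fun w : P.weylGroup => P.weylGroupToPerm w) fun v w h => ?_
  apply Subtype.ext
  apply RootPairing.Equiv.weightHom_injective P
  ext x
  have hx : x ∈ Submodule.span ℝ (Set.range P.root) := by
    rw [RootPairing.IsRootSystem.span_root_eq_top]; trivial
  induction hx using Submodule.span_induction with
  | mem x hx =>
    obtain ⟨i, rfl⟩ := hx
    have h1 := P.weylGroup_apply_root v i
    have h2 := P.weylGroup_apply_root w i
    have h' : P.weylGroupToPerm v = P.weylGroupToPerm w := h
    rw [h', ← h2] at h1
    exact h1
  | zero => simp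
  | add x y _ _ hx hy => rw [map_add, map_add, hx, hy]
  | smul a x _ hx => rw [map_smul, map_smul, hx]

/-- The group algebra `ℂ[P]` of Laurent polynomials; `e^μ` is `single μ 1`. -/
abbrev LaurentPoly (P : RootPairing ι ℝ M N) : Type _ :=
  AddMonoidAlgebra ℂ (weightLattice P)

/-- The exponential `e^μ`. -/
def expo (P : RootPairing ι ℝ M N) (μ : weightLattice P) : LaurentPoly P :=
  AddMonoidAlgebra.single μ 1

/-- The action of the Weyl group on `ℂ[P]`, `w e^μ = e^{w μ}`. -/
def weylLaurent (P : RootPairing ι ℝ M N) (w : P.weylGroup) :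
    LaurentPoly P ≃ₐ[ℂ] LaurentPoly P :=
  AddMonoidAlgebra.domCongr ℂ ℂ (DistribMulAction.toAddEquiv (weightLattice P) w)

/-- The field of fractions of `ℂ[P]`. -/
abbrev RatFun (P : RootPairing ι ℝ M N) : Type _ := FractionRing (LaurentPoly P)

/-- The action of the Weyl group on the field of fractions of `ℂ[P]`. -/
def weylRat (P : RootPairing ι ℝ M N) (w : P.weylGroup) : RatFun P ≃ₐ[ℂ] RatFun P :=
  IsLocalization.algEquivOfAlgEquiv (M := nonZeroDivisors (LaurentPoly P))
    (T := nonZeroDivisors (LaurentPoly P)) (RatFun P) (RatFun P) (weylLaurent P w)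
    (MulEquivClass.map_nonZeroDivisors (weylLaurent P w))

/-! ### Parabolic subgroups, dominant weights and the ordering -/

/-- The parabolic subgroup `W_I` generated by the simple reflections in `I`. -/
def parabolic {P : RootPairing ι ℝ M N} (b : P.Base) (I : Set b.support) :
    Subgroup P.weylGroup :=
  Subgroup.closure ((fun i : b.support => RootPairing.weylGroup.ofIdx P i) '' I)

/-- The positive roots `R_I⁺` of `W_I` (as a set of indices). -/
def posRoots {P : RootPairing ι ℝ M N} (b : P.Base) (I : Set b.support) : Set ι :=
  {i | b.IsPos i ∧ RootPairing.weylGroup.ofIdx P i ∈ parabolic b I}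

/-- The set `W^I = {v ∈ W | v(R_I⁺) ⊆ R⁺}` of representatives of `W / W_I`. -/
def minReps {P : RootPairing ι ℝ M N} (b : P.Base) (I : Set b.support) : Set P.weylGroup :=
  {v | ∀ i ∈ posRoots b I, b.IsPos (P.weylGroupToPerm v i)}

/-- The weights `P_I⁺` that are dominant for `W_I`. -/
def domWeights {P : RootPairing ι ℝ M N} (b : P.Base) (I : Set b.support) :
    Set (weightLattice P) :=
  {x | ∀ i ∈ posRoots b I, 0 ≤ P.coroot' i (x : M)}

/-- The dominant weights `P⁺`. -/
def dominant {P : RootPairing ι ℝ M N} (b : P.Base) : Set (weightLattice P) :=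
  {x | ∀ i, b.IsPos i → 0 ≤ P.coroot' i (x : M)}

/-- The length of a Weyl group element with respect to the simple reflections. -/
def weylLength {P : RootPairing ι ℝ M N} (b : P.Base) (w : P.weylGroup) : ℕ :=
  sInf {n | ∃ l : List b.support, l.length = n ∧
    (l.map fun i : b.support => RootPairing.weylGroup.ofIdx P i).prod = w}

/-- The Bruhat ordering on the Weyl group: the transitive and reflexive closure of
`u < u s_α` for `α` a root with `ℓ(u) < ℓ(u s_α)`. -/
def bruhatLE {P : RootPairing ι ℝ M N} (b : P.Base) : P.weylGroup → P.weylGroup → Prop :=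
  Relation.ReflTransGen fun u w =>
    ∃ i : ι, w = u * RootPairing.weylGroup.ofIdx P i ∧ weylLength b u < weylLength b w

/-- `v` is the shortest element of the Weyl group that maps `x` to `y`. -/
def IsShortest {P : RootPairing ι ℝ M N} (b : P.Base) (v : P.weylGroup)
    (x y : weightLattice P) : Prop :=
  v • x = y ∧ ∀ u : P.weylGroup, u • x = y → weylLength b v ≤ weylLength b u

/-- The partial ordering `x ≤ y` on the weight lattice: if `x0`, `y0` are the dominant weights in
the orbits of `x`, `y` and `v`, `u` are the shortest elements with `v x0 = x` and `u y0 = y`,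
then `y0 - x0` is a sum of simple roots and, if `x0 = y0`, then `v ≤ u` in the Bruhat ordering. -/
def weightLE {P : RootPairing ι ℝ M N} (b : P.Base) (x y : weightLattice P) : Prop :=
  ∃ x0 ∈ dominant b, ∃ y0 ∈ dominant b, ∃ v u : P.weylGroup,
    IsShortest b v x0 x ∧ IsShortest b u y0 y ∧
    (y0 : M) - (x0 : M) ∈ AddSubmonoid.closure (P.root '' b.support) ∧
    (x0 = y0 → bruhatLE b v u)

/-! ### The inner product and the Jacobi polynomials -/

/-- The value of `e^μ` at the point `exp(2πi ∑ t_j α_j^∨)` of the compact torus, where `α_j^∨` are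
the simple coroots. The integers `μ(α_j^∨)` are written as floors of real numbers. -/
def torusChar {P : RootPairing ι ℝ M N} (b : P.Base) (μ : weightLattice P)
    (t : UnitAddTorus b.support) : ℂ :=
  UnitAddTorus.mFourier (fun j : b.support => ⌊P.coroot' j (μ : M)⌋) t

/-- The value of a Laurent polynomial at a point of the compact torus. -/
def torusEval {P : RootPairing ι ℝ M N} (b : P.Base) (f : LaurentPoly P)
    (t : UnitAddTorus b.support) : ℂ :=
  f.coeff.sum fun μ c => c * torusChar b μ t

/-- The weight function `∏_{α ∈ R} |e^{α/2} - e^{-α/2}|^{k_α}` on the compact torus. Note that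
`|e^{α/2} - e^{-α/2}| = |1 - e^{-α}|` there. -/
def torusWeight [Fintype ι] {P : RootPairing ι ℝ M N} [P.IsCrystallographic] (b : P.Base)
    (k : ι → ℝ) (t : UnitAddTorus b.support) : ℝ :=
  ∏ i, ‖1 - torusChar b (-rootWeight P i) t‖ ^ k i

/-- The inner product `(f, g)_k`, conjugate linear in `f`, with respect to the normalized Haar
measure on the compact torus. -/
def innerProd [Fintype ι] {P : RootPairing ι ℝ M N} [P.IsCrystallographic] (b : P.Base)
    (k : ι → ℝ) (f g : LaurentPoly P) : ℂ :=
  ∫ t : UnitAddTorus b.support,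
    (starRingEnd ℂ) (torusEval b f t) * torusEval b g t * (torusWeight b k t : ℂ)
    ∂(MeasureTheory.Measure.pi fun _ => AddCircle.haarAddCircle)

/-- The basic invariant `m_I(x) = ∑_{y ∈ W_I x} e^y`. -/
def orbitSum {P : RootPairing ι ℝ M N} (b : P.Base) (I : Set b.support)
    (x : weightLattice P) : LaurentPoly P :=
  ∑ᶠ y ∈ {y | ∃ w ∈ parabolic b I, y = w • x}, expo P y

/-- `p` is the Jacobi polynomial `p_I(x, k)`: it is `m_I(x)` plus a combination of the `m_I(y)`
with `y < x` in `P_I⁺`, and it is orthogonal to all these `m_I(y)`. -/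
def IsJacobi [Fintype ι] {P : RootPairing ι ℝ M N} [P.IsCrystallographic] (b : P.Base)
    (I : Set b.support) (k : ι → ℝ) (x : weightLattice P) (p : LaurentPoly P) : Prop :=
  p - orbitSum b I x ∈ Submodule.span ℂ
      (orbitSum b I '' {y | y ∈ domWeights b I ∧ weightLE b y x ∧ y ≠ x}) ∧
    ∀ y ∈ domWeights b I, weightLE b y x → y ≠ x → innerProd b k p (orbitSum b I y) = 0

/-! ### Cherednik operators -/

/-- The complexification `𝔥` of the space `𝔞` dual to the span of the roots. -/
abbrev CplxSpace (N : Type*) [AddCommGroup N] [Module ℝ N] : Type _ := TensorProduct ℝ ℂ N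

/-- The complex linear extension to `𝔥` of a linear functional on `𝔞`. -/
def cplxFunctional (P : RootPairing ι ℝ M N) (x : M) : CplxSpace N →ₗ[ℂ] ℂ :=
  (TensorProduct.AlgebraTensorModule.rid ℝ ℂ ℂ).toLinearMap ∘ₗ
    (P.toLinearMap x).baseChange ℂ

/-- The linear map `∂_ξ` of `ℂ[P]`, `∂_ξ e^μ = μ(ξ) e^μ`. -/
def derivLaurentLin (P : RootPairing ι ℝ M N) (ξ : CplxSpace N) :
    LaurentPoly P →ₗ[ℂ] LaurentPoly P :=
  (Finsupp.lsum ℂ fun μ : weightLattice P =>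
    cplxFunctional P (μ : M) ξ • AddMonoidAlgebra.lsingle (R := ℂ) (S := ℂ) μ) ∘ₗ
      (AddMonoidAlgebra.coeffLinearEquiv ℂ).toLinearMap

theorem derivLaurentLin_single (P : RootPairing ι ℝ M N) (ξ : CplxSpace N)
    (μ : weightLattice P) (c : ℂ) :
    derivLaurentLin P ξ (AddMonoidAlgebra.single μ c) =
      AddMonoidAlgebra.single μ (cplxFunctional P (μ : M) ξ * c) := by
  simp [derivLaurentLin]

theorem cplxFunctional_add (P : RootPairing ι ℝ M N) (x y : M) :
    cplxFunctional P (x + y) = cplxFunctional P x + cplxFunctional P y := by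
  simp [cplxFunctional, LinearMap.baseChange_add, LinearMap.comp_add]

/-- The derivation `∂_ξ` of `ℂ[P]`, `∂_ξ e^μ = μ(ξ) e^μ`. -/
def derivLaurent (P : RootPairing ι ℝ M N) (ξ : CplxSpace N) :
    Derivation ℂ (LaurentPoly P) (LaurentPoly P) :=
  Derivation.mk' (derivLaurentLin P ξ) (fun f g => by
    induction f using AddMonoidAlgebra.induction_linear with
    | zero => simp
    | add f₁ f₂ h₁ h₂ =>
      rw [add_mul, map_add, h₁, h₂, map_add, add_smul, smul_add]
      abel
    | single m r =>
      induction g using AddMonoidAlgebra.induction_linear with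
      | zero => simp
      | add g₁ g₂ h₁ h₂ =>
        rw [mul_add, map_add, h₁, h₂, map_add, add_smul, smul_add]
        abel
      | single n s =>
        rw [smul_eq_mul, smul_eq_mul, AddMonoidAlgebra.single_mul_single,
          derivLaurentLin_single, derivLaurentLin_single, derivLaurentLin_single,
          AddMonoidAlgebra.single_mul_single, AddMonoidAlgebra.single_mul_single,
          add_comm n m, ← AddMonoidAlgebra.single_add, AddSubgroup.coe_add,
          cplxFunctional_add, LinearMap.add_apply]
        congr 1
        ring)

theorem derivLaurent_add (P : RootPairing ι ℝ M N) (ξ η : CplxSpace N) (f : LaurentPoly P) :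
    derivLaurent P (ξ + η) f = derivLaurent P ξ f + derivLaurent P η f := by
  change derivLaurentLin P (ξ + η) f = derivLaurentLin P ξ f + derivLaurentLin P η f
  induction f using AddMonoidAlgebra.induction_linear with
  | zero => simp
  | add f₁ f₂ h₁ h₂ =>
    rw [map_add, h₁, h₂, map_add, map_add]
    abel
  | single m r =>
    rw [derivLaurentLin_single, derivLaurentLin_single, derivLaurentLin_single, map_add, add_mul,
      AddMonoidAlgebra.single_add]

theorem derivLaurent_smul (P : RootPairing ι ℝ M N) (c : ℂ) (ξ : CplxSpace N)
    (f : LaurentPoly P) :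
    derivLaurent P (c • ξ) f = c • derivLaurent P ξ f := by
  change derivLaurentLin P (c • ξ) f = c • derivLaurentLin P ξ f
  induction f using AddMonoidAlgebra.induction_linear with
  | zero => simp
  | add f₁ f₂ h₁ h₂ => rw [map_add, h₁, h₂, map_add, smul_add]
  | single m r =>
    rw [derivLaurentLin_single, derivLaurentLin_single, map_smul, AddMonoidAlgebra.smul_single,
      smul_eq_mul, smul_eq_mul, mul_assoc]

/-- The derivations `∂_ξ` of the field of fractions of `ℂ[P]`, as operators. -/
def derivRat (P : RootPairing ι ℝ M N) : CplxSpace N →ₗ[ℂ] Module.End ℂ (RatFun P) where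
  toFun ξ := (fracDerivation (derivLaurent P ξ)).toLinearMap
  map_add' ξ η := by
    have h : fracDerivation (derivLaurent P (ξ + η)) =
        fracDerivation (derivLaurent P ξ) + fracDerivation (derivLaurent P η) :=
      fracDerivation_unique fun f => by
        rw [Derivation.add_apply, fracDerivation_algebraMap, fracDerivation_algebraMap,
          fracDerivation_algebraMap, derivLaurent_add, map_add]
    exact congrArg Derivation.toLinearMap h
  map_smul' c ξ := by
    have h : fracDerivation (derivLaurent P (c • ξ)) = c • fracDerivation (derivLaurent P ξ) :=
      fracDerivation_unique fun f => by
        rw [Derivation.smul_apply, fracDerivation_algebraMap, fracDerivation_algebraMap,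
          derivLaurent_smul, Algebra.smul_def, map_mul, Algebra.smul_def,
          ← IsScalarTower.algebraMap_apply]
    exact congrArg Derivation.toLinearMap h

/-- The rational function `1 / (1 - e^{-α})`. -/
def invOneSub (P : RootPairing ι ℝ M N) [P.IsCrystallographic] (i : ι) : RatFun P :=
  (1 - algebraMap (LaurentPoly P) (RatFun P) (expo P (-rootWeight P i)))⁻¹

/-- The vector `ρ(k) = ½ ∑_{α > 0} k_α α`. -/
def rhoVec [Fintype ι] {P : RootPairing ι ℝ M N} (b : P.Base) (k : ι → ℝ) : M :=
  open scoped Classical in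
  (1 / 2 : ℝ) • ∑ i with b.IsPos i, k i • P.root i

/-- The Cherednik operators
`D_ξ(k) = ∂_ξ + ∑_{α > 0} k_α α(ξ) (1 - e^{-α})⁻¹ (1 - s_α) - ρ(k)(ξ)`. They are written as
operators on the field of fractions of `ℂ[P]`, which contains `ℂ[P]` and is stable under
division by `1 - e^{-α}`. -/
def cherednik [Fintype ι] {P : RootPairing ι ℝ M N} [P.IsCrystallographic] (b : P.Base)
    (k : ι → ℝ) : CplxSpace N →ₗ[ℂ] Module.End ℂ (RatFun P) :=
  open scoped Classical in
  derivRat P +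
    ∑ i with b.IsPos i, (cplxFunctional P (P.root i)).smulRight
      ((k i : ℂ) • (Algebra.lmul ℂ (RatFun P) (invOneSub P i) *
        (1 - (weylRat P (RootPairing.weylGroup.ofIdx P i)).toLinearMap))) -
    (cplxFunctional P (rhoVec b k)).smulRight 1

/-- The action of the Weyl group on `𝔥`, dual to its action on weights. -/
def weylCplx (P : RootPairing ι ℝ M N) (w : P.weylGroup) : CplxSpace N →ₗ[ℂ] CplxSpace N :=
  ((w⁻¹ : P.weylGroup) : P.Aut).coweightMap.baseChange ℂ

/-- The action of the Weyl group on the symmetric algebra `S(𝔥)`. -/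
def weylSym (P : RootPairing ι ℝ M N) (w : P.weylGroup) :
    SymmetricAlgebra ℂ (CplxSpace N) →ₐ[ℂ] SymmetricAlgebra ℂ (CplxSpace N) :=
  SymmetricAlgebra.lift (SymmetricAlgebra.ι ℂ (CplxSpace N) ∘ₗ weylCplx P w)

/-- The set of operators `q(D(k))` with `q ∈ S(𝔥)^{W_I}`. To substitute the Cherednik operators
in `q` one writes `q` as the class of a noncommutative polynomial. -/
def invOperators [Fintype ι] {P : RootPairing ι ℝ M N} [P.IsCrystallographic] (b : P.Base)
    (I : Set b.support) (k : ι → ℝ) : Set (Module.End ℂ (RatFun P)) :=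
  {T | ∃ x : TensorAlgebra ℂ (CplxSpace N),
    (∀ w ∈ parabolic b I, weylSym P w (SymmetricAlgebra.algHom ℂ (CplxSpace N) x) =
      SymmetricAlgebra.algHom ℂ (CplxSpace N) x) ∧
    T = TensorAlgebra.lift ℂ (cherednik b k) x}

/-! ### Vector-valued functions and matrix-valued differential operators -/

/-- The set of cosets `W / W_I`. -/
abbrev Cosets {P : RootPairing ι ℝ M N} (b : P.Base) (I : Set b.support) : Type _ :=
  P.weylGroup ⧸ parabolic b I

instance [Finite ι] {P : RootPairing ι ℝ M N} [P.IsRootSystem] (b : P.Base)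
    (I : Set b.support) : Fintype (Cosets b I) :=
  Fintype.ofFinite _

instance {P : RootPairing ι ℝ M N} (b : P.Base) (I : Set b.support) :
    DecidableEq (Cosets b I) :=
  Classical.decEq _

/-- The space of functions on `W / W_I` with values in the fractions of `ℂ[P]`; it contains
`ℂ[P] ⊗ ℂ[W / W_I]`, where `f ⊗ δ_c` is the function that is `f` at `c` and vanishes elsewhere. -/
abbrev VecFun {P : RootPairing ι ℝ M N} (b : P.Base) (I : Set b.support) : Type _ :=
  Cosets b I → RatFun P

/-- The diagonal action of the Weyl group, `w (f ⊗ δ_c) = (w f) ⊗ δ_{w c}`. -/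
def weylVec {P : RootPairing ι ℝ M N} (b : P.Base) (I : Set b.support) (w : P.weylGroup) :
    Module.End ℂ (VecFun b I) :=
  LinearMap.pi fun c => (weylRat P w).toLinearMap ∘ₗ LinearMap.proj (w⁻¹ • c)

/-- The space `(ℂ[P] ⊗ ℂ[W / W_I])^W`. -/
def invVec {P : RootPairing ι ℝ M N} (b : P.Base) (I : Set b.support) :
    Submodule ℂ (VecFun b I) where
  carrier := {Φ | (∀ c, ∃ f : LaurentPoly P, Φ c = algebraMap (LaurentPoly P) (RatFun P) f) ∧
    ∀ w, weylVec b I w Φ = Φ}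
  add_mem' {Φ Ψ} hΦ hΨ := by
    refine ⟨fun c => ?_, fun w => by rw [map_add, hΦ.2, hΨ.2]⟩
    obtain ⟨f, hf⟩ := hΦ.1 c
    obtain ⟨g, hg⟩ := hΨ.1 c
    exact ⟨f + g, by rw [Pi.add_apply, hf, hg, map_add]⟩
  zero_mem' := ⟨fun c => ⟨0, by simp⟩, fun w => map_zero _⟩
  smul_mem' a Φ hΦ := by
    refine ⟨fun c => ?_, fun w => by rw [map_smul, hΦ.2]⟩
    obtain ⟨f, hf⟩ := hΦ.1 c
    exact ⟨a • f, by
      rw [Pi.smul_apply, hf, Algebra.smul_def, Algebra.smul_def, map_mul,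
        ← IsScalarTower.algebraMap_apply]⟩

/-- The map `Γ(f) = ∑_{u ∈ W^I} u (f ⊗ δ_{W_I})`. -/
def gammaVec {P : RootPairing ι ℝ M N} (b : P.Base) (I : Set b.support) (f : LaurentPoly P) :
    VecFun b I :=
  ∑ᶠ u ∈ minReps b I, weylVec b I u
    (Pi.single ((1 : P.weylGroup) : Cosets b I) (algebraMap (LaurentPoly P) (RatFun P) f))

/-- The map `γ(T) = ∑_{u ∈ W^I} (u ∘ T ∘ u⁻¹) ⊗ E_{uW_I, uW_I}`. -/
def gammaOp {P : RootPairing ι ℝ M N} (b : P.Base) (I : Set b.support)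
    (T : Module.End ℂ (RatFun P)) : Module.End ℂ (VecFun b I) :=
  ∑ᶠ u ∈ minReps b I,
    LinearMap.single ℂ (fun _ : Cosets b I => RatFun P) (u : Cosets b I) ∘ₗ
      ((weylRat P u).toLinearMap ∘ₗ T ∘ₗ (weylRat P u⁻¹).toLinearMap) ∘ₗ
      LinearMap.proj (u : Cosets b I)

/-- The algebra `ℛ` generated by the functions `1 / (1 - e^{-α})`, `α > 0`. -/
def coeffAlg {P : RootPairing ι ℝ M N} [P.IsCrystallographic] (b : P.Base) :
    Subalgebra ℂ (RatFun P) :=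
  Algebra.adjoin ℂ (invOneSub P '' {i | b.IsPos i})

/-- The algebra `ℛ ⊗ S(𝔥)` of scalar differential operators with coefficients in `ℛ`,
generated by the multiplications by elements of `ℛ` and the derivations `∂_ξ`. -/
def diffOps {P : RootPairing ι ℝ M N} [P.IsCrystallographic] (b : P.Base) :
    Subalgebra ℂ (Module.End ℂ (RatFun P)) :=
  Algebra.adjoin ℂ (Algebra.lmul ℂ (RatFun P) '' (coeffAlg b : Set (RatFun P)) ∪
    Set.range (derivRat P))

/-- The algebra `ℛ ⊗ End(ℂ[W / W_I]) ⊗ S(𝔥)` of matrix-valued differential operators with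
coefficients in `ℛ ⊗ End(ℂ[W / W_I])`. -/
abbrev MatDiffOps {P : RootPairing ι ℝ M N} [P.IsCrystallographic] (b : P.Base)
    (I : Set b.support) : Type _ :=
  Matrix (Cosets b I) (Cosets b I) (diffOps b)

/-- The action of matrix-valued differential operators on vector-valued functions,
`(D Φ)_c = ∑_d D_{c d} Φ_d`. -/
def matAct [Finite ι] {P : RootPairing ι ℝ M N} [P.IsRootSystem] [P.IsCrystallographic]
    (b : P.Base) (I : Set b.support) (D : MatDiffOps b I) : Module.End ℂ (VecFun b I) :=
  LinearMap.pi fun c => ∑ d : Cosets b I, (D c d : Module.End ℂ (RatFun P)) ∘ₗ LinearMap.proj d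

/-- The space of matrix-valued differential-reflection operators `∑_w D_w ⊗ w`. -/
abbrev MatReflOps {P : RootPairing ι ℝ M N} [P.IsCrystallographic] (b : P.Base)
    (I : Set b.support) : Type _ :=
  P.weylGroup →₀ MatDiffOps b I

/-- The operator `Φ ↦ ∑_w D_w (w Φ)` given by `∑_w D_w ⊗ w`. -/
def reflAct [Finite ι] {P : RootPairing ι ℝ M N} [P.IsRootSystem] [P.IsCrystallographic]
    (b : P.Base) (I : Set b.support) (Q : MatReflOps b I) : Module.End ℂ (VecFun b I) :=
  Q.sum fun w D => matAct b I D * weylVec b I w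

/-- The map `β(∑_w D_w ⊗ w) = ∑_w D_w`. -/
def betaOp {P : RootPairing ι ℝ M N} [P.IsCrystallographic] (b : P.Base)
    (I : Set b.support) (Q : MatReflOps b I) : MatDiffOps b I :=
  Q.sum fun _ D => D

/-- The set `𝔻(I, k)` of all `β(γ(q(D(k))))`, `q ∈ S(𝔥)^{W_I}`. Here a differential-reflection
operator `∑_w D_w ⊗ w` is identified with the operator that it defines. -/
def opAlg [Fintype ι] {P : RootPairing ι ℝ M N} [P.IsRootSystem] [P.IsCrystallographic]
    (b : P.Base) (I : Set b.support) (k : ι → ℝ) : Set (MatDiffOps b I) :=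
  {D | ∃ T ∈ invOperators b I k, ∃ Q : MatReflOps b I,
    reflAct b I Q = gammaOp b I T ∧ D = betaOp b I Q}

end JacobiPoly

end

/-!
The proof rests on three properties of the Cherednik operators `D_ξ(k)` on `ℂ[P]`.

*Triangularity* (`triangular_tensor`, `stableSet_domRep_le`). In terms of the divided differences
`(1 - e^{-α})⁻¹ (1 - s_α)`, which map `e^μ` to a sum over the `α`-string from `μ` to `s_α μ`, a
polynomial `q(D(k))` maps `e^μ` to `q` evaluated at the spectral vector
`μ + ½ ∑_{α > 0} (±k_α) α` of `μ`, times `e^μ`, plus a combination of `e^ν` with `ν < μ`. In the same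
way it respects the ordering of the dominant representatives for `W_I`.

*Adjoints* (`IsWeightFunctional.cherednik_adjoint`, `isWeightFunctional`). For real `ξ` the
operator `D_ξ(k)` is self-adjoint for the inner product. This is an integration by parts on the
torus. The weight function is not differentiable where it vanishes, so it is replaced by the smooth
functions `∏_α (|1 - e^{-α}|² + ε)^{k_α / 2}`; for `ε > 0` the reflections `s_α` turn the
logarithmic derivative into divided differences, and dominated convergence gives the limit
`ε → 0`. The algebraic part of the argument uses only the properties of the integral collected in
`IsWeightFunctional`.

*Separation* (`exists_tensor_separating`). The spectral vector of `μ` is conjugate to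
`-(ν + ρ(k))`, where `ν` is the dominant weight conjugate to `-μ`. As `k_α ≥ 0`, the vector `ρ(k)`
is dominant, and weights in distinct `W_I`-orbits have spectral vectors in distinct
`W_I`-orbits. These are separated by elements of `S(𝔥)^{W_I}`.

The ordering is a partial ordering with finite lower sets, and the form is definite, so the Jacobi
polynomials exist, are unique, and form a basis of `ℂ[P]^{W_I}`
(`exists_isOrthogonalTop`, `IsOrthogonalTop.unique`, `IsOrthogonalTop.span_eq`). An operator
`q(D(k))` that commutes with `W_I` is triangular together with its adjoint, hence multiplies each
of them by a scalar (`IsOrthogonalTop.map_tensor`), which is the value of `q` at a spectral vector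
(`IsOrthogonalTop.eigenvalue`). With `I = ∅`, this shows that the Cherednik operators commute
(`commute_cherednikLaurent`): they are simultaneously diagonalized by the nonsymmetric Jacobi
polynomials.

On the side of the operators, distinct elements of `W` are linearly independent over the
differential operators with rational coefficients (`coeff_unique`, from
`eq_zero_of_sum_mul_weylEnd`): passing from `T = ∑_w D_w w` to `T f - v(f) T`, for a function `f`,
lowers the order of `D_v` and does not raise the others, which reduces the claim to the
independence of the homomorphisms `f ↦ w f`. Hence identities between differential-reflection
operators may be checked on `ℂ[P]`, and an element of `𝔻_{I,ℛ} ⊗ ℂ[W]` is determined by its action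
(`reflAct_injective`). The relation between `D_ξ(k)` and simple reflections
(`weylEnd_mul_cherednik`) shows that `q(D(k))` commutes with `W_I` for `q ∈ S(𝔥)^{W_I}`
(`commute_weylEnd_of_weylSym`). For such operators `T ↦ β(γ(T))` is multiplicative
(`opMatrix_mul`), and it intertwines the action on `ℂ[P]^{W_I}` with the action on invariant
vector-valued functions by way of `Γ` (`matAct_opMatrix_gammaVec`). This transports the statements
about `p_I(λ, k)` to `P_I(λ, k)`.
-/

noncomputable section

set_option linter.unusedSectionVars false

namespace JacobiPoly

open RootPairing

section WeylCombinatorics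

variable {ι M N : Type*} [AddCommGroup M] [Module ℝ M] [AddCommGroup N] [Module ℝ N]
  {P : RootPairing ι ℝ M N}

/-! ### Reflections and positive roots -/

local notation "σ" => RootPairing.weylGroup.ofIdx P

theorem weylGroupToPerm_eq_smul (w : P.weylGroup) (i : ι) : P.weylGroupToPerm w i = w • i :=
  rfl

theorem smul_root (w : P.weylGroup) (i : ι) : w • P.root i = P.root (w • i) :=
  P.weylGroup_apply_root w i

theorem ofIdx_smul_idx (i j : ι) : σ i • j = P.reflectionPerm i j := by
  change (Equiv.reflection P i : P.Aut).indexEquiv j = _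
  rw [Equiv.reflection_indexEquiv]

theorem ofIdx_smul_apply (i : ι) (x : M) : σ i • x = x - P.coroot' i x • P.root i :=
  P.reflection_apply i x

theorem coroot'_smul (w : P.weylGroup) (i : ι) (x : M) :
    P.coroot' i (w • x) = P.coroot' (w⁻¹ • i) x :=
  coroot'_weyl_smul P w i x

theorem weyl_ext [P.IsRootSystem] {v w : P.weylGroup} (h : ∀ x : M, v • x = w • x) : v = w := by
  apply Subtype.ext
  apply RootPairing.Equiv.weightHom_injective P
  ext x
  exact h x

theorem ofIdx_mul_self [P.IsRootSystem] (i : ι) : σ i * σ i = 1 := by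
  refine weyl_ext fun x => ?_
  rw [mul_smul, ofIdx_smul_apply, ofIdx_smul_apply, map_sub, map_smul]
  simp only [root_coroot'_eq_pairing, pairing_same, smul_eq_mul, one_smul]
  module

theorem ofIdx_inv [P.IsRootSystem] (i : ι) : (σ i)⁻¹ = σ i :=
  inv_eq_of_mul_eq_one_left (ofIdx_mul_self i)

theorem ofIdx_smul_ofIdx_smul [P.IsRootSystem] {X : Type*} [MulAction P.weylGroup X] (i : ι)
    (x : X) : σ i • σ i • x = x := by
  rw [smul_smul, ofIdx_mul_self, one_smul]

theorem ofIdx_smul_eq [P.IsRootSystem] (w : P.weylGroup) (i : ι) :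
    σ (w • i) = w * σ i * w⁻¹ := by
  refine weyl_ext fun x => ?_
  have h : w • (w⁻¹ • x) = x := smul_inv_smul w x
  rw [mul_smul, mul_smul, ofIdx_smul_apply, ofIdx_smul_apply, smul_sub,
    smul_comm w (P.coroot' i (w⁻¹ • x)), smul_root, h, coroot'_smul, inv_inv]

theorem root_neg (i : ι) : P.root (P.reflectionPerm i i) = -P.root i := by
  simp

variable (b : P.Base)

theorem not_isPos_neg_iff {i : ι} : ¬ b.IsPos (P.reflectionPerm i i) ↔ b.IsPos i := by
  have := Base.IsPos.neg_iff_not b i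
  exact (not_congr this).trans not_not

theorem isPos_neg_iff {i : ι} : b.IsPos (P.reflectionPerm i i) ↔ ¬ b.IsPos i :=
  Base.IsPos.neg_iff_not b i

theorem smul_neg_idx (w : P.weylGroup) (i : ι) :
    w • P.reflectionPerm i i = P.reflectionPerm (w • i) (w • i) := by
  apply P.root.injective
  rw [root_neg, ← smul_root, root_neg, smul_neg, smul_root]

theorem coroot'_neg (i : ι) (x : M) : P.coroot' (P.reflectionPerm i i) x = - P.coroot' i x := by
  rw [← ofIdx_smul_idx]
  have h := coroot'_smul (P := P) (σ i)⁻¹ i x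
  rw [inv_inv] at h
  rw [← h]
  have h2 : (σ i)⁻¹ • x = x - P.coroot' i x • P.root i := by
    rw [inv_smul_eq_iff, ofIdx_smul_apply, map_sub, map_smul]
    simp only [root_coroot'_eq_pairing, pairing_same, smul_eq_mul]
    module
  rw [h2, map_sub, map_smul]
  simp only [root_coroot'_eq_pairing, pairing_same, smul_eq_mul]
  ring

variable [P.IsRootSystem]

/-- The cone of vectors whose coordinates in the basis of simple roots are nonnegative. -/
def posCone : AddSubmonoid M where
  carrier := {x | ∀ j, 0 ≤ b.toWeightBasis.repr x j}
  add_mem' hx hy j := by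
    rw [map_add, Finsupp.add_apply]
    exact add_nonneg (hx j) (hy j)
  zero_mem' j := by simp

theorem smul_mem_posCone {c : ℝ} (hc : 0 ≤ c) {x : M} (hx : x ∈ posCone b) :
    c • x ∈ posCone b := fun j => by
  rw [map_smul, Finsupp.smul_apply]
  exact mul_nonneg hc (hx j)

theorem eq_zero_of_mem_posCone {x : M} (hx : x ∈ posCone b) (hx' : -x ∈ posCone b) : x = 0 := by
  apply b.toWeightBasis.repr.injective
  ext j
  have h1 := hx j
  have h2 := hx' j
  rw [map_neg, Finsupp.neg_apply] at h2
  rw [map_zero, Finsupp.zero_apply]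
  linarith

theorem closure_le_posCone : AddSubmonoid.closure (P.root '' b.support) ≤ posCone b := by
  rw [AddSubmonoid.closure_le]
  rintro _ ⟨i, hi, rfl⟩ j
  classical
  have := b.toWeightBasis_repr_root ⟨i, hi⟩
  rw [this, Finsupp.single_apply]
  split_ifs <;> norm_num

/-- The linear functional that is `1` on the simple roots. -/
def heightFun : M →ₗ[ℝ] ℝ :=
  b.toWeightBasis.constr ℝ fun _ => (1 : ℝ)

theorem heightFun_root (i : ι) : heightFun b (P.root i) = b.height i := by
  obtain ⟨f, -, -, hf⟩ := b.exists_root_eq_sum_int i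
  rw [Base.height_eq_sum hf, hf, map_sum]
  push_cast
  refine Finset.sum_congr rfl fun j hj => ?_
  have : heightFun b (P.root j) = 1 := by
    have := b.toWeightBasis.constr_basis ℝ (fun _ => (1 : ℝ)) ⟨j, hj⟩
    rwa [Base.toWeightBasis_apply] at this
  rw [map_zsmul, this]
  simp

theorem isPos_iff_heightFun (i : ι) : b.IsPos i ↔ 0 < heightFun b (P.root i) := by
  rw [heightFun_root, Base.isPos_iff, Int.cast_pos]

theorem heightFun_nonneg {x : M} (hx : x ∈ posCone b) : 0 ≤ heightFun b x := by
  rw [heightFun, Module.Basis.constr_apply_fintype]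
  refine Finset.sum_nonneg fun j _ => ?_
  have := hx j
  simpa [Module.Basis.equivFun_apply] using this

theorem root_mem_closure {i : ι} (hi : b.IsPos i) :
    P.root i ∈ AddSubmonoid.closure (P.root '' b.support) := by
  refine (b.root_mem_or_neg_mem i).resolve_right fun h => ?_
  have := heightFun_nonneg b (closure_le_posCone b h)
  rw [isPos_iff_heightFun] at hi
  rw [map_neg] at this
  linarith

variable [Finite ι]

/-- A simple reflection permutes the positive roots other than the simple root itself. -/
theorem isPos_ofIdx_smul {i j : ι} (hi : b.IsPos i) (hj : j ∈ b.support) (hij : i ≠ j) :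
    b.IsPos (σ j • i) := by
  classical
  have : IsAddTorsionFree M := .of_isTorsionFree ℝ M
  have : IsAddTorsionFree N := .of_isTorsionFree ℝ N
  by_contra hneg
  rw [← isPos_neg_iff] at hneg
  have h1 := closure_le_posCone b (root_mem_closure b hi)
  have h2 := closure_le_posCone b (root_mem_closure b hneg)
  rw [root_neg, ← smul_root, ofIdx_smul_apply] at h2
  -- All coordinates of the root other than the one at `j` vanish.
  have h3 : ∀ l : b.support, l ≠ ⟨j, hj⟩ → b.toWeightBasis.repr (P.root i) l = 0 := by
    intro l hl
    have h4 := h2 l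
    have h5 := h1 l
    rw [map_neg, map_sub, map_smul, b.toWeightBasis_repr_root ⟨j, hj⟩] at h4
    simp only [Finsupp.neg_apply, Finsupp.sub_apply, Finsupp.smul_apply,
      Finsupp.single_eq_of_ne hl, smul_zero, sub_zero] at h4
    linarith
  have h6 : P.root i = b.toWeightBasis.repr (P.root i) ⟨j, hj⟩ • P.root j := by
    apply b.toWeightBasis.repr.injective
    ext l
    rw [map_smul, b.toWeightBasis_repr_root ⟨j, hj⟩, Finsupp.smul_apply]
    rcases eq_or_ne l ⟨j, hj⟩ with rfl | hl
    · simp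
    · rw [h3 l hl, Finsupp.single_eq_of_ne hl, smul_zero]
  rcases b.eq_one_or_neg_one_of_mem_support_of_smul_mem j hj _ ⟨i, h6⟩ with h | h
  · rw [h, one_smul] at h6
    exact hij (P.root.injective h6)
  · have := h1 ⟨j, hj⟩
    rw [h] at this
    norm_num at this

/-! ### Words in simple reflections -/

/-- The Weyl group element given by a word in the simple reflections. -/
def wordProd (l : List b.support) : P.weylGroup :=
  (l.map fun i : b.support => σ i).prod

theorem wordProd_cons (j : b.support) (l : List b.support) :
    wordProd b (j :: l) = σ j * wordProd b l := by
  simp [wordProd]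

theorem wordProd_append (l l' : List b.support) :
    wordProd b (l ++ l') = wordProd b l * wordProd b l' := by
  simp [wordProd]

theorem wordProd_singleton (j : b.support) : wordProd b [j] = σ j := by
  simp [wordProd]

/-- The exchange condition: if `w = s₁ ⋯ sₙ` maps the positive root `α` to a negative one, then
`w s_α` is obtained from the word `s₁ ⋯ sₙ` by deleting one letter. -/
theorem exists_sublist_of_not_isPos {i : ι} (hi : b.IsPos i) :
    ∀ l : List b.support, ¬ b.IsPos (wordProd b l • i) →
      ∃ l' : List b.support, l'.Sublist l ∧ l'.length < l.length ∧
        wordProd b l' = wordProd b l * σ i := by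
  intro l
  induction l with
  | nil => intro h; simp [wordProd, hi] at h
  | cons j t ih =>
    intro h
    by_cases ht : b.IsPos (wordProd b t • i)
    · rw [wordProd_cons, mul_smul] at h
      have hj : wordProd b t • i = j := by
        by_contra hne
        exact h (isPos_ofIdx_smul b ht j.2 hne)
      refine ⟨t, List.sublist_cons_self _ _, by simp, ?_⟩
      have h2 := ofIdx_smul_eq (wordProd b t) i
      rw [hj] at h2
      rw [wordProd_cons, h2, mul_assoc, mul_assoc, inv_mul_cancel_left, mul_assoc, ofIdx_mul_self,
        mul_one]
    · obtain ⟨l', h1, h2, h3⟩ := ih ht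
      exact ⟨j :: l', h1.cons_cons _, by simpa using h2, by
        rw [wordProd_cons, wordProd_cons, h3, mul_assoc]⟩

variable [P.IsCrystallographic]

/-- A positive root that is not simple has a positive pairing with some simple root `α`, and `s_α`
lowers its height; hence all reflections are words in the simple ones. -/
theorem exists_wordProd_eq_ofIdx {i : ι} (hi : b.IsPos i) :
    ∃ l : List b.support, wordProd b l = σ i := by
  generalize hN : (b.height i).natAbs = n
  induction n using Nat.strongRecOn generalizing i with
  | ind n ih =>
    obtain ⟨j, hj, hj'⟩ := hi.exists_mem_support_pos_pairingIn
    rw [P.zero_lt_pairingIn_iff'] at hj'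
    rcases eq_or_ne i j with rfl | hij
    · exact ⟨[⟨i, hj⟩], by rw [wordProd_singleton]⟩
    have hk := isPos_ofIdx_smul b hi hj hij
    have hlt : b.height (σ j • i) < b.height i := by
      have := P.reflection_apply_root' ℤ (i := j) (j := i)
      rw [← root_reflectionPerm, sub_eq_add_neg, ← neg_smul] at this
      rw [ofIdx_smul_idx, b.height_add_zsmul this, Base.height_one_of_mem_support hj]
      simpa using hj'
    rw [Base.isPos_iff] at hk hi
    obtain ⟨l, hl⟩ := ih _ (by lia) (Base.isPos_iff b |>.2 hk) rfl
    refine ⟨[⟨j, hj⟩] ++ l ++ [⟨j, hj⟩], ?_⟩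
    rw [wordProd_append, wordProd_append, wordProd_singleton, hl, ofIdx_smul_eq, ofIdx_inv]
    simp only [mul_assoc, ofIdx_mul_self, mul_one]
    rw [← mul_assoc, ofIdx_mul_self, one_mul]

theorem ofIdx_neg (i : ι) : σ (P.reflectionPerm i i) = σ i := by
  rw [← ofIdx_smul_idx, ofIdx_smul_eq, mul_inv_cancel_right]

theorem exists_wordProd (w : P.weylGroup) : ∃ l : List b.support, wordProd b l = w := by
  obtain ⟨w, hw⟩ := w
  induction hw using weylGroup.induction with
  | mem i =>
    by_cases hi : b.IsPos i
    · exact exists_wordProd_eq_ofIdx b hi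
    · obtain ⟨l, hl⟩ := exists_wordProd_eq_ofIdx b ((isPos_neg_iff b).2 hi)
      exact ⟨l, hl.trans (ofIdx_neg i)⟩
  | one => exact ⟨[], rfl⟩
  | mul x y hx hy h1 h2 =>
    obtain ⟨l, hl⟩ := h1
    obtain ⟨l', hl'⟩ := h2
    exact ⟨l ++ l', by rw [wordProd_append, hl, hl']; rfl⟩

theorem weylLength_wordProd_le (l : List b.support) : weylLength b (wordProd b l) ≤ l.length :=
  Nat.sInf_le ⟨l, rfl, rfl⟩

theorem exists_reduced_word (w : P.weylGroup) :
    ∃ l : List b.support, l.length = weylLength b w ∧ wordProd b l = w := by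
  obtain ⟨l, hl⟩ := exists_wordProd b w
  exact Nat.sInf_mem (s := {n | ∃ l : List b.support, l.length = n ∧
    (l.map fun i : b.support => σ i).prod = w}) ⟨_, l, rfl, hl⟩

theorem weylLength_mul_lt {w : P.weylGroup} {i : ι} (hi : b.IsPos i) (h : ¬ b.IsPos (w • i)) :
    weylLength b (w * σ i) < weylLength b w := by
  obtain ⟨l, hl, rfl⟩ := exists_reduced_word b w
  obtain ⟨l', -, h2, h3⟩ := exists_sublist_of_not_isPos b hi l h
  rw [← h3, ← hl]
  exact (weylLength_wordProd_le b l').trans_lt h2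

variable {b} {I : Set b.support}

theorem exists_wordProd_of_mem_parabolic {w : P.weylGroup} (hw : w ∈ parabolic b I) :
    ∃ l : List b.support, (∀ j ∈ l, j ∈ I) ∧ wordProd b l = w := by
  induction hw using Subgroup.closure_induction'' with
  | one => exact ⟨[], by simp, rfl⟩
  | mem x hx =>
    obtain ⟨j, hj, rfl⟩ := hx
    exact ⟨[j], by simpa using hj, wordProd_singleton b j⟩
  | inv_mem x hx =>
    obtain ⟨j, hj, rfl⟩ := hx
    exact ⟨[j], by simpa using hj, (wordProd_singleton b j).trans (ofIdx_inv (j : ι)).symm⟩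
  | mul x y _ _ h1 h2 =>
    obtain ⟨l, hl, hl'⟩ := h1
    obtain ⟨m, hm, hm'⟩ := h2
    refine ⟨l ++ m, fun j hj => ?_, by rw [wordProd_append, hl', hm']⟩
    rcases List.mem_append.1 hj with h | h
    exacts [hl j h, hm j h]

theorem ofIdx_mem_parabolic {j : b.support} (hj : j ∈ I) : σ (j : ι) ∈ parabolic b I :=
  Subgroup.subset_closure ⟨j, hj, rfl⟩

theorem wordProd_mem_parabolic {l : List b.support} (hl : ∀ j ∈ l, j ∈ I) :
    wordProd b l ∈ parabolic b I := by
  induction l with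
  | nil => exact one_mem _
  | cons j t ih =>
    rw [wordProd_cons]
    exact mul_mem (ofIdx_mem_parabolic (hl j (by simp))) (ih fun k hk => hl k (by simp [hk]))

/-- Induction along reduced words in a parabolic subgroup: it suffices to multiply from the right
with simple reflections that increase the length. -/
theorem parabolic_induction {p : P.weylGroup → Prop} (one : p 1)
    (mul : ∀ w ∈ parabolic b I, ∀ j ∈ I, b.IsPos (w • (j : ι)) → p w → p (w * σ (j : ι)))
    {w : P.weylGroup} (hw : w ∈ parabolic b I) : p w := by
  obtain ⟨l, hl, rfl⟩ := exists_wordProd_of_mem_parabolic hw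
  clear hw
  generalize hn : l.length = n
  induction n using Nat.strongRecOn generalizing l with
  | ind n ih =>
    rcases List.eq_nil_or_concat l with rfl | ⟨t, j, rfl⟩
    · exact one
    have ht : ∀ k ∈ t, k ∈ I := fun k hk => hl k (by simp [hk])
    have hj : j ∈ I := hl j (by simp)
    rw [List.concat_eq_append] at hn ⊢
    rw [List.length_append, List.length_singleton] at hn
    rw [wordProd_append, wordProd_singleton]
    by_cases h : b.IsPos (wordProd b t • (j : ι))
    · exact mul _ (wordProd_mem_parabolic ht) j hj h (ih t.length (by lia) t ht rfl)
    · obtain ⟨l', h1, h2, h3⟩ := exists_sublist_of_not_isPos b (Base.isPos_of_mem_support j.2) t h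
      rw [← h3]
      exact ih l'.length (by lia) l' (fun k hk => ht k (h1.subset hk)) rfl

variable (b) in
theorem parabolic_univ : parabolic b Set.univ = ⊤ := by
  rw [eq_top_iff]
  intro w _
  obtain ⟨l, rfl⟩ := exists_wordProd b w
  exact wordProd_mem_parabolic fun _ _ => trivial

variable (b) in
theorem parabolic_empty : parabolic b ∅ = ⊥ := by
  simp [parabolic]

theorem mem_posRoots_of_mem {j : b.support} (hj : j ∈ I) : (j : ι) ∈ posRoots b I :=
  ⟨Base.isPos_of_mem_support j.2, ofIdx_mem_parabolic hj⟩

/-- A non-trivial element of a parabolic subgroup maps one of its simple roots to a negative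
root. -/
theorem eq_one_or_exists_not_isPos {w : P.weylGroup} (hw : w ∈ parabolic b I) :
    w = 1 ∨ ∃ j ∈ I, ¬ b.IsPos (w • ((j : b.support) : ι)) := by
  refine parabolic_induction (p := fun w => w = 1 ∨ ∃ j ∈ I, ¬ b.IsPos (w • ((j : b.support) : ι)))
    (Or.inl rfl) (fun w _ j hj h _ => Or.inr ⟨j, hj, ?_⟩) hw
  rwa [mul_smul, ofIdx_smul_idx, smul_neg_idx, not_isPos_neg_iff]

theorem eq_one_of_forall_isPos {w : P.weylGroup} (h : ∀ i, b.IsPos i → b.IsPos (w • i)) :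
    w = 1 := by
  have hw : w ∈ parabolic b Set.univ := by rw [parabolic_univ]; trivial
  refine (eq_one_or_exists_not_isPos hw).resolve_right ?_
  rintro ⟨j, -, hj⟩
  exact hj (h _ (Base.isPos_of_mem_support j.2))

/-- The parabolic subgroup permutes the positive roots that do not belong to it. -/
theorem isPos_smul_of_notMem_parabolic {w : P.weylGroup} (hw : w ∈ parabolic b I) {i : ι}
    (hi : b.IsPos i) (hi' : σ i ∉ parabolic b I) : b.IsPos (w • i) := by
  obtain ⟨l, hl, rfl⟩ := exists_wordProd_of_mem_parabolic hw
  clear hw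
  induction l with
  | nil => simpa [wordProd] using hi
  | cons j t ih =>
    have ht : ∀ k ∈ t, k ∈ I := fun k hk => hl k (by simp [hk])
    have h := ih ht
    rw [wordProd_cons, mul_smul]
    refine isPos_ofIdx_smul b h j.2 fun hj => hi' ?_
    have h2 := ofIdx_smul_eq (wordProd b t) i
    rw [hj] at h2
    have h3 : σ i = (wordProd b t)⁻¹ * σ (j : ι) * wordProd b t := by
      rw [h2]; group
    rw [h3]
    have := wordProd_mem_parabolic ht
    exact mul_mem (mul_mem (inv_mem this) (ofIdx_mem_parabolic (hl j (by simp)))) this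

theorem ofIdx_smul_mem_parabolic {w : P.weylGroup} (hw : w ∈ parabolic b I) {i : ι} :
    σ (w • i) ∈ parabolic b I ↔ σ i ∈ parabolic b I := by
  rw [ofIdx_smul_eq]
  constructor
  · intro h
    have := mul_mem (mul_mem (inv_mem hw) h) hw
    rwa [mul_assoc, mul_assoc, mul_assoc, inv_mul_cancel_left, inv_mul_cancel, mul_one] at this
  · intro h
    exact mul_mem (mul_mem hw h) (inv_mem hw)

/-! ### Coset representatives -/

theorem minReps_unique {v v' : P.weylGroup} (hv : v ∈ minReps b I) (hv' : v' ∈ minReps b I)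
    (h : v⁻¹ * v' ∈ parabolic b I) : v = v' := by
  rcases eq_one_or_exists_not_isPos h with h1 | ⟨j, hj, hneg⟩
  · exact (inv_mul_eq_one.1 h1)
  · exfalso
    rw [← isPos_neg_iff, ← smul_neg_idx] at hneg
    have h2 := hv _ ⟨hneg, (ofIdx_smul_mem_parabolic h).2 (by
      rw [ofIdx_neg]; exact ofIdx_mem_parabolic hj)⟩
    rw [weylGroupToPerm_eq_smul, smul_smul, mul_inv_cancel_left, smul_neg_idx, isPos_neg_iff] at h2
    exact h2 (hv' _ (mem_posRoots_of_mem hj))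

/-- As long as `w` maps a positive root `α` of `W_I` to a negative root, `w s_α` is a shorter
element of the same coset. -/
theorem exists_mem_minReps (w : P.weylGroup) :
    ∃ v ∈ minReps b I, w⁻¹ * v ∈ parabolic b I := by
  generalize hn : weylLength b w = n
  induction n using Nat.strongRecOn generalizing w with
  | ind n ih =>
    by_cases hw : w ∈ minReps b I
    · exact ⟨w, hw, by simp⟩
    · have : ∃ i ∈ posRoots b I, ¬ b.IsPos (w • i) := by
        by_contra! h
        exact hw h
      obtain ⟨i, hi, hneg⟩ := this
      obtain ⟨v, hv, hv'⟩ := ih _ (hn ▸ weylLength_mul_lt b hi.1 hneg) _ rfl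
      refine ⟨v, hv, ?_⟩
      have := mul_mem hi.2 hv'
      rwa [mul_inv_rev, ofIdx_inv, ← mul_assoc, ← mul_assoc, ofIdx_mul_self, one_mul] at this

end WeylCombinatorics

section Order

variable {ι M N : Type*} [AddCommGroup M] [Module ℝ M] [AddCommGroup N] [Module ℝ N]
  {P : RootPairing ι ℝ M N} [P.IsRootSystem] [Finite ι] [P.IsCrystallographic]
  {b : P.Base} {I : Set b.support}

local notation "σ" => RootPairing.weylGroup.ofIdx P

/-! ### Dominant weights -/

theorem coe_ofIdx_smul (i : ι) (x : weightLattice P) :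
    ((σ i • x : weightLattice P) : M) = (x : M) - P.coroot' i (x : M) • P.root i :=
  ofIdx_smul_apply i (x : M)

/-- The integer `x(α^∨)` for a weight `x`. -/
def pairInt (i : ι) (x : weightLattice P) : ℤ := (x.2 i).choose

theorem coe_pairInt (i : ι) (x : weightLattice P) : (pairInt i x : ℝ) = P.coroot' i (x : M) :=
  (x.2 i).choose_spec.symm

theorem pairInt_smul (w : P.weylGroup) (i : ι) (x : weightLattice P) :
    pairInt i (w • x) = pairInt (w⁻¹ • i) x := by
  have : (pairInt i (w • x) : ℝ) = pairInt (w⁻¹ • i) x := by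
    rw [coe_pairInt, coe_pairInt, coe_weyl_smul, coroot'_smul]
  exact_mod_cast this

theorem pairInt_add (i : ι) (x y : weightLattice P) :
    pairInt i (x + y) = pairInt i x + pairInt i y := by
  have : (pairInt i (x + y) : ℝ) = pairInt i x + pairInt i y := by
    simp only [coe_pairInt, AddSubgroup.coe_add, map_add]
  exact_mod_cast this

theorem pairInt_neg (i : ι) (x : weightLattice P) : pairInt i (-x) = -pairInt i x := by
  have : (pairInt i (-x) : ℝ) = -pairInt i x := by
    simp only [coe_pairInt, AddSubgroup.coe_neg, map_neg]
  exact_mod_cast this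

theorem pairInt_zsmul (i : ι) (n : ℤ) (x : weightLattice P) :
    pairInt i (n • x) = n * pairInt i x := by
  have : (pairInt i (n • x) : ℝ) = n * pairInt i x := by
    simp only [coe_pairInt, AddSubgroup.coe_zsmul, map_zsmul, zsmul_eq_mul]
  exact_mod_cast this

theorem pairInt_rootWeight_self (i : ι) : pairInt i (rootWeight P i) = 2 := by
  have : (pairInt i (rootWeight P i) : ℝ) = 2 := by
    rw [coe_pairInt]; simp [rootWeight]
  exact_mod_cast this

theorem ofIdx_smul_weight (i : ι) (x : weightLattice P) :
    σ i • x = x - pairInt i x • rootWeight P i := by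
  apply Subtype.ext
  rw [coe_ofIdx_smul, AddSubgroup.coe_sub, AddSubgroup.coe_zsmul, ← coe_pairInt,
    Int.cast_smul_eq_zsmul]
  rfl

theorem smul_zsmul_weight (w : P.weylGroup) (n : ℤ) (x : weightLattice P) :
    w • (n • x) = n • (w • x) :=
  map_zsmul (DistribSMul.toAddMonoidHom (weightLattice P) w) n x

theorem smul_rootWeight (w : P.weylGroup) (i : ι) :
    w • rootWeight P i = rootWeight P (w • i) :=
  Subtype.ext (smul_root w i)

theorem rootWeight_neg (i : ι) : rootWeight P (P.reflectionPerm i i) = -rootWeight P i :=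
  Subtype.ext (root_neg i)

theorem pairInt_neg_idx (i : ι) (x : weightLattice P) :
    pairInt (P.reflectionPerm i i) x = -pairInt i x := by
  have : (pairInt (P.reflectionPerm i i) x : ℝ) = -pairInt i x := by
    rw [coe_pairInt, coe_pairInt, coroot'_neg]
  exact_mod_cast this

theorem weight_ext {x y : weightLattice P} (h : ∀ j ∈ b.support, pairInt j x = pairInt j y) :
    x = y := by
  apply Subtype.ext
  apply P.toPerfPair.injective
  refine b.toCoweightBasis.ext fun j => ?_
  rw [Base.toCoweightBasis_apply]
  have := h j j.2
  have h2 : (pairInt (j : ι) x : ℝ) = pairInt (j : ι) y := by rw [this]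
  rw [coe_pairInt, coe_pairInt] at h2
  exact h2

theorem mem_domWeights {x : weightLattice P} :
    x ∈ domWeights b I ↔ ∀ i ∈ posRoots b I, 0 ≤ pairInt i x :=
  forall₂_congr fun i _ => by rw [← coe_pairInt, Int.cast_nonneg_iff]

theorem mem_dominant {x : weightLattice P} :
    x ∈ dominant b ↔ ∀ i, b.IsPos i → 0 ≤ pairInt i x :=
  forall₂_congr fun i _ => by rw [← coe_pairInt, Int.cast_nonneg_iff]

variable (b) in
theorem posRoots_univ : posRoots b Set.univ = {i | b.IsPos i} := by
  ext i
  simp [posRoots, parabolic_univ]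

variable (b) in
theorem domWeights_univ : domWeights b Set.univ = dominant b := by
  ext x
  rw [mem_domWeights, mem_dominant, posRoots_univ]
  rfl

variable (b) in
/-- There is no condition of dominance if `I` is empty, so that `p_∅` are the nonsymmetric Jacobi
polynomials. -/
theorem domWeights_empty : domWeights b ∅ = Set.univ := by
  ext x
  rw [mem_domWeights]
  simp only [Set.mem_univ, iff_true]
  intro i hi
  have h2 := hi.2
  rw [parabolic_empty, Subgroup.mem_bot] at h2
  have h3 := ofIdx_smul_weight i (rootWeight P i)
  rw [h2, one_smul, pairInt_rootWeight_self] at h3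
  have h4 : rootWeight P i = 0 := by
    have h5 : (2 : ℤ) • rootWeight P i = 0 := sub_eq_self.1 h3.symm
    rw [two_zsmul] at h5
    have h6 : (2 : ℝ) • P.root i = 0 := by
      rw [two_smul]
      exact congrArg Subtype.val h5
    exact Subtype.ext ((smul_eq_zero.1 h6).resolve_left two_ne_zero)
  exact absurd (congrArg Subtype.val h4) (P.ne_zero i)

theorem sub_smul_mem (C : AddSubmonoid M) {x : M}
    (h : ∀ j ∈ I, ∀ i, b.IsPos i → P.coroot' (j : b.support) x • P.root i ∈ C)
    {w : P.weylGroup} (hw : w ∈ parabolic b I) : x - w • x ∈ C := by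
  refine parabolic_induction (p := fun w => x - w • x ∈ C) (by simp) (fun w _ j hj hpos hx => ?_) hw
  have h2 : x - (w * σ (j : ι)) • x = (x - w • x) + P.coroot' (j : ι) x • P.root (w • (j : ι)) := by
    rw [mul_smul, ofIdx_smul_apply, smul_sub, smul_comm w (P.coroot' (j : ι) x), smul_root]
    abel
  rw [h2]
  exact add_mem hx (h j hj _ hpos)

theorem sub_smul_mem_posCone {x : M}
    (h : ∀ i, b.IsPos i → 0 ≤ P.coroot' i x) (w : P.weylGroup) :
    x - w • x ∈ posCone b :=
  sub_smul_mem (I := Set.univ) (posCone b) (fun j _ i hi =>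
    smul_mem_posCone b (h _ (Base.isPos_of_mem_support j.2))
      (closure_le_posCone b (root_mem_closure b hi)))
    (by rw [parabolic_univ]; trivial)

theorem zsmul_root_mem_closure {i : ι} (hi : b.IsPos i) {n : ℤ} (hn : 0 ≤ n) :
    n • P.root i ∈ AddSubmonoid.closure (P.root '' b.support) := by
  lift n to ℕ using hn
  rw [natCast_zsmul]
  exact AddSubmonoid.nsmul_mem _ (root_mem_closure b hi) n

theorem sub_smul_mem_closure {x : weightLattice P} (hx : x ∈ domWeights b I) {w : P.weylGroup}
    (hw : w ∈ parabolic b I) :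
    (x : M) - w • (x : M) ∈ AddSubmonoid.closure (P.root '' b.support) :=
  sub_smul_mem _ (fun j hj i hi => by
    rw [← coe_pairInt, Int.cast_smul_eq_zsmul]
    exact zsmul_root_mem_closure hi (mem_domWeights.1 hx _ (mem_posRoots_of_mem hj))) hw

theorem sub_smul_mem_closure' {x : weightLattice P} (hx : x ∈ dominant b) (w : P.weylGroup) :
    (x : M) - w • (x : M) ∈ AddSubmonoid.closure (P.root '' b.support) :=
  sub_smul_mem_closure (I := Set.univ) (by rwa [domWeights_univ]) (by rw [parabolic_univ]; trivial)

theorem domWeights_unique {x : weightLattice P} {w : P.weylGroup} (hw : w ∈ parabolic b I)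
    (hx : x ∈ domWeights b I) (hx' : w • x ∈ domWeights b I) : w • x = x := by
  have h1 := closure_le_posCone b (sub_smul_mem_closure hx hw)
  have h2 := closure_le_posCone b (sub_smul_mem_closure hx' (inv_mem hw))
  rw [coe_weyl_smul, inv_smul_smul, ← neg_sub] at h2
  exact Subtype.ext (sub_eq_zero.1 (eq_zero_of_mem_posCone b h1 h2)).symm

theorem dominant_unique {x : weightLattice P} {w : P.weylGroup}
    (hx : x ∈ dominant b) (hx' : w • x ∈ dominant b) : w • x = x := by
  rw [← domWeights_univ] at hx hx'
  exact domWeights_unique (by rw [parabolic_univ]; trivial) hx hx'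

theorem exists_smul_mem_domWeights (I : Set b.support) (x : weightLattice P) :
    ∃ w ∈ parabolic b I, w • x ∈ domWeights b I := by
  -- A weight of maximal height in the orbit is dominant.
  obtain ⟨w, hw, hmax⟩ := Set.exists_max_image (parabolic b I : Set P.weylGroup)
    (fun w => heightFun b ((w • x : weightLattice P) : M)) (Set.toFinite _) ⟨1, one_mem _⟩
  refine ⟨w, hw, mem_domWeights.2 fun i hi => ?_⟩
  by_contra! hneg
  have h := hmax (σ i * w) (mul_mem hi.2 hw)
  simp only [mul_smul] at h
  rw [coe_ofIdx_smul, map_sub, map_smul, ← coe_pairInt, smul_eq_mul] at h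
  have h1 := (isPos_iff_heightFun b i).1 hi.1
  have h2 : (pairInt i (w • x) : ℝ) < 0 := by exact_mod_cast hneg
  nlinarith

variable (b) in
theorem exists_smul_mem_dominant (x : weightLattice P) : ∃ w : P.weylGroup, w • x ∈ dominant b := by
  obtain ⟨w, -, hw⟩ := exists_smul_mem_domWeights (b := b) Set.univ x
  exact ⟨w, by rwa [domWeights_univ] at hw⟩

/-! ### Shortest elements and the Bruhat ordering -/

/-- `v` is the representative of the coset `v Stab(x)` that maps the positive roots orthogonal to
the dominant weight `x` to positive roots. -/
def MinAt (b : P.Base) (v : P.weylGroup) (x : weightLattice P) : Prop :=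
  ∀ i, b.IsPos i → pairInt i x = 0 → b.IsPos (v • i)

/-- The inversions of a minimal element are determined by the extremal weight `v x`. -/
theorem MinAt.isPos_iff {v : P.weylGroup} {x : weightLattice P} (hv : MinAt b v x)
    (hx : x ∈ dominant b) {i : ι} (hi : b.IsPos i) :
    b.IsPos (v⁻¹ • i) ↔ 0 ≤ pairInt i (v • x) := by
  rw [pairInt_smul]
  constructor
  · intro h
    exact mem_dominant.1 hx _ h
  · intro h
    by_contra hneg
    rw [← isPos_neg_iff] at hneg
    have h1 := mem_dominant.1 hx _ hneg
    rw [pairInt_neg_idx] at h1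
    have h2 := hv _ hneg (by rw [pairInt_neg_idx]; lia)
    rw [smul_neg_idx, smul_inv_smul, isPos_neg_iff] at h2
    exact h2 hi

theorem MinAt.unique {v u : P.weylGroup} {x : weightLattice P} (hv : MinAt b v x)
    (hu : MinAt b u x) (hx : x ∈ dominant b) (h : v • x = u • x) : v = u := by
  have key : ∀ i, b.IsPos i → (b.IsPos (v⁻¹ • i) ↔ b.IsPos (u⁻¹ • i)) := fun i hi => by
    rw [hv.isPos_iff hx hi, hu.isPos_iff hx hi, h]
  have key2 : ∀ i, (b.IsPos (v⁻¹ • i) ↔ b.IsPos (u⁻¹ • i)) := fun i => by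
    by_cases hi : b.IsPos i
    · exact key i hi
    · have := key _ ((isPos_neg_iff b).2 hi)
      rw [smul_neg_idx, smul_neg_idx, isPos_neg_iff, isPos_neg_iff] at this
      exact not_iff_not.1 this
  have h1 : u⁻¹ * v = 1 := eq_one_of_forall_isPos (b := b) fun i hi => by
    rw [mul_smul, ← key2, inv_smul_smul]
    exact hi
  exact (inv_mul_eq_one.1 h1).symm

theorem IsShortest.minAt {v : P.weylGroup} {x y : weightLattice P} (h : IsShortest b v x y) :
    MinAt b v x := by
  intro i hi h0
  by_contra hneg
  have h1 := weylLength_mul_lt b hi hneg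
  have h2 := h.2 (v * σ i) (by
    rw [mul_smul, ofIdx_smul_weight, h0, zero_smul, sub_zero]; exact h.1)
  lia

theorem exists_isShortest {x y : weightLattice P} {u : P.weylGroup} (h : u • x = y) :
    ∃ v, IsShortest b v x y := by
  obtain ⟨v, hv, hmin⟩ := Set.exists_min_image {v : P.weylGroup | v • x = y} (weylLength b)
    (Set.toFinite _) ⟨u, h⟩
  exact ⟨v, hv, hmin⟩

theorem MinAt.isShortest {v : P.weylGroup} {x : weightLattice P} (h : MinAt b v x)
    (hx : x ∈ dominant b) : IsShortest b v x (v • x) := by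
  obtain ⟨u, hu⟩ := exists_isShortest (b := b) (u := v) (x := x) rfl
  have := hu.minAt.unique h hx hu.1
  rwa [this] at hu

theorem IsShortest.unique {v u : P.weylGroup} {x y : weightLattice P} (hx : x ∈ dominant b)
    (hv : IsShortest b v x y) (hu : IsShortest b u x y) : v = u :=
  hv.minAt.unique hu.minAt hx (hv.1.trans hu.1.symm)

theorem bruhatLE_of_lt {u w : P.weylGroup} (i : ι) (h : w = u * σ i)
    (hlt : weylLength b u < weylLength b w) : bruhatLE b u w :=
  Relation.ReflTransGen.single ⟨i, h, hlt⟩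

theorem bruhatLE.eq_or_lt {u w : P.weylGroup} (h : bruhatLE b u w) :
    u = w ∨ weylLength b u < weylLength b w := by
  induction h with
  | refl => exact Or.inl rfl
  | tail _ h ih =>
    obtain ⟨i, -, hlt⟩ := h
    rcases ih with rfl | ih
    · exact Or.inr hlt
    · exact Or.inr (ih.trans hlt)

theorem bruhatLE.antisymm {u w : P.weylGroup} (h : bruhatLE b u w) (h' : bruhatLE b w u) :
    u = w := by
  rcases h.eq_or_lt with h1 | h1
  · exact h1
  rcases h'.eq_or_lt with h2 | h2
  · exact h2.symm
  · lia

/-- The shortest element of a coset of the stabilizer is below all others in the Bruhat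
ordering. -/
theorem exists_isShortest_bruhatLE {x : weightLattice P} (hx : x ∈ dominant b)
    (u : P.weylGroup) : ∃ v, IsShortest b v x (u • x) ∧ bruhatLE b v u := by
  generalize hn : weylLength b u = n
  induction n using Nat.strongRecOn generalizing u with
  | ind n ih =>
    by_cases hu : MinAt b u x
    · exact ⟨u, hu.isShortest hx, .refl⟩
    · unfold MinAt at hu
      push Not at hu
      obtain ⟨i, hi, h0, hneg⟩ := hu
      have hlt := weylLength_mul_lt b hi hneg
      obtain ⟨v, hv, hv'⟩ := ih _ (hn ▸ hlt) _ rfl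
      rw [mul_smul, ofIdx_smul_weight, h0, zero_smul, sub_zero] at hv
      refine ⟨v, hv, Relation.ReflTransGen.trans hv' (bruhatLE_of_lt i ?_ hlt)⟩
      rw [mul_assoc, ofIdx_mul_self, mul_one]

/-! ### The ordering on the weight lattice -/

variable (b) in
theorem exists_dominant_isShortest (x : weightLattice P) :
    ∃ x0 ∈ dominant b, ∃ v, IsShortest b v x0 x := by
  obtain ⟨w, hw⟩ := exists_smul_mem_dominant b x
  exact ⟨_, hw, exists_isShortest (inv_smul_smul w x)⟩

theorem weightLE_refl (x : weightLattice P) : weightLE b x x := by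
  obtain ⟨x0, hx0, v, hv⟩ := exists_dominant_isShortest b x
  exact ⟨x0, hx0, x0, hx0, v, v, hv, hv, by rw [sub_self]; exact zero_mem _, fun _ => .refl⟩

theorem dominant_eq_of_smul_eq {x y z : weightLattice P} (hx : x ∈ dominant b)
    (hy : y ∈ dominant b) {v u : P.weylGroup} (hv : v • x = z) (hu : u • y = z) : x = y := by
  have h : y = (u⁻¹ * v) • x := by rw [mul_smul, hv, ← hu, inv_smul_smul]
  rw [h] at hy ⊢
  exact (dominant_unique hx hy).symm

theorem weightLE_trans {x y z : weightLattice P} (h : weightLE b x y) (h' : weightLE b y z) :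
    weightLE b x z := by
  obtain ⟨x0, hx0, y0, hy0, v, u, hv, hu, h1, h2⟩ := h
  obtain ⟨y1, hy1, z0, hz0, u', t, hu', ht, h3, h4⟩ := h'
  obtain rfl := dominant_eq_of_smul_eq hy0 hy1 hu.1 hu'.1
  obtain rfl := hu.unique hy0 hu'
  have h5 := add_mem h1 h3
  rw [add_comm, sub_add_sub_cancel] at h5
  refine ⟨x0, hx0, z0, hz0, v, t, hv, ht, h5, fun h6 => ?_⟩
  subst h6
  have h7 : (y0 : M) - x0 = 0 := by
    refine eq_zero_of_mem_posCone b (closure_le_posCone b h1) ?_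
    rw [neg_sub]
    exact closure_le_posCone b h3
  obtain rfl : x0 = y0 := Subtype.ext (sub_eq_zero.1 h7).symm
  exact (h2 rfl).trans (h4 rfl)

theorem weightLE_antisymm {x y : weightLattice P} (h : weightLE b x y) (h' : weightLE b y x) :
    x = y := by
  obtain ⟨x0, hx0, y0, hy0, v, u, hv, hu, h1, h2⟩ := h
  obtain ⟨y1, hy1, x1, hx1, u', v', hu', hv', h3, h4⟩ := h'
  obtain rfl := dominant_eq_of_smul_eq hy0 hy1 hu.1 hu'.1
  obtain rfl := dominant_eq_of_smul_eq hx0 hx1 hv.1 hv'.1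
  obtain rfl := hu.unique hy0 hu'
  obtain rfl := hv.unique hx0 hv'
  have h7 : (y0 : M) - x0 = 0 := by
    refine eq_zero_of_mem_posCone b (closure_le_posCone b h1) ?_
    rw [neg_sub]
    exact closure_le_posCone b h3
  obtain rfl : x0 = y0 := Subtype.ext (sub_eq_zero.1 h7).symm
  rw [← hv.1, ← hu.1, (h2 rfl).antisymm (h4 rfl)]

/-- Reflecting a weight towards the dominant chamber makes it smaller. -/
theorem weightLE_ofIdx_smul {i : ι} (hi : b.IsPos i) {x : weightLattice P}
    (hx : pairInt i x ≤ 0) : weightLE b (σ i • x) x := by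
  rcases hx.eq_or_lt with h0 | hx
  · rw [ofIdx_smul_weight, h0, zero_smul, sub_zero]
    exact weightLE_refl x
  obtain ⟨x0, hx0, v, hv⟩ := exists_dominant_isShortest b x
  have hneg : ¬ b.IsPos (v⁻¹ • i) := by
    rw [hv.minAt.isPos_iff hx0 hi, hv.1]
    lia
  have hlt := weylLength_mul_lt b (w := v) ((isPos_neg_iff b).2 hneg) (by
    rw [smul_neg_idx, smul_inv_smul, not_isPos_neg_iff]; exact hi)
  have heq : v * σ (P.reflectionPerm (v⁻¹ • i) (v⁻¹ • i)) = σ i * v := by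
    rw [ofIdx_neg, ofIdx_smul_eq, inv_inv]
    group
  rw [heq] at hlt
  obtain ⟨u, hu, hu'⟩ := exists_isShortest_bruhatLE hx0 (σ i * v)
  rw [mul_smul, hv.1] at hu
  refine ⟨x0, hx0, x0, hx0, u, v, hu, hv, by rw [sub_self]; exact zero_mem _, fun _ => ?_⟩
  refine hu'.trans (bruhatLE_of_lt (P.reflectionPerm (v⁻¹ • i) (v⁻¹ • i)) ?_ hlt)
  rw [← heq, mul_assoc, ofIdx_mul_self, mul_one]

/-- The dominant weights in the orbits of `x` and `y` are different and their difference is a sum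
of simple roots. -/
def domLT (b : P.Base) (x y : weightLattice P) : Prop :=
  ∃ x0 ∈ dominant b, ∃ y0 ∈ dominant b, (∃ v : P.weylGroup, v • x = x0) ∧
    (∃ v : P.weylGroup, v • y = y0) ∧
    (y0 : M) - (x0 : M) ∈ AddSubmonoid.closure (P.root '' b.support) ∧ x0 ≠ y0

theorem domLT.weightLE {x y : weightLattice P} (h : domLT b x y) : weightLE b x y := by
  obtain ⟨x0, hx0, y0, hy0, ⟨v, rfl⟩, ⟨u, rfl⟩, h1, h2⟩ := h
  obtain ⟨v', hv'⟩ := exists_isShortest (b := b) (inv_smul_smul v x)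
  obtain ⟨u', hu'⟩ := exists_isShortest (b := b) (inv_smul_smul u y)
  exact ⟨_, hx0, _, hy0, v', u', hv', hu', h1, fun h => absurd h h2⟩

theorem domLT.smul {x y : weightLattice P} (h : domLT b x y) (v u : P.weylGroup) :
    domLT b (v • x) (u • y) := by
  obtain ⟨x0, hx0, y0, hy0, ⟨v', rfl⟩, ⟨u', rfl⟩, h1, h2⟩ := h
  exact ⟨_, hx0, _, hy0, ⟨v' * v⁻¹, by rw [mul_smul, inv_smul_smul]⟩,
    ⟨u' * u⁻¹, by rw [mul_smul, inv_smul_smul]⟩, h1, h2⟩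

/-- The interior points of a root string are strictly smaller than its end points. -/
theorem domLT_sub_zsmul (b : P.Base) {i : ι} {x : weightLattice P} {n : ℤ} (h0 : 0 < n)
    (hn : n < pairInt i x) : domLT b (x - n • rootWeight P i) x := by
  obtain ⟨w, hw⟩ := exists_smul_mem_dominant b (x - n • rootWeight P i)
  obtain ⟨u, hu⟩ := exists_smul_mem_dominant b x
  -- One of the two end points of the string is larger than the interior point after applying `w`.
  have key : ∀ v : P.weylGroup, ∀ j, b.IsPos j → ∀ m : ℤ, 0 < m →
      w • (x - n • rootWeight P i) = v • x - m • rootWeight P j →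
      domLT b (x - n • rootWeight P i) x := by
    intro v j hj m hm heq
    refine ⟨_, hw, _, hu, ⟨w, rfl⟩, ⟨u, rfl⟩, ?_, fun h => ?_⟩
    · have h1 := sub_smul_mem_closure' hu (v * u⁻¹)
      have h2 := add_mem h1 (zsmul_root_mem_closure hj hm.le)
      have h3 : ((v * u⁻¹) • ((u • x : weightLattice P) : M)) = ((v • x : weightLattice P) : M) := by
        rw [← coe_weyl_smul, mul_smul, inv_smul_smul]
      rw [h3] at h2
      rw [heq]
      convert h2 using 1
      rw [AddSubgroup.coe_sub, AddSubgroup.coe_zsmul]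
      change _ - (_ - m • P.root j) = _
      abel
    · have h1 := closure_le_posCone b (sub_smul_mem_closure' hu (v * u⁻¹))
      have h2 := closure_le_posCone b (zsmul_root_mem_closure hj hm.le)
      have h3 : ((v * u⁻¹) • ((u • x : weightLattice P) : M)) = ((v • x : weightLattice P) : M) := by
        rw [← coe_weyl_smul, mul_smul, inv_smul_smul]
      rw [h3, ← h, heq, AddSubgroup.coe_sub, AddSubgroup.coe_zsmul, sub_sub_cancel_left] at h1
      have h4 := eq_zero_of_mem_posCone b h2 h1
      rw [← Int.cast_smul_eq_zsmul ℝ, smul_eq_zero] at h4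
      rcases h4 with h4 | h4
      · have : m = 0 := by exact_mod_cast h4
        lia
      · exact P.ne_zero j h4
  by_cases hp : b.IsPos (w • i)
  · refine key w (w • i) hp n h0 ?_
    rw [smul_sub, smul_zsmul_weight, smul_rootWeight]
  · refine key (w * σ i) (P.reflectionPerm (w • i) (w • i)) ((isPos_neg_iff b).2 hp)
      (pairInt i x - n) (by lia) ?_
    rw [mul_smul, ofIdx_smul_weight, rootWeight_neg, ← smul_rootWeight, smul_sub, smul_sub,
      smul_zsmul_weight, smul_zsmul_weight, smul_neg, sub_smul]
    abel

/-! ### Finiteness of lower sets -/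

theorem rootForm_nonneg_of_mem_closure [Fintype ι] {z : M}
    (hz : ∀ i, b.IsPos i → 0 ≤ P.coroot' i z) {v : M}
    (hv : v ∈ AddSubmonoid.closure (P.root '' b.support)) : 0 ≤ P.RootForm v z := by
  induction hv using AddSubmonoid.closure_induction with
  | mem v hv =>
    obtain ⟨i, hi, rfl⟩ := hv
    have h2 := congrArg (fun t => P.toLinearMap z t) (P.rootForm_self_smul_coroot i)
    simp only [map_smul, map_nsmul, toLinearMap_apply_apply_Polarization] at h2
    have h3 : 0 ≤ P.RootForm (P.root i) (P.root i) := P.zero_le_rootForm _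
    have h4 : 0 ≤ P.toLinearMap z (P.coroot i) := hz i (Base.isPos_of_mem_support hi)
    have h5 := mul_nonneg h3 h4
    rw [← smul_eq_mul, h2, nsmul_eq_mul] at h5
    simpa using h5
  | zero => simp
  | add u v _ _ hu hv => rw [map_add, LinearMap.add_apply]; exact add_nonneg hu hv

/-- The length of a dominant weight below `y` is at most that of `y`. -/
theorem finite_dominant_le {y : weightLattice P} (hy : y ∈ dominant b) :
    {x : weightLattice P | x ∈ dominant b ∧
      (y : M) - (x : M) ∈ AddSubmonoid.closure (P.root '' b.support)}.Finite := by
  classical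
  have := Fintype.ofFinite ι
  set B : ℤ := ∑ i, pairInt i y * pairInt i y with hB
  refine Set.Finite.of_finite_image (f := fun x (j : b.support) => pairInt (j : ι) x) ?_ ?_
  · refine (Set.finite_Icc (fun _ : b.support => -B) (fun _ => B)).subset ?_
    rintro _ ⟨x, ⟨hx, hle⟩, rfl⟩
    -- The canonical form is nonnegative on `y - x` and `y + x`, so that `|x|² ≤ |y|²`.
    have h1 : 0 ≤ P.RootForm ((y : M) - x) ((x : M) + y) :=
      rootForm_nonneg_of_mem_closure (fun i hi => by
        rw [map_add]; exact add_nonneg (hx i hi) (hy i hi)) hle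
    have h2 : ∑ i, pairInt i x * pairInt i x ≤ B := by
      rw [hB]
      have h3 : (0 : ℝ) ≤ ∑ i, (pairInt i y * pairInt i y - pairInt i x * pairInt i x : ℝ) := by
        convert h1 using 1
        rw [rootForm_apply_apply]
        refine Finset.sum_congr rfl fun i _ => ?_
        rw [map_sub, map_add, coe_pairInt, coe_pairInt]
        ring
      rw [Finset.sum_sub_distrib, sub_nonneg] at h3
      exact_mod_cast h3
    have h3 : ∀ i, pairInt i x * pairInt i x ≤ B := fun i =>
      (Finset.single_le_sum (f := fun i => pairInt i x * pairInt i x)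
        (fun i _ => mul_self_nonneg _) (Finset.mem_univ i)).trans h2
    exact ⟨fun j => by have := h3 j; change -B ≤ pairInt (j : ι) x; nlinarith,
      fun j => by have := h3 j; change pairInt (j : ι) x ≤ B; nlinarith⟩
  · intro x _ x' _ h
    exact weight_ext fun j hj => congrFun h ⟨j, hj⟩

variable (b) in
theorem finite_weightLE (y : weightLattice P) : {x | weightLE b x y}.Finite := by
  obtain ⟨y0, hy0, v, hv⟩ := exists_dominant_isShortest b y
  refine ((finite_dominant_le hy0).biUnion
    fun x0 _ => Set.finite_range fun w : P.weylGroup => w • x0).subset ?_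
  rintro x ⟨x0, hx0, y1, hy1, u, v', hu, hv', h1, -⟩
  obtain rfl := dominant_eq_of_smul_eq hy0 hy1 hv.1 hv'.1
  exact Set.mem_biUnion ⟨hx0, h1⟩ ⟨u, hu.1⟩

/-! ### The ordering on dominant weights of a parabolic subgroup -/

/-- The `W_I`-dominant weight in the `W_I`-orbit of `x`. -/
def domRep (b : P.Base) (I : Set b.support) (x : weightLattice P) : weightLattice P :=
  (exists_smul_mem_domWeights I x).choose • x

theorem domRep_mem (x : weightLattice P) : domRep b I x ∈ domWeights b I :=
  (exists_smul_mem_domWeights I x).choose_spec.2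

theorem exists_domRep_eq (x : weightLattice P) :
    ∃ w ∈ parabolic b I, domRep b I x = w • x :=
  ⟨_, (exists_smul_mem_domWeights I x).choose_spec.1, rfl⟩

theorem domRep_eq_of_mem {x : weightLattice P} {w : P.weylGroup} (hw : w ∈ parabolic b I)
    (hx : w • x ∈ domWeights b I) : domRep b I x = w • x := by
  obtain ⟨v, hv, h⟩ := exists_domRep_eq (I := I) x
  have h1 : domRep b I x = (v * w⁻¹) • (w • x) := by rw [h, mul_smul, inv_smul_smul]
  rw [h1]
  exact domWeights_unique (mul_mem hv (inv_mem hw)) hx (h1 ▸ domRep_mem x)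

theorem domRep_of_mem {x : weightLattice P} (hx : x ∈ domWeights b I) : domRep b I x = x := by
  have := domRep_eq_of_mem (x := x) (one_mem _) (by rwa [one_smul])
  rwa [one_smul] at this

theorem domRep_smul {x : weightLattice P} {w : P.weylGroup} (hw : w ∈ parabolic b I) :
    domRep b I (w • x) = domRep b I x := by
  obtain ⟨v, hv, h⟩ := exists_domRep_eq (I := I) x
  have h1 : (v * w⁻¹) • (w • x) = domRep b I x := by rw [h, mul_smul, inv_smul_smul]
  rw [← h1]
  exact domRep_eq_of_mem (mul_mem hv (inv_mem hw)) (h1 ▸ domRep_mem x)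

/-- The `W_I`-dominant weight is the smallest one in its `W_I`-orbit. -/
theorem domRep_weightLE (x : weightLattice P) : weightLE b (domRep b I x) x := by
  -- The reflections of a shorter and shorter word move the weight to larger ones.
  suffices h : ∀ z ∈ domWeights b I, ∀ w ∈ parabolic b I, weightLE b z (w • z) by
    obtain ⟨w, hw, h1⟩ := exists_domRep_eq (I := I) x
    have := h _ (domRep_mem x) w⁻¹ (inv_mem hw)
    rwa [h1, inv_smul_smul, ← h1] at this
  intro z hz w hw
  refine parabolic_induction (p := fun w => weightLE b z (w • z)) ?_ ?_ hw
  · rw [one_smul]; exact weightLE_refl z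
  · intro w _ j hj hpos ih
    refine weightLE_trans ih ?_
    have h1 : w • z = σ (w • (j : ι)) • ((w * σ (j : ι)) • z) := by
      rw [smul_smul, ofIdx_smul_eq, ← mul_assoc, inv_mul_cancel_right, mul_assoc, ofIdx_mul_self,
        mul_one]
    nth_rewrite 1 [h1]
    refine weightLE_ofIdx_smul hpos ?_
    rw [pairInt_smul, mul_inv_rev, mul_smul, inv_smul_smul, ofIdx_inv, ofIdx_smul_idx,
      pairInt_neg_idx]
    have := mem_domWeights.1 hz _ (mem_posRoots_of_mem hj)
    lia

/-- Reflecting towards the dominant chamber makes the `W_I`-dominant representative smaller. -/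
theorem weightLE_domRep_ofIdx_smul {i : ι} (hi : b.IsPos i) {x : weightLattice P}
    (hx : pairInt i x ≤ 0) : weightLE b (domRep b I (σ i • x)) (domRep b I x) := by
  by_cases hiI : σ i ∈ parabolic b I
  · rw [domRep_smul hiI]
    exact weightLE_refl _
  · obtain ⟨w, hw, h1⟩ := exists_domRep_eq (I := I) x
    have h2 : domRep b I (σ i • x) = domRep b I (σ (w • i) • domRep b I x) := by
      have : σ (w • i) • domRep b I x = w • (σ i • x) := by
        rw [ofIdx_smul_eq, h1, mul_smul, mul_smul, inv_smul_smul]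
      rw [this, domRep_smul hw]
    rw [h2]
    refine weightLE_trans (domRep_weightLE _)
      (weightLE_ofIdx_smul (isPos_smul_of_notMem_parabolic hw hi hiI) ?_)
    rwa [h1, pairInt_smul, inv_smul_smul]

theorem weightLE_domRep_of_domLT {x y : weightLattice P} (h : domLT b x y) :
    weightLE b (domRep b I x) (domRep b I y) := by
  obtain ⟨w, -, h1⟩ := exists_domRep_eq (I := I) x
  obtain ⟨v, -, h2⟩ := exists_domRep_eq (I := I) y
  rw [h1, h2]
  exact (h.smul w v).weightLE

end Order

section Laurent

variable {ι M N : Type*} [AddCommGroup M] [Module ℝ M] [AddCommGroup N] [Module ℝ N]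
  {P : RootPairing ι ℝ M N}

local notation "σ" => RootPairing.weylGroup.ofIdx P

/-! ### Laurent polynomials -/

theorem smul_expo (c : ℂ) (μ : weightLattice P) :
    c • expo P μ = AddMonoidAlgebra.single μ c := by
  rw [expo, AddMonoidAlgebra.smul_single, smul_eq_mul, mul_one]

theorem expo_zero : expo P 0 = 1 := rfl

theorem expo_add (μ ν : weightLattice P) : expo P (μ + ν) = expo P μ * expo P ν := by
  rw [expo, expo, expo, AddMonoidAlgebra.single_mul_single, one_mul]

theorem expo_mul_expo_neg (μ : weightLattice P) : expo P μ * expo P (-μ) = 1 := by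
  rw [← expo_add, add_neg_cancel, expo_zero]

theorem expo_injective : Function.Injective (expo P) :=
  AddMonoidAlgebra.single_left_injective one_ne_zero

theorem coeff_expo (μ ν : weightLattice P) [Decidable (μ = ν)] :
    (expo P μ).coeff ν = if μ = ν then 1 else 0 := by
  classical
  rw [expo, AddMonoidAlgebra.coeff_single, Finsupp.single_apply]

theorem coeff_expo_self (μ : weightLattice P) : (expo P μ).coeff μ = 1 := by
  classical
  rw [coeff_expo, if_pos rfl]

@[elab_as_elim]
theorem laurent_induction {p : LaurentPoly P → Prop} (f : LaurentPoly P)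
    (smul : ∀ (c : ℂ) μ, p (c • expo P μ)) (add : ∀ f g, p f → p g → p (f + g)) : p f := by
  induction f using AddMonoidAlgebra.induction_linear with
  | zero => simpa using smul 0 0
  | add f g hf hg => exact add f g hf hg
  | single μ c => rw [← smul_expo]; exact smul c μ

/-- The linear map on `ℂ[P]` with prescribed values on the exponentials. -/
def laurentLift {X : Type*} [AddCommGroup X] [Module ℂ X] (v : weightLattice P → X) :
    LaurentPoly P →ₗ[ℂ] X :=
  Finsupp.linearCombination ℂ v ∘ₗ (AddMonoidAlgebra.coeffLinearEquiv ℂ).toLinearMap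

theorem laurentLift_expo {X : Type*} [AddCommGroup X] [Module ℂ X] (v : weightLattice P → X)
    (μ : weightLattice P) : laurentLift v (expo P μ) = v μ := by
  simp [laurentLift, expo]

theorem weylLaurent_expo (w : P.weylGroup) (μ : weightLattice P) :
    weylLaurent P w (expo P μ) = expo P (w • μ) := by
  simp [weylLaurent, expo]

theorem weylLaurent_one (f : LaurentPoly P) : weylLaurent P 1 f = f := by
  induction f using laurent_induction with
  | smul c μ => rw [map_smul, weylLaurent_expo, one_smul]
  | add f g hf hg => rw [map_add, hf, hg]

theorem weylLaurent_mul (v w : P.weylGroup) (f : LaurentPoly P) :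
    weylLaurent P (v * w) f = weylLaurent P v (weylLaurent P w f) := by
  induction f using laurent_induction with
  | smul c μ => rw [map_smul, map_smul, map_smul, weylLaurent_expo, weylLaurent_expo,
      weylLaurent_expo, mul_smul]
  | add f g hf hg => rw [map_add, map_add, map_add, hf, hg]

theorem coeff_weylLaurent (w : P.weylGroup) (f : LaurentPoly P) (μ : weightLattice P) :
    (weylLaurent P w f).coeff (w • μ) = f.coeff μ := by
  classical
  induction f using laurent_induction with
  | smul c ν =>
    rw [map_smul (weylLaurent P w), weylLaurent_expo, AddMonoidAlgebra.coeff_smul_apply,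
      AddMonoidAlgebra.coeff_smul_apply, coeff_expo, coeff_expo]
    simp only [smul_left_cancel_iff]
  | add f g hf hg =>
    rw [map_add (weylLaurent P w), AddMonoidAlgebra.coeff_add, AddMonoidAlgebra.coeff_add,
      Finsupp.add_apply, Finsupp.add_apply, hf, hg]

/-- The Laurent polynomials whose exponents lie in a given set of weights. -/
def suppIn (S : Set (weightLattice P)) : Submodule ℂ (LaurentPoly P) where
  carrier := {f | ∀ μ, f.coeff μ ≠ 0 → μ ∈ S}
  add_mem' {f g} hf hg μ h := by
    by_contra hμ
    have h1 : f.coeff μ = 0 := by_contra fun h => hμ (hf μ h)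
    have h2 : g.coeff μ = 0 := by_contra fun h => hμ (hg μ h)
    exact h (by rw [AddMonoidAlgebra.coeff_add, Finsupp.add_apply, h1, h2, add_zero])
  zero_mem' μ h := absurd rfl h
  smul_mem' c f hf μ h := hf μ fun h0 => h (by
    rw [AddMonoidAlgebra.coeff_smul_apply, h0, smul_zero])

theorem expo_mem_suppIn {S : Set (weightLattice P)} {μ : weightLattice P} (h : μ ∈ S) :
    expo P μ ∈ suppIn S := by
  classical
  intro ν hν
  rw [coeff_expo] at hν
  have : μ = ν := by by_contra h; exact hν (if_neg h)
  rwa [← this]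

theorem suppIn_mono {S S' : Set (weightLattice P)} (h : S ⊆ S') : suppIn S ≤ suppIn S' :=
  fun _ hf μ hμ => h (hf μ hμ)

theorem eq_sum_coeff (f : LaurentPoly P) :
    f = ∑ μ ∈ f.coeff.support, f.coeff μ • expo P μ := by
  conv_lhs => rw [← AddMonoidAlgebra.sum_coeff_single f]
  exact Finset.sum_congr rfl fun μ _ => (smul_expo _ _).symm

/-- A linear map preserves the Laurent polynomials with exponents in `S` if it does so for the
exponentials. -/
theorem map_suppIn {S S' : Set (weightLattice P)} {T : Module.End ℂ (LaurentPoly P)}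
    (h : ∀ μ ∈ S, T (expo P μ) ∈ suppIn S') {f : LaurentPoly P} (hf : f ∈ suppIn S) :
    T f ∈ suppIn S' := by
  rw [eq_sum_coeff f, map_sum]
  refine Submodule.sum_mem _ fun μ hμ => ?_
  rw [map_smul]
  exact Submodule.smul_mem _ _ (h μ (hf μ (Finsupp.mem_support_iff.1 hμ)))

/-- The derivations `∂_ξ` of `ℂ[P]`, as a linear function of `ξ`. -/
def derivLin (P : RootPairing ι ℝ M N) : CplxSpace N →ₗ[ℂ] Module.End ℂ (LaurentPoly P) where
  toFun ξ := derivLaurentLin P ξ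
  map_add' ξ η := LinearMap.ext fun f => derivLaurent_add P ξ η f
  map_smul' c ξ := LinearMap.ext fun f => derivLaurent_smul P c ξ f

theorem derivLin_expo (ξ : CplxSpace N) (μ : weightLattice P) :
    derivLin P ξ (expo P μ) = cplxFunctional P (μ : M) ξ • expo P μ := by
  rw [smul_expo]
  exact (derivLaurentLin_single P ξ μ 1).trans (by rw [mul_one])

theorem derivLin_mul (ξ : CplxSpace N) (f g : LaurentPoly P) :
    derivLin P ξ (f * g) = f * derivLin P ξ g + g * derivLin P ξ f :=
  (derivLaurent P ξ).leibniz f g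

theorem cplxFunctional_smul (c : ℝ) (x : M) :
    cplxFunctional P (c • x) = (c : ℂ) • cplxFunctional P x := by
  ext ξ
  simp [cplxFunctional, LinearMap.baseChange_smul, TensorProduct.smul_tmul', mul_comm]

/-- The complex linear functionals on `𝔥` attached to vectors, as an additive map. -/
def cplxFunctionalHom (P : RootPairing ι ℝ M N) : M →+ (CplxSpace N →ₗ[ℂ] ℂ) :=
  AddMonoidHom.mk' (cplxFunctional P) (cplxFunctional_add P)

theorem cplxFunctional_sub (x y : M) :
    cplxFunctional P (x - y) = cplxFunctional P x - cplxFunctional P y :=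
  map_sub (cplxFunctionalHom P) x y

theorem cplxFunctional_sum {κ : Type*} (s : Finset κ) (x : κ → M) :
    cplxFunctional P (∑ i ∈ s, x i) = ∑ i ∈ s, cplxFunctional P (x i) :=
  map_sum (cplxFunctionalHom P) x s

variable [P.IsCrystallographic]

/-- The difference `1 - e^{-α}`. -/
def oneSub (P : RootPairing ι ℝ M N) [P.IsCrystallographic] (i : ι) : LaurentPoly P :=
  1 - expo P (-rootWeight P i)

theorem oneSub_ne_zero (i : ι) : oneSub P i ≠ 0 := by
  intro h
  have h1 := expo_injective (expo_zero.trans (sub_eq_zero.1 h))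
  have h2 : rootWeight P i = 0 := neg_eq_zero.1 h1.symm
  exact P.ne_zero i (congrArg Subtype.val h2)

variable [P.IsRootSystem] [Finite ι] {b : P.Base}

/-! ### Divided differences -/

/-- The quotient `(e^μ - e^{s_α μ}) / (1 - e^{-α})`, an alternating sum over a root string. -/
def stringSum (i : ι) (μ : weightLattice P) : LaurentPoly P :=
  ∑ j ∈ Finset.range (pairInt i μ).toNat, expo P (μ - (j : ℤ) • rootWeight P i) -
    ∑ j ∈ Finset.range (-pairInt i μ).toNat, expo P (μ + ((j : ℤ) + 1) • rootWeight P i)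

/-- A telescoping sum. One of the two ranges in `stringSum` is empty, by truncation. -/
theorem oneSub_mul_stringSum (i : ι) (μ : weightLattice P) :
    oneSub P i * stringSum i μ = expo P μ - expo P (σ i • μ) := by
  have h1 : ∀ n : ℕ, oneSub P i * ∑ j ∈ Finset.range n, expo P (μ - (j : ℤ) • rootWeight P i) =
      expo P μ - expo P (μ - (n : ℤ) • rootWeight P i) := by
    intro n
    induction n with
    | zero => simp
    | succ n ih =>
      rw [Finset.sum_range_succ, mul_add, ih, oneSub, sub_mul, one_mul, ← expo_add]
      have : -rootWeight P i + (μ - (n : ℤ) • rootWeight P i) =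
          μ - ((n + 1 : ℕ) : ℤ) • rootWeight P i := by
        rw [Nat.cast_add, Nat.cast_one, add_smul, one_smul]; abel
      rw [this]
      abel
  have h2 : ∀ n : ℕ, oneSub P i *
      ∑ j ∈ Finset.range n, expo P (μ + ((j : ℤ) + 1) • rootWeight P i) =
      expo P (μ + (n : ℤ) • rootWeight P i) - expo P μ := by
    intro n
    induction n with
    | zero => simp
    | succ n ih =>
      rw [Finset.sum_range_succ, mul_add, ih, oneSub, sub_mul, one_mul, ← expo_add]
      have : -rootWeight P i + (μ + ((n : ℤ) + 1) • rootWeight P i) =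
          μ + (n : ℤ) • rootWeight P i := by
        rw [add_smul, one_smul]; abel
      rw [this, Nat.cast_add, Nat.cast_one]
      abel
  rw [stringSum, mul_sub, h1, h2, ofIdx_smul_weight]
  rcases le_total 0 (pairInt i μ) with h | h
  · rw [Int.toNat_of_nonneg h, Int.toNat_of_nonpos (neg_nonpos.2 h)]
    simp
  · rw [Int.toNat_of_nonneg (neg_nonneg.2 h), Int.toNat_of_nonpos h]
    simp [sub_eq_add_neg]

/-- The divided difference operator `f ↦ (f - s_α f) / (1 - e^{-α})` on `ℂ[P]`. -/
def divDiff (P : RootPairing ι ℝ M N) [P.IsCrystallographic] (i : ι) :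
    Module.End ℂ (LaurentPoly P) :=
  laurentLift (stringSum i)

theorem oneSub_mul_divDiff (i : ι) (f : LaurentPoly P) :
    oneSub P i * divDiff P i f = f - weylLaurent P (σ i) f := by
  induction f using laurent_induction with
  | smul c μ =>
    rw [map_smul, map_smul, divDiff, laurentLift_expo, mul_smul_comm, oneSub_mul_stringSum,
      weylLaurent_expo, smul_sub]
  | add f g hf hg =>
    rw [map_add, map_add, mul_add, hf, hg]
    abel

/-- The divided difference of `e^μ` involves the interior of the string from `μ` to `s_α μ`, and one
of its end points: `μ` if `μ(α^∨) > 0` and `s_α μ` if `μ(α^∨) < 0`. -/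
theorem divDiff_expo_mem {S : Set (weightLattice P)} {i : ι} {μ : weightLattice P}
    (h0 : 0 < pairInt i μ → μ ∈ S) (h1 : ∀ ν, domLT b ν μ → ν ∈ S)
    (h2 : pairInt i μ < 0 → σ i • μ ∈ S) : divDiff P i (expo P μ) ∈ suppIn S := by
  rw [divDiff, laurentLift_expo, stringSum]
  refine Submodule.sub_mem _ (Submodule.sum_mem _ fun j hj => ?_)
    (Submodule.sum_mem _ fun j hj => ?_)
  · have hj' : (j : ℤ) < pairInt i μ := Int.lt_toNat.1 (Finset.mem_range.1 hj)
    apply expo_mem_suppIn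
    rcases Nat.eq_zero_or_pos j with rfl | hpos
    · rw [Nat.cast_zero, zero_smul, sub_zero]
      exact h0 (by simpa using hj')
    · exact h1 _ (domLT_sub_zsmul b (by exact_mod_cast hpos) hj')
  · have hj' : (j : ℤ) < -pairInt i μ := Int.lt_toNat.1 (Finset.mem_range.1 hj)
    apply expo_mem_suppIn
    rcases (show (j : ℤ) + 1 ≤ -pairInt i μ by lia).eq_or_lt with h | h
    · rw [h, neg_smul, ← sub_eq_add_neg, ← ofIdx_smul_weight]
      exact h2 (by lia)
    · have := domLT_sub_zsmul b (i := P.reflectionPerm i i) (x := μ) (n := (j : ℤ) + 1) (by lia)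
        (by rw [pairInt_neg_idx]; exact h)
      rw [rootWeight_neg, smul_neg, sub_neg_eq_add] at this
      exact h1 _ this

theorem coeff_divDiff_expo_self {i : ι} {μ : weightLattice P} :
    (divDiff P i (expo P μ)).coeff μ = if 0 < pairInt i μ then 1 else 0 := by
  classical
  have hne : rootWeight P i ≠ 0 := fun h => P.ne_zero i (congrArg Subtype.val h)
  have hinj : ∀ n : ℤ, n • rootWeight P i = 0 → n = 0 := by
    intro n hn
    have h1 := congrArg (pairInt i) hn
    rw [pairInt_zsmul, pairInt_rootWeight_self] at h1
    have h0 := pairInt_zsmul i 0 (0 : weightLattice P)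
    rw [zero_smul, zero_mul] at h0
    lia
  rw [divDiff, laurentLift_expo, stringSum, AddMonoidAlgebra.coeff_sub, Finsupp.sub_apply,
    AddMonoidAlgebra.coeff_sum, AddMonoidAlgebra.coeff_sum, Finsupp.finsetSum_apply,
    Finsupp.finsetSum_apply]
  have h2 : ∑ j ∈ Finset.range (-pairInt i μ).toNat,
      (expo P (μ + ((j : ℤ) + 1) • rootWeight P i)).coeff μ = 0 := by
    refine Finset.sum_eq_zero fun j _ => ?_
    rw [coeff_expo, if_neg]
    intro h
    have := hinj _ (add_eq_left.1 h)
    lia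
  have h1 : ∀ j ∈ Finset.range (pairInt i μ).toNat,
      (expo P (μ - (j : ℤ) • rootWeight P i)).coeff μ = if j = 0 then 1 else 0 := by
    intro j _
    rw [coeff_expo]
    refine if_congr ⟨fun h => ?_, fun h => ?_⟩ rfl rfl
    · have := hinj _ (sub_eq_self.1 h)
      exact_mod_cast this
    · rw [h, Nat.cast_zero, zero_smul, sub_zero]
  rw [h2, sub_zero, Finset.sum_congr rfl h1, Finset.sum_ite_eq']
  refine if_congr ?_ rfl rfl
  rw [Finset.mem_range]
  lia

end Laurent

section CherednikLaurent

variable {ι M N : Type*} [Fintype ι] [AddCommGroup M] [Module ℝ M] [AddCommGroup N] [Module ℝ N]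
  {P : RootPairing ι ℝ M N} [P.IsRootSystem] [P.IsCrystallographic] {b : P.Base}
  {I : Set b.support} {k : ι → ℝ}

local notation "σ" => RootPairing.weylGroup.ofIdx P

/-! ### Cherednik operators on Laurent polynomials -/

/-- The Cherednik operators, as operators on `ℂ[P]`. -/
def cherednikLaurent (b : P.Base) (k : ι → ℝ) :
    CplxSpace N →ₗ[ℂ] Module.End ℂ (LaurentPoly P) :=
  open scoped Classical in
  derivLin P +
    ∑ i with b.IsPos i, (cplxFunctional P (P.root i)).smulRight ((k i : ℂ) • divDiff P i) -
    (cplxFunctional P (rhoVec b k)).smulRight 1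

open scoped Classical in
theorem cherednikLaurent_apply (ξ : CplxSpace N) (f : LaurentPoly P) :
    cherednikLaurent b k ξ f = derivLin P ξ f +
      ∑ i with b.IsPos i, (cplxFunctional P (P.root i) ξ * k i) • divDiff P i f -
      cplxFunctional P (rhoVec b k) ξ • f := by
  simp [cherednikLaurent, LinearMap.sum_apply, mul_smul]

/-- A set of weights is stable if it contains with `μ` all weights that can occur in the images of
`e^μ` under the divided differences of the positive roots. -/
def StableSet (b : P.Base) (S : Set (weightLattice P)) : Prop :=
  ∀ μ ∈ S, (∀ ν, domLT b ν μ → ν ∈ S) ∧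
    ∀ i, b.IsPos i → pairInt i μ < 0 → σ i • μ ∈ S

open scoped Classical in
theorem cherednikLaurent_mem_suppIn {S : Set (weightLattice P)} (hS : StableSet b S)
    (ξ : CplxSpace N) {f : LaurentPoly P} (hf : f ∈ suppIn S) :
    cherednikLaurent b k ξ f ∈ suppIn S := by
  refine map_suppIn (fun μ hμ => ?_) hf
  rw [cherednikLaurent_apply, derivLin_expo]
  refine Submodule.sub_mem _ (Submodule.add_mem _ (Submodule.smul_mem _ _ (expo_mem_suppIn hμ))
    (Submodule.sum_mem _ fun i hi => Submodule.smul_mem _ _ ?_))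
    (Submodule.smul_mem _ _ (expo_mem_suppIn hμ))
  exact divDiff_expo_mem (fun _ => hμ) (hS μ hμ).1 ((hS μ hμ).2 i (Finset.mem_filter.1 hi).2)

open scoped Classical in
/-- The spectral vector `μ + ∑_{α > 0, μ(α^∨) > 0} k_α α - ρ(k)`: the leading coefficient of the
Cherednik operator `D_ξ` at `e^μ` is its value at `ξ`. -/
def spectralVec (b : P.Base) (k : ι → ℝ) (μ : weightLattice P) : M :=
  (μ : M) + ∑ i with b.IsPos i, (if 0 < pairInt i μ then k i else 0) • P.root i - rhoVec b k

theorem coeff_cherednikLaurent_expo_self (ξ : CplxSpace N) (μ : weightLattice P) :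
    (cherednikLaurent b k ξ (expo P μ)).coeff μ = cplxFunctional P (spectralVec b k μ) ξ := by
  classical
  rw [cherednikLaurent_apply, derivLin_expo, spectralVec, cplxFunctional_sub, cplxFunctional_add,
    cplxFunctional_sum, AddMonoidAlgebra.coeff_sub, Finsupp.sub_apply, AddMonoidAlgebra.coeff_add,
    Finsupp.add_apply, AddMonoidAlgebra.coeff_sum, Finsupp.finsetSum_apply]
  simp only [AddMonoidAlgebra.coeff_smul_apply, coeff_expo_self, smul_eq_mul, mul_one,
    coeff_divDiff_expo_self, LinearMap.sub_apply, LinearMap.add_apply, LinearMap.sum_apply,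
    cplxFunctional_smul, LinearMap.smul_apply]
  congr 2
  refine Finset.sum_congr rfl fun i _ => ?_
  split_ifs <;> simp [mul_comm]

variable (b) in
/-- The weights smaller than or equal to `μ` form a stable set, also for the ordering of the
`W_I`-dominant representatives. -/
theorem stableSet_domRep_le (I : Set b.support) (x : weightLattice P) :
    StableSet b {μ | weightLE b (domRep b I μ) x} := fun _ hμ =>
  ⟨fun _ hν => weightLE_trans (weightLE_domRep_of_domLT hν) hμ, fun _ hi hneg =>
    weightLE_trans (weightLE_domRep_ofIdx_smul hi hneg.le) hμ⟩

variable (b) in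
theorem domRep_empty (x : weightLattice P) : domRep b ∅ x = x :=
  domRep_of_mem (by rw [domWeights_empty]; trivial)

variable (b) in
theorem stableSet_lt (x : weightLattice P) : StableSet b {μ | weightLE b μ x ∧ μ ≠ x} := by
  have h : StableSet b {μ | weightLE b μ x} := by
    have := stableSet_domRep_le b ∅ x
    simpa only [domRep_empty] using this
  have aux : ∀ μ ν, weightLE b μ x ∧ μ ≠ x → weightLE b ν μ → ν ≠ x := by
    rintro μ ν ⟨h1, h2⟩ h3 rfl
    exact h2 (weightLE_antisymm h1 h3)
  exact fun μ hμ => ⟨fun ν hν => ⟨(h μ hμ.1).1 ν hν, aux μ ν hμ hν.weightLE⟩,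
    fun i hi hneg => ⟨(h μ hμ.1).2 i hi hneg, aux μ _ hμ (weightLE_ofIdx_smul hi hneg.le)⟩⟩

theorem stable_tensor {S : Set (weightLattice P)} (hS : StableSet b S)
    (x : TensorAlgebra ℂ (CplxSpace N)) {f : LaurentPoly P} (hf : f ∈ suppIn S) :
    TensorAlgebra.lift ℂ (cherednikLaurent b k) x f ∈ suppIn S := by
  induction x using TensorAlgebra.induction generalizing f with
  | algebraMap c =>
    rw [AlgHom.commutes, Module.algebraMap_end_apply]
    exact Submodule.smul_mem _ _ hf
  | ι ξ => rw [TensorAlgebra.lift_ι_apply]; exact cherednikLaurent_mem_suppIn hS ξ hf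
  | mul x y hx hy => rw [map_mul]; exact hx (hy hf)
  | add x y hx hy => rw [map_add]; exact Submodule.add_mem _ (hx hf) (hy hf)

/-- Polynomials in the Cherednik operators are triangular, with eigenvalues the values of the
polynomial at the spectral vectors. -/
theorem triangular_tensor (x : TensorAlgebra ℂ (CplxSpace N)) (μ : weightLattice P) :
    TensorAlgebra.lift ℂ (cherednikLaurent b k) x (expo P μ) -
      TensorAlgebra.lift ℂ (cplxFunctional P (spectralVec b k μ)) x • expo P μ ∈
        suppIn {ν | weightLE b ν μ ∧ ν ≠ μ} := by
  induction x using TensorAlgebra.induction with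
  | algebraMap c =>
    rw [AlgHom.commutes, AlgHom.commutes, Module.algebraMap_end_apply, Algebra.algebraMap_self_apply,
      sub_self]
    exact zero_mem _
  | ι ξ =>
    rw [TensorAlgebra.lift_ι_apply, TensorAlgebra.lift_ι_apply]
    intro ν hν
    have hself := coeff_cherednikLaurent_expo_self (b := b) (k := k) ξ μ
    have hne : ν ≠ μ := by
      rintro rfl
      rw [AddMonoidAlgebra.coeff_sub, Finsupp.sub_apply, hself,
        AddMonoidAlgebra.coeff_smul_apply, coeff_expo_self, smul_eq_mul, mul_one, sub_self] at hν
      exact hν rfl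
    refine ⟨?_, hne⟩
    have h1 := stableSet_domRep_le b ∅ μ
    simp only [domRep_empty] at h1
    have h2 : expo P μ ∈ suppIn {ν | weightLE b ν μ} := expo_mem_suppIn (weightLE_refl μ)
    exact Submodule.sub_mem _ (cherednikLaurent_mem_suppIn h1 ξ h2) (Submodule.smul_mem _ _ h2) ν hν
  | mul x y hx hy =>
    have h1 := stable_tensor (k := k) (stableSet_lt b μ) x hy
    have h2 := Submodule.smul_mem _ (TensorAlgebra.lift ℂ (cplxFunctional P (spectralVec b k μ)) y) hx
    have h3 := Submodule.add_mem _ h1 h2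
    convert h3 using 1
    rw [map_mul, map_mul, Module.End.mul_apply, map_sub, map_smul, smul_sub, smul_smul, mul_comm]
    abel
  | add x y hx hy =>
    convert Submodule.add_mem _ hx hy using 1
    rw [map_add, map_add, LinearMap.add_apply, add_smul]
    abel

end CherednikLaurent

section Star

variable {ι M N : Type*} [AddCommGroup M] [Module ℝ M] [AddCommGroup N] [Module ℝ N]
  {P : RootPairing ι ℝ M N}

local notation "σ" => RootPairing.weylGroup.ofIdx P

/-! ### The adjoints of the Cherednik operators -/

/-- The conjugation `c e^μ ↦ c̄ e^{-μ}` of `ℂ[P]`; it is complex conjugation of functions on the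
compact torus. -/
def starLaurent (P : RootPairing ι ℝ M N) : LaurentPoly P →+* LaurentPoly P :=
  (AddMonoidAlgebra.mapDomainRingHom ℂ (negAddMonoidHom (α := weightLattice P))).comp
    (AddMonoidAlgebra.mapRingHom (weightLattice P) (starRingEnd ℂ))

theorem starLaurent_single (μ : weightLattice P) (c : ℂ) :
    starLaurent P (AddMonoidAlgebra.single μ c) =
      AddMonoidAlgebra.single (-μ) (starRingEnd ℂ c) := by
  simp [starLaurent]

theorem starLaurent_expo (μ : weightLattice P) : starLaurent P (expo P μ) = expo P (-μ) := by
  rw [expo, starLaurent_single, map_one, expo]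

theorem starLaurent_smul (c : ℂ) (f : LaurentPoly P) :
    starLaurent P (c • f) = starRingEnd ℂ c • starLaurent P f := by
  induction f using laurent_induction with
  | smul d μ =>
    rw [smul_smul, smul_expo, smul_expo, starLaurent_single, starLaurent_single, map_mul,
      AddMonoidAlgebra.smul_single, smul_eq_mul]
  | add f g hf hg => rw [smul_add, map_add, map_add, hf, hg, smul_add]

theorem starLaurent_starLaurent (f : LaurentPoly P) : starLaurent P (starLaurent P f) = f := by
  induction f using laurent_induction with
  | smul c μ =>
    rw [starLaurent_smul, starLaurent_smul, Complex.conj_conj, starLaurent_expo, starLaurent_expo,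
      neg_neg]
  | add f g hf hg => rw [map_add, map_add, hf, hg]

theorem starLaurent_weylLaurent (w : P.weylGroup) (f : LaurentPoly P) :
    starLaurent P (weylLaurent P w f) = weylLaurent P w (starLaurent P f) := by
  induction f using laurent_induction with
  | smul c μ =>
    rw [map_smul, starLaurent_smul, starLaurent_smul, map_smul, weylLaurent_expo,
      starLaurent_expo, starLaurent_expo, weylLaurent_expo, smul_neg]
  | add f g hf hg => simp only [map_add, hf, hg]

theorem cplxFunctional_tmul (x : M) (c : ℂ) (η : N) :
    cplxFunctional P x (c ⊗ₜ η) = c * P.toLinearMap x η := by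
  simp [cplxFunctional, mul_comm]

theorem starLaurent_derivLin (η : N) (f : LaurentPoly P) :
    starLaurent P (derivLin P ((1 : ℂ) ⊗ₜ η) f) =
      -derivLin P ((1 : ℂ) ⊗ₜ η) (starLaurent P f) := by
  induction f using laurent_induction with
  | smul c μ =>
    rw [map_smul, starLaurent_smul, starLaurent_smul, map_smul, derivLin_expo, starLaurent_expo,
      starLaurent_smul, starLaurent_expo, derivLin_expo, cplxFunctional_tmul, cplxFunctional_tmul,
      AddSubgroup.coe_neg, map_neg, LinearMap.neg_apply, one_mul, one_mul, Complex.conj_ofReal,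
      Complex.ofReal_neg, neg_smul, smul_neg, neg_neg]
  | add f g hf hg => simp only [map_add, hf, hg, neg_add]

variable [P.IsCrystallographic] [P.IsRootSystem] [Finite ι] {b : P.Base}

theorem starLaurent_divDiff (i : ι) (f : LaurentPoly P) :
    starLaurent P (divDiff P i f) =
      -(expo P (-rootWeight P i) * divDiff P i (starLaurent P f)) := by
  have h1 := congrArg (starLaurent P) (oneSub_mul_divDiff i f)
  have h2 := oneSub_mul_divDiff i (starLaurent P f)
  rw [map_mul, map_sub, starLaurent_weylLaurent, ← h2, oneSub, map_sub, map_one, starLaurent_expo,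
    neg_neg] at h1
  have h3 := expo_mul_expo_neg (rootWeight P i)
  refine mul_left_cancel₀ (oneSub_ne_zero i) ?_
  rw [oneSub]
  linear_combination (-expo P (-rootWeight P i)) * h1 -
    starLaurent P (divDiff P i f) * h3

theorem weylLaurent_oneSub (i : ι) :
    weylLaurent P (σ i) (oneSub P i) = -(expo P (rootWeight P i) * oneSub P i) := by
  have h3 := expo_mul_expo_neg (rootWeight P i)
  rw [oneSub, map_sub, map_one, weylLaurent_expo, smul_neg, smul_rootWeight, ofIdx_smul_idx,
    rootWeight_neg, neg_neg]
  linear_combination -h3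

/-- The combination of divided differences by which the two sides of the adjointness relation
differ is antisymmetric. -/
theorem weylLaurent_adjoint_defect (i : ι) (h g : LaurentPoly P) (c : ℂ) (hc : 2 * c = 1) :
    weylLaurent P (σ i) (h * divDiff P i g + expo P (-rootWeight P i) * divDiff P i h * g -
      c • ((1 + expo P (-rootWeight P i)) * divDiff P i (h * g))) =
    -(h * divDiff P i g + expo P (-rootWeight P i) * divDiff P i h * g -
      c • ((1 + expo P (-rootWeight P i)) * divDiff P i (h * g))) := by
  set X := h * divDiff P i g + expo P (-rootWeight P i) * divDiff P i h * g -
      c • ((1 + expo P (-rootWeight P i)) * divDiff P i (h * g)) with hX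
  have huv := expo_mul_expo_neg (rootWeight P i)
  have hg := oneSub_mul_divDiff i g
  have hh := oneSub_mul_divDiff i h
  have hhg := oneSub_mul_divDiff i (h * g)
  have hs : ∀ f : LaurentPoly P, weylLaurent P (σ i) (weylLaurent P (σ i) f) = f := fun f => by
    rw [← weylLaurent_mul, ofIdx_mul_self, weylLaurent_one]
  rw [map_mul (weylLaurent P (σ i))] at hhg
  have hsv : weylLaurent P (σ i) (expo P (-rootWeight P i)) = expo P (rootWeight P i) := by
    rw [weylLaurent_expo, smul_neg, smul_rootWeight, ofIdx_smul_idx, rootWeight_neg, neg_neg]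
  have hy := weylLaurent_oneSub (P := P) i
  rw [Algebra.smul_def] at hX
  set d := algebraMap ℂ (LaurentPoly P) c with hd
  have hd2 : 2 * d = 1 := by
    rw [hd, ← map_ofNat (algebraMap ℂ (LaurentPoly P)) 2, ← map_mul, hc, map_one]
  have hsd : weylLaurent P (σ i) d = d := AlgEquiv.commutes _ _
  set u := expo P (rootWeight P i)
  set v := expo P (-rootWeight P i)
  set y := oneSub P i
  -- Both sides are compared after multiplication with `e^α (1 - e^{-α})`.
  have hyX : y * X = h * (g - weylLaurent P (σ i) g) + v * (h - weylLaurent P (σ i) h) * g -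
      d * ((1 + v) * (h * g - weylLaurent P (σ i) h * weylLaurent P (σ i) g)) := by
    rw [hX]
    linear_combination h * hg + v * g * hh - d * (1 + v) * hhg
  have h2 := congrArg (weylLaurent P (σ i)) hyX
  simp only [map_mul, map_sub, map_add, map_one, hs, hsd, hsv, hy] at h2
  have hu : u ≠ 0 := left_ne_zero_of_mul_eq_one huv
  refine mul_left_cancel₀ (mul_ne_zero hu (oneSub_ne_zero i)) ?_
  change u * y * _ = u * y * _
  set sg := weylLaurent P (σ i) g
  set sh := weylLaurent P (σ i) h
  linear_combination -h2 + u * hyX + (h * g - sh * g - d * (h * g) + d * (sh * sg)) * huv +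
    (-(u + 1) * (h * g) + (u + 1) * (sh * sg)) * hd2

end Star

section Adjoint

variable {ι M N : Type*} [Fintype ι] [AddCommGroup M] [Module ℝ M] [AddCommGroup N] [Module ℝ N]
  {P : RootPairing ι ℝ M N} [P.IsRootSystem] [P.IsCrystallographic] {b : P.Base}
  {I : Set b.support} {k : ι → ℝ}

local notation "σ" => RootPairing.weylGroup.ofIdx P

open scoped Classical in
/-- The properties of the functional `f ↦ ∫_T f Δ` on `ℂ[P]` that are used in the algebraic part of
the argument: invariance, positivity, and the effect of an integration by parts. -/
structure IsWeightFunctional (b : P.Base) (k : ι → ℝ) (L : LaurentPoly P →ₗ[ℂ] ℂ) : Prop where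
  invariant : ∀ (i : ι) (f : LaurentPoly P), L (weylLaurent P (σ i) f) = L f
  conj : ∀ f : LaurentPoly P, L (starLaurent P f) = starRingEnd ℂ (L f)
  definite : ∀ f : LaurentPoly P, L (starLaurent P f * f) = 0 → f = 0
  deriv : ∀ (η : N) (f : LaurentPoly P), L (derivLin P ((1 : ℂ) ⊗ₜ η) f) =
    -∑ i with b.IsPos i, (1 / 2 : ℂ) * (cplxFunctional P (P.root i) ((1 : ℂ) ⊗ₜ η) * k i) *
      L ((1 + expo P (-rootWeight P i)) * divDiff P i f)

variable {L : LaurentPoly P →ₗ[ℂ] ℂ}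

theorem IsWeightFunctional.weyl (hL : IsWeightFunctional b k L) (w : P.weylGroup)
    (f : LaurentPoly P) : L (weylLaurent P w f) = L f := by
  obtain ⟨l, rfl⟩ := exists_wordProd b w
  induction l with
  | nil => exact congrArg L (weylLaurent_one f)
  | cons j t ih => rw [wordProd_cons, weylLaurent_mul, hL.invariant, ih]

theorem IsWeightFunctional.divDiff_symm (hL : IsWeightFunctional b k L) (i : ι)
    (h g : LaurentPoly P) :
    L (h * divDiff P i g) + L (expo P (-rootWeight P i) * divDiff P i h * g) =
      (1 / 2 : ℂ) * L ((1 + expo P (-rootWeight P i)) * divDiff P i (h * g)) := by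
  have h1 := congrArg L (weylLaurent_adjoint_defect i h g (1 / 2) (by norm_num))
  rw [hL.invariant, map_neg] at h1
  have h2 := self_eq_neg.1 h1
  rw [map_sub, map_add, map_smul, smul_eq_mul] at h2
  linear_combination h2

/-- The Cherednik operators for real `ξ` are self-adjoint. -/
theorem IsWeightFunctional.cherednik_adjoint (hL : IsWeightFunctional b k L) (η : N)
    (f g : LaurentPoly P) :
    L (starLaurent P (cherednikLaurent b k ((1 : ℂ) ⊗ₜ η) f) * g) =
      L (starLaurent P f * cherednikLaurent b k ((1 : ℂ) ⊗ₜ η) g) := by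
  classical
  set h := starLaurent P f with hh
  have hconj : ∀ x : M, starRingEnd ℂ (cplxFunctional P x ((1 : ℂ) ⊗ₜ η)) =
      cplxFunctional P x ((1 : ℂ) ⊗ₜ η) := fun x => by
    rw [cplxFunctional_tmul, one_mul, Complex.conj_ofReal]
  have h1 := hL.deriv η (h * g)
  rw [derivLin_mul, map_add] at h1
  simp only [cherednikLaurent_apply, map_sub, map_add, map_sum, starLaurent_smul, map_mul, hconj,
    Complex.conj_ofReal, starLaurent_derivLin, starLaurent_divDiff, ← hh, sub_mul, add_mul,
    mul_sub, mul_add, Finset.sum_mul, Finset.mul_sum, smul_mul_assoc, mul_smul_comm, map_smul,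
    smul_eq_mul, neg_mul, map_neg, mul_neg]
  have h2 : ∑ i with b.IsPos i, cplxFunctional P (P.root i) ((1 : ℂ) ⊗ₜ η) * k i *
      (L (h * divDiff P i g) + L (expo P (-rootWeight P i) * divDiff P i h * g)) =
      ∑ i with b.IsPos i, (1 / 2 : ℂ) * (cplxFunctional P (P.root i) ((1 : ℂ) ⊗ₜ η) * k i) *
      L ((1 + expo P (-rootWeight P i)) * divDiff P i (h * g)) :=
    Finset.sum_congr rfl fun i _ => by rw [hL.divDiff_symm]; ring
  simp only [mul_add, Finset.sum_add_distrib] at h2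
  rw [← h2] at h1
  rw [mul_comm g] at h1
  simp only [Finset.sum_neg_distrib]
  linear_combination -h1

/-- Every polynomial in the Cherednik operators has an adjoint that is again a polynomial in the
Cherednik operators. -/
theorem IsWeightFunctional.exists_adjoint (hL : IsWeightFunctional b k L)
    (x : TensorAlgebra ℂ (CplxSpace N)) : ∃ y : TensorAlgebra ℂ (CplxSpace N),
      ∀ f g, L (starLaurent P (TensorAlgebra.lift ℂ (cherednikLaurent b k) x f) * g) =
        L (starLaurent P f * TensorAlgebra.lift ℂ (cherednikLaurent b k) y g) := by
  induction x using TensorAlgebra.induction with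
  | algebraMap c =>
    refine ⟨algebraMap _ _ (starRingEnd ℂ c), fun f g => ?_⟩
    rw [AlgHom.commutes, AlgHom.commutes, Module.algebraMap_end_apply, Module.algebraMap_end_apply,
      starLaurent_smul, smul_mul_assoc, mul_smul_comm]
  | ι ξ =>
    induction ξ using TensorProduct.induction_on with
    | zero => exact ⟨0, fun f g => by simp⟩
    | tmul c η =>
      refine ⟨TensorAlgebra.ι ℂ (starRingEnd ℂ c ⊗ₜ η), fun f g => ?_⟩
      have h : ∀ c : ℂ, (c ⊗ₜ[ℝ] η : CplxSpace N) = c • ((1 : ℂ) ⊗ₜ[ℝ] η) := fun c => by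
        rw [TensorProduct.smul_tmul', smul_eq_mul, mul_one]
      rw [TensorAlgebra.lift_ι_apply, TensorAlgebra.lift_ι_apply, h c, h (starRingEnd ℂ c),
        map_smul, map_smul, LinearMap.smul_apply, LinearMap.smul_apply, starLaurent_smul,
        smul_mul_assoc, mul_smul_comm, map_smul, map_smul, hL.cherednik_adjoint]
    | add ξ η hξ hη =>
      obtain ⟨y, hy⟩ := hξ
      obtain ⟨z, hz⟩ := hη
      refine ⟨y + z, fun f g => ?_⟩
      rw [map_add, map_add, map_add, LinearMap.add_apply, LinearMap.add_apply, map_add, add_mul,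
        mul_add, map_add, map_add, hy, hz]
  | mul x y hx hy =>
    obtain ⟨x', hx⟩ := hx
    obtain ⟨y', hy⟩ := hy
    refine ⟨y' * x', fun f g => ?_⟩
    rw [map_mul (TensorAlgebra.lift ℂ _), map_mul (TensorAlgebra.lift ℂ _), Module.End.mul_apply,
      Module.End.mul_apply, hx, hy]
  | add x y hx hy =>
    obtain ⟨x', hx⟩ := hx
    obtain ⟨y', hy⟩ := hy
    refine ⟨x' + y', fun f g => ?_⟩
    rw [map_add, map_add, LinearMap.add_apply, LinearMap.add_apply, map_add, add_mul, mul_add,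
      map_add, map_add, hx, hy]

end Adjoint

section Integration

open MeasureTheory

/-! ### Integration on the compact torus -/

section Torus

variable {d : Type*} [Fintype d]

/-- The normalized Haar measure of the compact torus. -/
abbrev torusMeasure (d : Type*) [Fintype d] : Measure (UnitAddTorus d) :=
  Measure.pi fun _ => AddCircle.haarAddCircle

theorem integrable_torus {E : Type*} [NormedAddCommGroup E] {H : UnitAddTorus d → E}
    (hH : Continuous H) : Integrable H (torusMeasure d) :=
  hH.integrable_of_hasCompactSupport (.of_compactSpace H)

theorem mFourier_apply_eq_toCircle (n : d → ℤ) (t : UnitAddTorus d) :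
    UnitAddTorus.mFourier n t = (AddCircle.toCircle (∑ j, n j • t j) : ℂ) := by
  have h : ∀ s : Finset d, ∏ j ∈ s, (fourier (n j) (t j) : ℂ) =
      (AddCircle.toCircle (∑ j ∈ s, n j • t j) : ℂ) := by
    intro s
    classical
    induction s using Finset.induction_on with
    | empty => simp
    | insert a s ha ih =>
      rw [Finset.prod_insert ha, Finset.sum_insert ha, ih, AddCircle.toCircle_add, Circle.coe_mul,
        fourier_apply]
  exact h Finset.univ

/-- The one-parameter subgroup of the torus with direction `c`. -/
def torusLine (c : d → ℝ) (s : ℝ) : UnitAddTorus d := fun j => ((s * c j : ℝ) : UnitAddCircle)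

theorem torusLine_add (c : d → ℝ) (s s' : ℝ) :
    torusLine c (s + s') = torusLine c s + torusLine c s' := by
  ext j
  simp [torusLine, add_mul]

theorem torusLine_zero (c : d → ℝ) : torusLine c 0 = 0 := by
  ext j
  simp [torusLine]

theorem hasDerivAt_mFourier_torusLine (n : d → ℤ) (c : d → ℝ) (t : UnitAddTorus d) :
    HasDerivAt (fun s => UnitAddTorus.mFourier n (t + torusLine c s))
      (2 * Real.pi * Complex.I * (∑ j, n j * c j : ℝ) * UnitAddTorus.mFourier n t) 0 := by
  have h : ∀ s : ℝ, UnitAddTorus.mFourier n (t + torusLine c s) =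
      UnitAddTorus.mFourier n t *
        Complex.exp (s * (2 * Real.pi * Complex.I * (∑ j, n j * c j : ℝ))) := by
    intro s
    rw [mFourier_apply_eq_toCircle, mFourier_apply_eq_toCircle]
    have h1 : ∑ j, n j • (t + torusLine c s) j =
        ∑ j, n j • t j + ((s * ∑ j, n j * c j : ℝ) : UnitAddCircle) := by
      simp only [Pi.add_apply, smul_add, Finset.sum_add_distrib, torusLine]
      congr 1
      rw [Finset.mul_sum]
      have : ((∑ j, s * (n j * c j) : ℝ) : UnitAddCircle) =
          ∑ j, ((s * (n j * c j) : ℝ) : UnitAddCircle) :=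
        map_sum (QuotientAddGroup.mk' (AddSubgroup.zmultiples (1 : ℝ))) _ _
      rw [this]
      refine Finset.sum_congr rfl fun j _ => ?_
      rw [← AddCircle.coe_zsmul, zsmul_eq_mul]
      congr 1
      ring
    rw [h1, AddCircle.toCircle_add, Circle.coe_mul, AddCircle.toCircle_apply_mk, Circle.coe_exp]
    congr 2
    push_cast
    ring
  simp only [h]
  have h2 : HasDerivAt (fun s : ℝ => (s : ℂ) * (2 * Real.pi * Complex.I * (∑ j, n j * c j : ℝ)))
      (2 * Real.pi * Complex.I * (∑ j, n j * c j : ℝ)) 0 := by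
    simpa using (Complex.ofRealCLM.hasDerivAt (x := (0 : ℝ))).mul_const
      (2 * Real.pi * Complex.I * ((∑ j, n j * c j : ℝ) : ℂ))
  have h3 := (h2.cexp).const_mul (UnitAddTorus.mFourier n t)
  simp only [Complex.ofReal_zero, zero_mul, Complex.exp_zero, one_mul] at h3
  rwa [mul_comm (UnitAddTorus.mFourier n t)] at h3

/-- The integral of a derivative along a one-parameter subgroup vanishes. -/
theorem integral_deriv_torusLine_eq_zero {H H' : UnitAddTorus d → ℂ} (hH : Continuous H)
    (hH' : Continuous H') (c : d → ℝ)
    (hd : ∀ t, HasDerivAt (fun s => H (t + torusLine c s)) (H' t) 0) :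
    ∫ t, H' t ∂torusMeasure d = 0 := by
  obtain ⟨C, hC⟩ : ∃ C, ∀ t, ‖H' t‖ ≤ C := by
    obtain ⟨C, hC⟩ := (isCompact_range hH').isBounded.exists_norm_le
    exact ⟨C, fun t => hC _ ⟨t, rfl⟩⟩
  have hd' : ∀ t s₀, HasDerivAt (fun s => H (t + torusLine c s)) (H' (t + torusLine c s₀)) s₀ := by
    intro t s₀
    have h1 := hd (t + torusLine c s₀)
    have h3 : HasDerivAt (fun s => H (t + torusLine c s₀ + torusLine c s))
        (H' (t + torusLine c s₀)) (s₀ - s₀) := by rwa [sub_self]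
    refine (h3.comp_sub_const s₀ s₀).congr_of_eventuallyEq (Filter.Eventually.of_forall fun s => ?_)
    beta_reduce
    rw [add_assoc, ← torusLine_add, add_sub_cancel]
  have key := (hasDerivAt_integral_of_dominated_loc_of_deriv_le (μ := torusMeasure d)
    (F := fun s t => H (t + torusLine c s)) (F' := fun s t => H' (t + torusLine c s))
    (x₀ := 0) (bound := fun _ => C) Filter.univ_mem
    (Filter.Eventually.of_forall fun s =>
      (hH.comp (continuous_id.add continuous_const)).aestronglyMeasurable)
    (integrable_torus (hH.comp (continuous_id.add continuous_const)))
    (hH'.comp (continuous_id.add continuous_const)).aestronglyMeasurable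
    (Filter.Eventually.of_forall fun t s _ => hC _) (integrable_const C)
    (Filter.Eventually.of_forall fun t s _ => hd' t s)).2
  simp only [integral_add_right_eq_self, torusLine_zero, add_zero] at key
  exact key.unique (hasDerivAt_const _ _)

variable (c : d → ℤ) (a : d → ℤ)

/-- The endomorphism `t ↦ t - (∑ⱼ aⱼ tⱼ) c` of the torus; it is a reflection if
`∑ⱼ aⱼ cⱼ = 2`. -/
def torusReflection : UnitAddTorus d →+ UnitAddTorus d where
  toFun t := fun l => t l - c l • ∑ j, a j • t j
  map_zero' := by ext; simp
  map_add' s t := by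
    ext l
    simp only [Pi.add_apply, smul_add, Finset.sum_add_distrib]
    abel

variable {c a}

theorem torusReflection_apply (t : UnitAddTorus d) (l : d) :
    torusReflection c a t l = t l - c l • ∑ j, a j • t j :=
  rfl

theorem continuous_torusReflection : Continuous (torusReflection c a) := by
  refine continuous_pi fun l => ?_
  change Continuous fun t : UnitAddTorus d => t l - c l • ∑ j, a j • t j
  exact (continuous_apply l).sub ((continuous_zsmul (c l)).comp (continuous_finsetSum _ fun j _ =>
    (continuous_zsmul (a j)).comp (continuous_apply j)))

theorem sum_zsmul_sub_zsmul {G : Type*} [AddCommGroup G] (n c a : d → ℤ) (t : d → G) :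
    ∑ l, n l • (t l - c l • ∑ j, a j • t j) = ∑ l, (n l - (∑ j, n j * c j) * a l) • t l := by
  have h : ∀ l, n l • (t l - c l • ∑ j, a j • t j) =
      n l • t l - (n l * c l) • ∑ j, a j • t j := fun l => by rw [zsmul_sub, mul_zsmul]
  have h' : ∀ l, (n l - (∑ j, n j * c j) * a l) • t l =
      n l • t l - (∑ j, n j * c j) • a l • t l := fun l => by
    rw [sub_zsmul, mul_zsmul, sub_eq_add_neg]
  simp only [h, h', Finset.sum_sub_distrib]
  rw [← Finset.smul_sum, ← Finset.sum_smul]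

theorem sum_zsmul_torusReflection (n : d → ℤ) (t : UnitAddTorus d) :
    ∑ l, n l • torusReflection c a t l = ∑ l, (n l - (∑ j, n j * c j) * a l) • t l :=
  sum_zsmul_sub_zsmul n c a t

theorem torusReflection_involutive (h : ∑ j, a j * c j = 2) :
    Function.Involutive (torusReflection c a) := by
  intro t
  ext l
  rw [torusReflection_apply, sum_zsmul_torusReflection, torusReflection_apply, h]
  have : ∑ j, (a j - 2 * a j) • t j = -∑ j, a j • t j := by
    rw [← Finset.sum_neg_distrib]
    refine Finset.sum_congr rfl fun j _ => ?_
    rw [← neg_smul]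
    congr 1
    ring
  rw [this, smul_neg]
  abel

theorem integral_comp_torusReflection (h : ∑ j, a j * c j = 2) {H : UnitAddTorus d → ℂ}
    (hH : Continuous H) :
    ∫ t, H (torusReflection c a t) ∂torusMeasure d = ∫ t, H t ∂torusMeasure d := by
  have h1 : MeasurePreserving (torusReflection c a) (torusMeasure d) (torusMeasure d) :=
    AddMonoidHom.measurePreserving continuous_torusReflection
      (torusReflection_involutive h).surjective rfl
  conv_rhs => rw [← h1.map_eq]
  rw [integral_map h1.measurable.aemeasurable hH.aestronglyMeasurable]

end Torus

section Eval

variable {ι M N : Type*} [Fintype ι] [AddCommGroup M] [Module ℝ M] [AddCommGroup N] [Module ℝ N]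
  {P : RootPairing ι ℝ M N} [P.IsRootSystem] [P.IsCrystallographic] (b : P.Base)
  {I : Set b.support} {k : ι → ℝ}

local notation "σ" => RootPairing.weylGroup.ofIdx P

/-! ### Laurent polynomials as functions on the torus -/

theorem torusChar_eq (μ : weightLattice P) (t : UnitAddTorus b.support) :
    torusChar b μ t = UnitAddTorus.mFourier (fun j : b.support => pairInt (j : ι) μ) t := by
  have h : (fun j : b.support => ⌊P.coroot' j (μ : M)⌋) = fun j : b.support => pairInt (j : ι) μ :=
    funext fun j => by rw [← coe_pairInt, Int.floor_intCast]
  rw [torusChar, h]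

theorem torusChar_add (μ ν : weightLattice P) (t : UnitAddTorus b.support) :
    torusChar b (μ + ν) t = torusChar b μ t * torusChar b ν t := by
  simp only [torusChar_eq, ← UnitAddTorus.mFourier_add]
  congr 2
  funext j
  exact pairInt_add _ _ _

theorem torusChar_neg (μ : weightLattice P) (t : UnitAddTorus b.support) :
    torusChar b (-μ) t = starRingEnd ℂ (torusChar b μ t) := by
  simp only [torusChar_eq, ← UnitAddTorus.mFourier_neg]
  congr 2
  funext j
  exact pairInt_neg _ _

theorem torusEval_eq (f : LaurentPoly P) (t : UnitAddTorus b.support) :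
    torusEval b f t = laurentLift (fun μ => torusChar b μ t) f := by
  simp [torusEval, laurentLift, Finsupp.linearCombination_apply, Finsupp.sum]

theorem torusEval_expo (μ : weightLattice P) (t : UnitAddTorus b.support) :
    torusEval b (expo P μ) t = torusChar b μ t := by
  rw [torusEval_eq, laurentLift_expo]

theorem torusEval_add (f g : LaurentPoly P) (t : UnitAddTorus b.support) :
    torusEval b (f + g) t = torusEval b f t + torusEval b g t := by
  simp only [torusEval_eq, map_add]

theorem torusEval_sub (f g : LaurentPoly P) (t : UnitAddTorus b.support) :
    torusEval b (f - g) t = torusEval b f t - torusEval b g t := by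
  simp only [torusEval_eq, map_sub]

theorem torusEval_smul (c : ℂ) (f : LaurentPoly P) (t : UnitAddTorus b.support) :
    torusEval b (c • f) t = c * torusEval b f t := by
  simp only [torusEval_eq, map_smul, smul_eq_mul]

theorem torusEval_one (t : UnitAddTorus b.support) : torusEval b 1 t = 1 := by
  rw [← expo_zero (P := P), torusEval_expo, torusChar_eq, mFourier_apply_eq_toCircle]
  have : ∀ j : ι, pairInt j (0 : weightLattice P) = 0 := fun j => by
    have h0 := pairInt_zsmul j 0 (0 : weightLattice P)
    rwa [zero_smul, zero_mul] at h0
  simp [this]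

theorem torusEval_mul (f g : LaurentPoly P) (t : UnitAddTorus b.support) :
    torusEval b (f * g) t = torusEval b f t * torusEval b g t := by
  induction f using laurent_induction with
  | smul c μ =>
    induction g using laurent_induction with
    | smul d ν =>
      rw [smul_mul_smul_comm, ← expo_add, torusEval_smul, torusEval_smul, torusEval_smul,
        torusEval_expo, torusEval_expo, torusEval_expo, torusChar_add]
      ring
    | add g g' hg hg' => rw [mul_add, torusEval_add, hg, hg', torusEval_add, mul_add]
  | add f f' hf hf' => rw [add_mul, torusEval_add, hf, hf', torusEval_add, add_mul]

theorem torusEval_prod {κ : Type*} (s : Finset κ) (f : κ → LaurentPoly P)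
    (t : UnitAddTorus b.support) :
    torusEval b (∏ i ∈ s, f i) t = ∏ i ∈ s, torusEval b (f i) t := by
  classical
  induction s using Finset.induction_on with
  | empty => simp [torusEval_one]
  | insert a s ha ih => rw [Finset.prod_insert ha, Finset.prod_insert ha, torusEval_mul, ih]

theorem torusEval_star (f : LaurentPoly P) (t : UnitAddTorus b.support) :
    torusEval b (starLaurent P f) t = starRingEnd ℂ (torusEval b f t) := by
  induction f using laurent_induction with
  | smul c μ =>
    rw [starLaurent_smul, starLaurent_expo, torusEval_smul, torusEval_smul, torusEval_expo,
      torusEval_expo, torusChar_neg, map_mul]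
  | add f g hf hg => rw [map_add, torusEval_add, torusEval_add, hf, hg, map_add]

theorem continuous_torusEval (f : LaurentPoly P) : Continuous (torusEval b f) := by
  induction f using laurent_induction with
  | smul c μ =>
    have : torusEval b (c • expo P μ) = fun t => c *
        UnitAddTorus.mFourier (fun j : b.support => pairInt (j : ι) μ) t := by
      funext t
      rw [torusEval_smul, torusEval_expo, torusChar_eq]
    rw [this]
    exact continuous_const.mul (ContinuousMap.continuous _)
  | add f g hf hg =>
    have : torusEval b (f + g) = fun t => torusEval b f t + torusEval b g t :=
      funext fun t => torusEval_add b f g t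
    rw [this]
    exact hf.add hg

/-- The characters of the torus are linearly independent. -/
theorem exists_torusEval_ne_zero {f : LaurentPoly P} (hf : f ≠ 0) : ∃ t, torusEval b f t ≠ 0 := by
  by_contra! h
  let χ : weightLattice P → (Multiplicative (UnitAddTorus b.support) →* ℂ) := fun μ =>
    { toFun := fun t => torusChar b μ t.toAdd
      map_one' := by
        change torusChar b μ 0 = 1
        rw [torusChar_eq, mFourier_apply_eq_toCircle]
        simp
      map_mul' := fun s t => by
        change torusChar b μ (s.toAdd + t.toAdd) = _
        simp only [torusChar_eq, mFourier_apply_eq_toCircle]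
        rw [← Circle.coe_mul, ← AddCircle.toCircle_add, ← Finset.sum_add_distrib]
        simp only [Pi.add_apply, smul_add] }
  have hχ : Function.Injective χ := by
    classical
    intro μ ν hμν
    refine weight_ext (b := b) fun j hj => ?_
    by_contra hne
    -- The characters differ on the line through the `j`-th coroot.
    have h1 : (fun s => UnitAddTorus.mFourier (fun l : b.support => pairInt (l : ι) μ)
          (0 + torusLine (Pi.single ⟨j, hj⟩ 1) s)) =
        fun s => UnitAddTorus.mFourier (fun l : b.support => pairInt (l : ι) ν)
          (0 + torusLine (Pi.single ⟨j, hj⟩ 1) s) := by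
      funext s
      rw [← torusChar_eq, ← torusChar_eq]
      exact DFunLike.congr_fun hμν (Multiplicative.ofAdd _)
    have h2 := hasDerivAt_mFourier_torusLine (fun l : b.support => pairInt (l : ι) μ)
      (Pi.single ⟨j, hj⟩ 1) 0
    rw [h1] at h2
    have h3 := h2.unique (hasDerivAt_mFourier_torusLine (fun l : b.support => pairInt (l : ι) ν)
      (Pi.single ⟨j, hj⟩ 1) 0)
    have h4 : ∀ n : b.support → ℤ, UnitAddTorus.mFourier n (0 : UnitAddTorus b.support) = 1 := by
      intro n
      rw [mFourier_apply_eq_toCircle]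
      simp
    rw [h4, h4, mul_one, mul_one] at h3
    have h5 := mul_left_cancel₀ Complex.two_pi_I_ne_zero h3
    simp only [Pi.single_apply, mul_ite, mul_one, mul_zero, Finset.sum_ite_eq',
      Finset.mem_univ, if_true] at h5
    exact hne (by exact_mod_cast h5)
  have hli := (linearIndependent_monoidHom (Multiplicative (UnitAddTorus b.support)) ℂ).comp χ hχ
  apply hf
  apply AddMonoidAlgebra.coeff_injective
  rw [AddMonoidAlgebra.coeff_zero]
  refine linearIndependent_iff.1 hli f.coeff (funext fun t => ?_)
  rw [Finsupp.linearCombination_apply, Finsupp.sum, Finset.sum_apply]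
  exact h t.toAdd

/-- The coordinates of a coroot in the basis of simple coroots. -/
def corootCoord (i : ι) : b.support → ℤ :=
  fun j => (b.flip.exists_root_eq_sum_int i).choose j

theorem coroot_eq_sum (i : ι) : P.coroot i = ∑ j : b.support, corootCoord b i j • P.coroot j := by
  have h := (b.flip.exists_root_eq_sum_int i).choose_spec.2.2
  refine h.trans ?_
  exact (Finset.sum_coe_sort b.support
    (fun j => (b.flip.exists_root_eq_sum_int i).choose j • P.coroot j)).symm

theorem pairInt_eq_sum (i : ι) (μ : weightLattice P) :
    pairInt i μ = ∑ j : b.support, pairInt (j : ι) μ * corootCoord b i j := by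
  have h : (pairInt i μ : ℝ) = ∑ j : b.support, pairInt (j : ι) μ * corootCoord b i j := by
    push_cast
    simp only [coe_pairInt]
    have h1 := congrArg (P.toLinearMap (μ : M)) (coroot_eq_sum b i)
    rw [map_sum] at h1
    simp only [map_zsmul, zsmul_eq_mul] at h1
    exact h1.trans (Finset.sum_congr rfl fun j _ => mul_comm _ _)
  exact_mod_cast h

/-- The action of the reflection in a root on the torus. -/
def torusRefl (i : ι) : UnitAddTorus b.support →+ UnitAddTorus b.support :=
  torusReflection (corootCoord b i) fun j : b.support => pairInt (j : ι) (rootWeight P i)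

theorem sum_rootWeight_corootCoord (i : ι) :
    ∑ j : b.support, pairInt (j : ι) (rootWeight P i) * corootCoord b i j = 2 := by
  rw [← pairInt_eq_sum, pairInt_rootWeight_self]

theorem torusChar_torusRefl (i : ι) (μ : weightLattice P) (t : UnitAddTorus b.support) :
    torusChar b μ (torusRefl b i t) = torusChar b (σ i • μ) t := by
  rw [torusChar_eq, torusChar_eq, mFourier_apply_eq_toCircle, mFourier_apply_eq_toCircle,
    torusRefl, sum_zsmul_torusReflection, ← pairInt_eq_sum]
  congr 2
  refine Finset.sum_congr rfl fun l _ => ?_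
  rw [ofIdx_smul_weight, sub_eq_add_neg μ, ← neg_smul, pairInt_add, pairInt_zsmul]
  congr 1
  ring

theorem torusEval_torusRefl (i : ι) (f : LaurentPoly P) (t : UnitAddTorus b.support) :
    torusEval b f (torusRefl b i t) = torusEval b (weylLaurent P (σ i) f) t := by
  induction f using laurent_induction with
  | smul c μ =>
    rw [map_smul, torusEval_smul, torusEval_smul, weylLaurent_expo, torusEval_expo,
      torusEval_expo, torusChar_torusRefl]
  | add f g hf hg => rw [map_add, torusEval_add, torusEval_add, hf, hg]

theorem integral_torusRefl (i : ι) {H : UnitAddTorus b.support → ℂ} (hH : Continuous H) :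
    ∫ t, H (torusRefl b i t) ∂torusMeasure b.support = ∫ t, H t ∂torusMeasure b.support :=
  integral_comp_torusReflection (sum_rootWeight_corootCoord b i) hH

theorem hasDerivAt_torusEval (η : N) (f : LaurentPoly P) (t : UnitAddTorus b.support) :
    HasDerivAt (fun s => torusEval b f (t + torusLine (fun j => b.toCoweightBasis.repr η j) s))
      (2 * Real.pi * Complex.I * torusEval b (derivLin P ((1 : ℂ) ⊗ₜ η) f) t) 0 := by
  induction f using laurent_induction with
  | smul c μ =>
    have h1 : ((∑ j : b.support, pairInt (j : ι) μ * b.toCoweightBasis.repr η j : ℝ) : ℂ) =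
        cplxFunctional P (μ : M) ((1 : ℂ) ⊗ₜ η) := by
      rw [cplxFunctional_tmul, one_mul]
      congr 1
      conv_rhs => rw [← b.toCoweightBasis.sum_repr η, map_sum]
      refine Finset.sum_congr rfl fun j _ => ?_
      rw [map_smul, Base.toCoweightBasis_apply, coe_pairInt, smul_eq_mul, mul_comm]
      rfl
    have h2 := (hasDerivAt_mFourier_torusLine (fun j : b.support => pairInt (j : ι) μ)
      (fun j => b.toCoweightBasis.repr η j) t).const_mul c
    simp only [← torusChar_eq, h1] at h2
    have h3 : 2 * Real.pi * Complex.I *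
        torusEval b (derivLin P ((1 : ℂ) ⊗ₜ η) (c • expo P μ)) t =
        c * (2 * Real.pi * Complex.I * cplxFunctional P (μ : M) ((1 : ℂ) ⊗ₜ η) *
          torusChar b μ t) := by
      rw [map_smul, derivLin_expo, torusEval_smul, torusEval_smul, torusEval_expo]
      ring
    rw [h3]
    simpa only [torusEval_smul, torusEval_expo] using h2
  | add f g hf hg =>
    rw [map_add, torusEval_add, mul_add]
    simp only [torusEval_add]
    exact hf.add hg

end Eval

section Weight

variable {ι M N : Type*} [Fintype ι] [AddCommGroup M] [Module ℝ M] [AddCommGroup N] [Module ℝ N]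
  {P : RootPairing ι ℝ M N} [P.IsRootSystem] [P.IsCrystallographic] (b : P.Base)
  {I : Set b.support} (k : ι → ℝ)

local notation "σ" => RootPairing.weylGroup.ofIdx P

/-! ### The regularized weight function -/

/-- The function `|1 - e^{-α}|²` on the torus. -/
def normSqFun (i : ι) (t : UnitAddTorus b.support) : ℝ :=
  ‖1 - torusChar b (-rootWeight P i) t‖ ^ 2

theorem normSqFun_nonneg (i : ι) (t : UnitAddTorus b.support) : 0 ≤ normSqFun b i t :=
  sq_nonneg _

theorem torusEval_oneSub (i : ι) (t : UnitAddTorus b.support) :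
    torusEval b (oneSub P i) t = 1 - torusChar b (-rootWeight P i) t := by
  rw [oneSub, torusEval_sub, torusEval_one, torusEval_expo]

theorem ofReal_normSqFun (i : ι) (t : UnitAddTorus b.support) :
    (normSqFun b i t : ℂ) = torusEval b (oneSub P i * starLaurent P (oneSub P i)) t := by
  rw [torusEval_mul, torusEval_star, Complex.mul_conj, torusEval_oneSub, normSqFun,
    Complex.normSq_eq_norm_sq]

theorem continuous_normSqFun (i : ι) : Continuous (normSqFun b i) := by
  have : normSqFun b i = fun t => ‖torusEval b (oneSub P i) t‖ ^ 2 :=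
    funext fun t => by rw [torusEval_oneSub, normSqFun]
  rw [this]
  exact (continuous_torusEval b _).norm.pow 2

theorem normSqFun_torusRefl (i j : ι) (t : UnitAddTorus b.support) :
    normSqFun b i (torusRefl b j t) = normSqFun b (P.reflectionPerm j i) t := by
  rw [normSqFun, normSqFun, torusChar_torusRefl, smul_neg, smul_rootWeight, ofIdx_smul_idx]

/-- The smooth approximation `∏_α (|1 - e^{-α}|² + ε)^{k_α / 2}` of the weight function. -/
def regWeight (ε : ℝ) (t : UnitAddTorus b.support) : ℝ :=
  Real.exp (∑ i, k i / 2 * Real.log (normSqFun b i t + ε))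

variable {b k}

theorem regWeight_torusRefl (hk : ∀ i j, k (P.reflectionPerm i j) = k j) (ε : ℝ) (j : ι)
    (t : UnitAddTorus b.support) : regWeight b k ε (torusRefl b j t) = regWeight b k ε t := by
  rw [regWeight, regWeight]
  congr 1
  simp only [normSqFun_torusRefl]
  refine Fintype.sum_equiv (P.reflectionPerm j) _ _ fun i => ?_
  rw [hk]

theorem torusWeight_torusRefl (hk : ∀ i j, k (P.reflectionPerm i j) = k j) (j : ι)
    (t : UnitAddTorus b.support) : torusWeight b k (torusRefl b j t) = torusWeight b k t := by
  rw [torusWeight, torusWeight]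
  refine Fintype.prod_equiv (P.reflectionPerm j) _ _ fun i => ?_
  rw [torusChar_torusRefl, smul_neg, smul_rootWeight, ofIdx_smul_idx, hk]

theorem continuous_regWeight {ε : ℝ} (hε : 0 < ε) : Continuous (regWeight b k ε) := by
  refine Real.continuous_exp.comp (continuous_finsetSum _ fun i _ => continuous_const.mul ?_)
  exact ((continuous_normSqFun b i).add continuous_const).log fun t =>
    (add_pos_of_nonneg_of_pos (normSqFun_nonneg b i t) hε).ne'

theorem continuous_torusWeight (hk0 : ∀ i, 0 ≤ k i) : Continuous (torusWeight b k) := by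
  refine continuous_finsetProd _ fun i _ => Continuous.rpow_const ?_ fun _ => Or.inr (hk0 i)
  have := (continuous_torusEval b (oneSub P i)).norm
  simpa only [torusEval_oneSub] using this

theorem regWeight_eq_prod {ε : ℝ} (hε : 0 < ε) (t : UnitAddTorus b.support) :
    regWeight b k ε t = ∏ i, (normSqFun b i t + ε) ^ (k i / 2) := by
  rw [regWeight, Real.exp_sum]
  refine Finset.prod_congr rfl fun i _ => ?_
  rw [Real.rpow_def_of_pos (add_pos_of_nonneg_of_pos (normSqFun_nonneg b i t) hε), mul_comm]

theorem torusWeight_eq_prod (t : UnitAddTorus b.support) :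
    torusWeight b k t = ∏ i, (normSqFun b i t) ^ (k i / 2) := by
  rw [torusWeight]
  refine Finset.prod_congr rfl fun i _ => ?_
  rw [normSqFun, ← Real.rpow_natCast, ← Real.rpow_mul (norm_nonneg _)]
  congr 1
  push_cast
  ring

theorem tendsto_regWeight (hk0 : ∀ i, 0 ≤ k i) (t : UnitAddTorus b.support) :
    Filter.Tendsto (fun ε => regWeight b k ε t) (nhdsWithin 0 (Set.Ioi 0))
      (nhds (torusWeight b k t)) := by
  have h : Filter.Tendsto (fun ε : ℝ => ∏ i, (normSqFun b i t + ε) ^ (k i / 2))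
      (nhdsWithin 0 (Set.Ioi 0)) (nhds (torusWeight b k t)) := by
    rw [torusWeight_eq_prod]
    have hc : Continuous fun ε : ℝ => ∏ i, (normSqFun b i t + ε) ^ (k i / 2) :=
      continuous_finsetProd _ fun i _ => Continuous.rpow_const
        (continuous_const.add continuous_id) fun _ => Or.inr (div_nonneg (hk0 i) zero_le_two)
    have := hc.tendsto 0
    simp only [add_zero] at this
    exact this.mono_left nhdsWithin_le_nhds
  refine h.congr' ?_
  filter_upwards [self_mem_nhdsWithin] with ε hε
  exact (regWeight_eq_prod hε t).symm

theorem normSqFun_le (i : ι) (t : UnitAddTorus b.support) : normSqFun b i t ≤ 4 := by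
  have h1 : ‖torusChar b (-rootWeight P i) t‖ = 1 := by
    rw [torusChar_eq, mFourier_apply_eq_toCircle, Circle.norm_coe]
  have h2 : ‖1 - torusChar b (-rootWeight P i) t‖ ≤ 2 := by
    refine (norm_sub_le _ _).trans ?_
    rw [h1, norm_one]
    norm_num
  rw [normSqFun]
  have := norm_nonneg (1 - torusChar b (-rootWeight P i) t)
  nlinarith

theorem regWeight_le (hk0 : ∀ i, 0 ≤ k i) {ε : ℝ} (hε : 0 < ε) (hε1 : ε ≤ 1)
    (t : UnitAddTorus b.support) : regWeight b k ε t ≤ ∏ i, (5 : ℝ) ^ (k i / 2) := by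
  rw [regWeight_eq_prod hε]
  have h0 : ∀ i, 0 ≤ normSqFun b i t + ε := fun i => add_nonneg (normSqFun_nonneg b i t) hε.le
  refine Finset.prod_le_prod (fun i _ => Real.rpow_nonneg (h0 i) _) fun i _ => ?_
  exact Real.rpow_le_rpow (h0 i) (by linarith [normSqFun_le i t])
    (div_nonneg (hk0 i) zero_le_two)

theorem regWeight_nonneg (ε : ℝ) (t : UnitAddTorus b.support) : 0 ≤ regWeight b k ε t :=
  (Real.exp_pos _).le

theorem torusWeight_nonneg (t : UnitAddTorus b.support) : 0 ≤ torusWeight b k t :=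
  Finset.prod_nonneg fun _ _ => Real.rpow_nonneg (norm_nonneg _) _

/-! ### Integration by parts -/

theorem derivLin_oneSub_mul_star (i : ι) (ξ : CplxSpace N) :
    derivLin P ξ (oneSub P i * starLaurent P (oneSub P i)) =
      cplxFunctional P (P.root i) ξ • (expo P (-rootWeight P i) - expo P (rootWeight P i)) := by
  have h1 : oneSub P i * starLaurent P (oneSub P i) =
      (2 : ℂ) • expo P 0 - expo P (-rootWeight P i) - expo P (rootWeight P i) := by
    rw [oneSub, map_sub, map_one, starLaurent_expo, neg_neg, expo_zero, two_smul]
    linear_combination expo_mul_expo_neg (rootWeight P i)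
  have h2 : cplxFunctional P ((-rootWeight P i : weightLattice P) : M) =
      -cplxFunctional P (P.root i) := map_neg (cplxFunctionalHom P) (P.root i)
  have h3 : cplxFunctional P ((0 : weightLattice P) : M) = 0 := map_zero (cplxFunctionalHom P)
  have h4 : ((rootWeight P i : weightLattice P) : M) = P.root i := rfl
  rw [h1, map_sub, map_sub, map_smul, derivLin_expo, derivLin_expo, derivLin_expo, h2, h3, h4,
    smul_sub, LinearMap.zero_apply, zero_smul, smul_zero, LinearMap.neg_apply, neg_smul]
  abel

theorem hasDerivAt_normSqFun (η : N) (i : ι) (t : UnitAddTorus b.support) :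
    HasDerivAt (fun s => normSqFun b i (t + torusLine (fun j => b.toCoweightBasis.repr η j) s))
      (2 * Real.pi * Complex.I * (cplxFunctional P (P.root i) ((1 : ℂ) ⊗ₜ η) *
        torusEval b (expo P (-rootWeight P i) - expo P (rootWeight P i)) t)).re 0 := by
  have h := hasDerivAt_torusEval b η (oneSub P i * starLaurent P (oneSub P i)) t
  rw [derivLin_oneSub_mul_star, torusEval_smul] at h
  simp only [← ofReal_normSqFun] at h
  have h2 := Complex.reCLM.hasFDerivAt.comp_hasDerivAt (0 : ℝ) h
  exact h2

/-- The antisymmetric function `(e^{-α} - e^{α}) / (|1 - e^{-α}|² + ε)`. -/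
def regCot (b : P.Base) (ε : ℝ) (i : ι) (t : UnitAddTorus b.support) : ℂ :=
  torusEval b (expo P (-rootWeight P i) - expo P (rootWeight P i)) t / (normSqFun b i t + ε : ℝ)

theorem continuous_regCot {ε : ℝ} (hε : 0 < ε) (i : ι) : Continuous (regCot b ε i) := by
  refine (continuous_torusEval b _).div (Complex.continuous_ofReal.comp
    ((continuous_normSqFun b i).add continuous_const)) fun t => ?_
  exact Complex.ofReal_ne_zero.2 (add_pos_of_nonneg_of_pos (normSqFun_nonneg b i t) hε).ne'

theorem regCot_torusRefl (ε : ℝ) (i : ι) (t : UnitAddTorus b.support) :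
    regCot b ε i (torusRefl b i t) = -regCot b ε i t := by
  have h1 : normSqFun b (P.reflectionPerm i i) t = normSqFun b i t := by
    rw [normSqFun, normSqFun, rootWeight_neg, neg_neg, torusChar_neg]
    rw [← Complex.norm_conj (1 - torusChar b (rootWeight P i) t), map_sub, map_one]
  rw [regCot, regCot, normSqFun_torusRefl, h1, torusEval_torusRefl, map_sub, weylLaurent_expo,
    weylLaurent_expo, smul_neg, smul_rootWeight, ofIdx_smul_idx, rootWeight_neg, neg_neg,
    ← neg_div, torusEval_sub, torusEval_sub, neg_sub]

theorem hasDerivAt_regWeight {ε : ℝ} (hε : 0 < ε) (η : N) (t : UnitAddTorus b.support) :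
    HasDerivAt (fun s => (regWeight b k ε
        (t + torusLine (fun j => b.toCoweightBasis.repr η j) s) : ℂ))
      (2 * Real.pi * Complex.I * (regWeight b k ε t *
        ∑ i, (k i / 2 : ℂ) * cplxFunctional P (P.root i) ((1 : ℂ) ⊗ₜ η) * regCot b ε i t)) 0 := by
  set γ := torusLine (fun j => b.toCoweightBasis.repr η j) with hγ
  set z : ι → ℂ := fun i => 2 * Real.pi * Complex.I *
    (cplxFunctional P (P.root i) ((1 : ℂ) ⊗ₜ η) *
        torusEval b (expo P (-rootWeight P i) - expo P (rootWeight P i)) t) with hz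
  have hre : ∀ i, ((z i).re : ℂ) = z i := by
    intro i
    apply Complex.conj_eq_iff_re.1
    rw [hz]
    simp only [map_mul, cplxFunctional_tmul, one_mul, Complex.conj_ofReal, Complex.conj_I,
      ← torusEval_star, map_sub, starLaurent_expo, neg_neg, torusEval_sub, map_ofNat]
    ring
  have h0 : ∀ i, normSqFun b i (t + γ 0) + ε ≠ 0 := fun i =>
    (add_pos_of_nonneg_of_pos (normSqFun_nonneg b i _) hε).ne'
  have h1 : HasDerivAt (fun s => ∑ i, k i / 2 * Real.log (normSqFun b i (t + γ s) + ε))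
      (∑ i, k i / 2 * ((z i).re / (normSqFun b i (t + γ 0) + ε))) 0 :=
    HasDerivAt.fun_sum fun i _ =>
      (((hasDerivAt_normSqFun η i t).add_const ε).log (h0 i)).const_mul _
  have h2 := h1.exp.ofReal_comp
  have h3 : γ 0 = 0 := torusLine_zero _
  simp only [h3, add_zero] at h2
  have h4 : ((Real.exp (∑ i, k i / 2 * Real.log (normSqFun b i t + ε)) *
      ∑ i, k i / 2 * ((z i).re / (normSqFun b i t + ε)) : ℝ) : ℂ) =
      2 * Real.pi * Complex.I * (regWeight b k ε t *
        ∑ i, (k i / 2 : ℂ) * cplxFunctional P (P.root i) ((1 : ℂ) ⊗ₜ η) * regCot b ε i t) := by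
    have h5 : Real.exp (∑ i, k i / 2 * Real.log (normSqFun b i t + ε)) = regWeight b k ε t := rfl
    rw [h5, Complex.ofReal_mul, mul_left_comm]
    congr 1
    rw [Complex.ofReal_sum, Finset.mul_sum]
    refine Finset.sum_congr rfl fun i _ => ?_
    rw [Complex.ofReal_mul, Complex.ofReal_div (z i).re, hre, regCot]
    simp only [hz]
    push_cast
    ring
  exact h4 ▸ h2

/-- The pole of `(e^{-α} - e^{α}) / |1 - e^{-α}|²` on the kernel of `α` cancels on functions that
are antisymmetric under `s_α`. -/
theorem torusEval_regCot_mul (F : LaurentPoly P) (ε : ℝ) (i : ι) (t : UnitAddTorus b.support) :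
    torusEval b (F - weylLaurent P (σ i) F) t * regCot b ε i t =
      torusEval b ((1 + expo P (-rootWeight P i)) * divDiff P i F) t *
        (normSqFun b i t / (normSqFun b i t + ε) : ℝ) := by
  have h1 : oneSub P i * (expo P (-rootWeight P i) - expo P (rootWeight P i)) =
      (1 + expo P (-rootWeight P i)) * (oneSub P i * starLaurent P (oneSub P i)) := by
    rw [oneSub, map_sub, map_one, starLaurent_expo, neg_neg]
    linear_combination (1 - expo P (-rootWeight P i)) * expo_mul_expo_neg (rootWeight P i)
  have h2 := congrArg (fun f => torusEval b f t) h1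
  simp only [torusEval_mul _ _ (oneSub P i * _), ← ofReal_normSqFun] at h2
  rw [torusEval_mul] at h2
  rw [← oneSub_mul_divDiff, regCot, torusEval_mul, torusEval_mul]
  push_cast
  linear_combination torusEval b (divDiff P i F) t / ((normSqFun b i t : ℂ) + ε) * h2

/-- Integration by parts against the regularized weight function. -/
theorem integral_deriv_regWeight (hk : ∀ i j, k (P.reflectionPerm i j) = k j) {ε : ℝ} (hε : 0 < ε)
    (η : N) (F : LaurentPoly P) :
    ∫ t, torusEval b (derivLin P ((1 : ℂ) ⊗ₜ η) F) t * regWeight b k ε t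
        ∂torusMeasure b.support =
      -∑ i, (1 / 4 : ℂ) * (cplxFunctional P (P.root i) ((1 : ℂ) ⊗ₜ η)) *
        ∫ t, torusEval b ((1 + expo P (-rootWeight P i)) * divDiff P i F) t *
          (k i * (normSqFun b i t / (normSqFun b i t + ε)) * regWeight b k ε t : ℝ)
          ∂torusMeasure b.support := by
  have hcF : ∀ f : LaurentPoly P, Continuous (torusEval b f) := continuous_torusEval b
  have hcR : Continuous fun t => (regWeight b k ε t : ℂ) :=
    Complex.continuous_ofReal.comp (continuous_regWeight hε)
  have hcC : ∀ i, Continuous (regCot b ε i) := continuous_regCot hε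
  -- The integral of the total derivative vanishes.
  have h1 := integral_deriv_torusLine_eq_zero (d := b.support)
    (H := fun t => torusEval b F t * regWeight b k ε t)
    (H' := fun t => 2 * Real.pi * Complex.I * (torusEval b (derivLin P ((1 : ℂ) ⊗ₜ η) F) t *
        regWeight b k ε t + torusEval b F t * (regWeight b k ε t *
        ∑ i, (k i / 2 : ℂ) * cplxFunctional P (P.root i) ((1 : ℂ) ⊗ₜ η) * regCot b ε i t)))
    ((hcF F).mul hcR)
    (continuous_const.mul (((hcF _).mul hcR).add ((hcF F).mul (hcR.mul
      (continuous_finsetSum _ fun i _ => continuous_const.mul (hcC i))))))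
    (fun j => b.toCoweightBasis.repr η j) (fun t => by
      have h2 := (hasDerivAt_torusEval b η F t).mul (hasDerivAt_regWeight (k := k) hε η t)
      simp only [torusLine_zero, add_zero] at h2
      refine h2.congr_deriv ?_
      ring)
  rw [integral_const_mul] at h1
  have h1' := (mul_eq_zero.1 h1).resolve_left Complex.two_pi_I_ne_zero
  have hI1 : Integrable (fun t => torusEval b (derivLin P ((1 : ℂ) ⊗ₜ η) F) t * regWeight b k ε t)
      (torusMeasure b.support) := integrable_torus ((hcF _).mul hcR)
  have hI2 : Integrable (fun t => torusEval b F t * (regWeight b k ε t *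
      ∑ i, (k i / 2 : ℂ) * cplxFunctional P (P.root i) ((1 : ℂ) ⊗ₜ η) * regCot b ε i t))
      (torusMeasure b.support) := integrable_torus ((hcF F).mul (hcR.mul
      (continuous_finsetSum _ fun i _ => continuous_const.mul (hcC i))))
  rw [integral_add hI1 hI2] at h1'
  -- The reflections make the remaining integrands regular.
  have h3 : ∀ i, ∫ t, torusEval b F t * regWeight b k ε t * regCot b ε i t ∂torusMeasure b.support =
      (1 / 2 : ℂ) * ∫ t, torusEval b ((1 + expo P (-rootWeight P i)) * divDiff P i F) t *
        ((normSqFun b i t / (normSqFun b i t + ε)) * regWeight b k ε t : ℝ)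
          ∂torusMeasure b.support := by
    intro i
    have hI : ∀ f : LaurentPoly P, Integrable (fun t => torusEval b f t * regWeight b k ε t *
        regCot b ε i t) (torusMeasure b.support) := fun f =>
      integrable_torus (((hcF f).mul hcR).mul (hcC i))
    have hc : Continuous fun t => torusEval b F t * regWeight b k ε t * regCot b ε i t :=
      ((hcF F).mul hcR).mul (hcC i)
    have h4 := integral_torusRefl b i hc
    simp only [torusEval_torusRefl, regWeight_torusRefl hk, regCot_torusRefl, mul_neg,
      integral_neg] at h4
    have h5 : ∫ t, torusEval b (F - weylLaurent P (σ i) F) t * regWeight b k ε t * regCot b ε i t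
        ∂torusMeasure b.support =
        2 * ∫ t, torusEval b F t * regWeight b k ε t * regCot b ε i t ∂torusMeasure b.support := by
      simp only [torusEval_sub, sub_mul]
      rw [integral_sub (hI _) (hI _)]
      linear_combination h4
    have h6 : ∀ t, torusEval b (F - weylLaurent P (σ i) F) t * regWeight b k ε t *
        regCot b ε i t = torusEval b ((1 + expo P (-rootWeight P i)) * divDiff P i F) t *
        ((normSqFun b i t / (normSqFun b i t + ε)) * regWeight b k ε t : ℝ) := by
      intro t
      rw [mul_right_comm, torusEval_regCot_mul]
      push_cast
      ring
    simp only [h6] at h5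
    linear_combination -(1 / 2 : ℂ) * h5
  have h7 : ∫ t, torusEval b F t * (regWeight b k ε t * ∑ i, (k i / 2 : ℂ) *
      cplxFunctional P (P.root i) ((1 : ℂ) ⊗ₜ η) * regCot b ε i t) ∂torusMeasure b.support =
      ∑ i, (k i / 2 : ℂ) * cplxFunctional P (P.root i) ((1 : ℂ) ⊗ₜ η) *
        ∫ t, torusEval b F t * regWeight b k ε t * regCot b ε i t ∂torusMeasure b.support := by
    have h8 : ∀ t, torusEval b F t * (regWeight b k ε t * ∑ i, (k i / 2 : ℂ) *
      cplxFunctional P (P.root i) ((1 : ℂ) ⊗ₜ η) * regCot b ε i t) =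
      ∑ i, (k i / 2 : ℂ) * cplxFunctional P (P.root i) ((1 : ℂ) ⊗ₜ η) *
        (torusEval b F t * regWeight b k ε t * regCot b ε i t) := by
      intro t
      rw [Finset.mul_sum, Finset.mul_sum]
      exact Finset.sum_congr rfl fun i _ => by ring
    simp only [h8]
    have hI : ∀ i, Integrable (fun t => (k i / 2 : ℂ) *
        cplxFunctional P (P.root i) ((1 : ℂ) ⊗ₜ η) *
        (torusEval b F t * regWeight b k ε t * regCot b ε i t)) (torusMeasure b.support) :=
      fun i => integrable_torus (continuous_const.mul (((hcF F).mul hcR).mul (hcC i)))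
    rw [integral_finsetSum _ fun i _ => hI i]
    exact Finset.sum_congr rfl fun i _ => integral_const_mul _ _
  rw [h7] at h1'
  rw [eq_neg_of_add_eq_zero_left h1']
  congr 1
  refine Finset.sum_congr rfl fun i _ => ?_
  have h9 : ∀ t, torusEval b ((1 + expo P (-rootWeight P i)) * divDiff P i F) t *
          (k i * (normSqFun b i t / (normSqFun b i t + ε)) * regWeight b k ε t : ℝ) =
      k i * (torusEval b ((1 + expo P (-rootWeight P i)) * divDiff P i F) t *
          ((normSqFun b i t / (normSqFun b i t + ε)) * regWeight b k ε t : ℝ)) := by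
    intro t
    push_cast
    ring
  simp only [h9]
  rw [integral_const_mul, h3]
  ring

end Weight

section Weight

variable {ι M N : Type*} [Fintype ι] [AddCommGroup M] [Module ℝ M] [AddCommGroup N] [Module ℝ N]
  {P : RootPairing ι ℝ M N} [P.IsRootSystem] [P.IsCrystallographic] {b : P.Base}
  {I : Set b.support} {k : ι → ℝ}

local notation "σ" => RootPairing.weylGroup.ofIdx P

theorem neg_neg_idx (i : ι) : P.reflectionPerm (P.reflectionPerm i i) (P.reflectionPerm i i) = i := by
  apply P.root.injective
  rw [root_neg, root_neg, neg_neg]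

open scoped Classical in
theorem sum_eq_sum_isPos {X : Type*} [AddCommMonoid X] (b : P.Base) (f : ι → X) :
    ∑ i, f i = ∑ i with b.IsPos i, (f i + f (P.reflectionPerm i i)) := by
  rw [Finset.sum_add_distrib, ← Finset.sum_filter_add_sum_filter_not Finset.univ b.IsPos]
  congr 1
  refine Finset.sum_nbij' (fun i => P.reflectionPerm i i) (fun i => P.reflectionPerm i i)
    ?_ ?_ ?_ ?_ ?_
  · intro i hi
    simpa [isPos_neg_iff b] using hi
  · intro i hi
    simpa [isPos_neg_iff b] using hi
  · exact fun i _ => neg_neg_idx i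
  · exact fun i _ => neg_neg_idx i
  · intro i _
    rw [neg_neg_idx]

theorem divDiff_neg (i : ι) (f : LaurentPoly P) :
    (1 + expo P (-rootWeight P (P.reflectionPerm i i))) * divDiff P (P.reflectionPerm i i) f =
      -((1 + expo P (-rootWeight P i)) * divDiff P i f) := by
  apply mul_left_cancel₀ (oneSub_ne_zero (P := P) (P.reflectionPerm i i))
  have h1 := oneSub_mul_divDiff (P.reflectionPerm i i) f
  have h2 := oneSub_mul_divDiff i f
  rw [ofIdx_neg, ← h2] at h1
  have h3 : oneSub P (P.reflectionPerm i i) = 1 - expo P (rootWeight P i) := by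
    rw [oneSub, rootWeight_neg, neg_neg]
  rw [mul_left_comm, h1, rootWeight_neg, neg_neg, h3, oneSub]
  linear_combination (-2 * divDiff P i f) * expo_mul_expo_neg (rootWeight P i)

/-! ### The weight functional -/

/-- The functional `f ↦ ∫_T f ∏_α |e^{α/2} - e^{-α/2}|^{k_α} dt` on `ℂ[P]`. -/
def weightFunctional (b : P.Base) (hk0 : ∀ i, 0 ≤ k i) : LaurentPoly P →ₗ[ℂ] ℂ where
  toFun f := ∫ t, torusEval b f t * (torusWeight b k t : ℂ) ∂torusMeasure b.support
  map_add' f g := by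
    have h : ∀ f : LaurentPoly P, Integrable (fun t => torusEval b f t * (torusWeight b k t : ℂ))
        (torusMeasure b.support) := fun f => integrable_torus
      ((continuous_torusEval b f).mul (Complex.continuous_ofReal.comp (continuous_torusWeight hk0)))
    simp only [torusEval_add, add_mul]
    exact integral_add (h f) (h g)
  map_smul' c f := by
    simp only [torusEval_smul, mul_assoc, RingHom.id_apply, smul_eq_mul]
    exact integral_const_mul _ _

variable (hk0 : ∀ i, 0 ≤ k i)

theorem weightFunctional_apply (f : LaurentPoly P) : weightFunctional b hk0 f =
    ∫ t, torusEval b f t * (torusWeight b k t : ℂ) ∂torusMeasure b.support :=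
  rfl

theorem innerProd_eq (f g : LaurentPoly P) :
    innerProd b k f g = weightFunctional b hk0 (starLaurent P f * g) := by
  simp only [weightFunctional_apply, torusEval_mul, torusEval_star]
  rfl

theorem continuous_torusEval_mul_torusWeight (hk0 : ∀ i, 0 ≤ k i) (f : LaurentPoly P) :
    Continuous fun t => torusEval b f t * (torusWeight b k t : ℂ) :=
  (continuous_torusEval b f).mul (Complex.continuous_ofReal.comp (continuous_torusWeight hk0))

theorem weightFunctional_weyl (hk : ∀ i j, k (P.reflectionPerm i j) = k j) (i : ι)
    (f : LaurentPoly P) :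
    weightFunctional b hk0 (weylLaurent P (σ i) f) = weightFunctional b hk0 f := by
  have h := integral_torusRefl b i (continuous_torusEval_mul_torusWeight (b := b) hk0 f)
  simp only [torusEval_torusRefl, torusWeight_torusRefl hk] at h
  exact h

theorem weightFunctional_star (f : LaurentPoly P) : weightFunctional b hk0 (starLaurent P f) =
    starRingEnd ℂ (weightFunctional b hk0 f) := by
  rw [weightFunctional_apply, weightFunctional_apply, ← integral_conj]
  simp only [torusEval_star, map_mul, Complex.conj_ofReal]

/-- The weight function is continuous and vanishes only on the zero set of `∏_α (1 - e^{-α})`. -/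
theorem weightFunctional_definite (f : LaurentPoly P)
    (hf : weightFunctional b hk0 (starLaurent P f * f) = 0) : f = 0 := by
  by_contra hne
  have h1 : f * ∏ i, oneSub P i ≠ 0 :=
    mul_ne_zero hne (Finset.prod_ne_zero_iff.2 fun i _ => oneSub_ne_zero i)
  obtain ⟨t, ht⟩ := exists_torusEval_ne_zero b h1
  rw [torusEval_mul, torusEval_prod] at ht
  have h2 : ∀ s, torusEval b (starLaurent P f * f) s * (torusWeight b k s : ℂ) =
      ((‖torusEval b f s‖ ^ 2 * torusWeight b k s : ℝ) : ℂ) := by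
    intro s
    rw [torusEval_mul, torusEval_star, mul_comm (starRingEnd ℂ _), Complex.mul_conj,
      Complex.normSq_eq_norm_sq]
    push_cast
    rfl
  rw [weightFunctional_apply] at hf
  simp only [h2] at hf
  have hf : ∫ s, ‖torusEval b f s‖ ^ 2 * torusWeight b k s ∂torusMeasure b.support = 0 :=
    Complex.ofReal_eq_zero.1 (integral_ofReal.symm.trans hf)
  have hc : Continuous fun s => ‖torusEval b f s‖ ^ 2 * torusWeight b k s :=
    ((continuous_torusEval b f).norm.pow 2).mul (continuous_torusWeight hk0)
  have h3 : 0 < ∫ s, ‖torusEval b f s‖ ^ 2 * torusWeight b k s ∂torusMeasure b.support := by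
    refine hc.integral_pos_of_hasCompactSupport_nonneg_nonzero (x := t)
      (HasCompactSupport.of_compactSpace _) (fun s => ?_) (mul_ne_zero ?_ ?_)
    · exact mul_nonneg (sq_nonneg _) (torusWeight_nonneg s)
    · exact pow_ne_zero _ (norm_ne_zero_iff.2 (left_ne_zero_of_mul ht))
    · have h4 := Finset.prod_ne_zero_iff.1 (right_ne_zero_of_mul ht)
      refine Finset.prod_ne_zero_iff.2 fun i hi => ?_
      have h5 := h4 i hi
      rw [torusEval_oneSub] at h5
      exact (Real.rpow_pos_of_pos (norm_pos_iff.2 h5) _).ne'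
  exact h3.ne' hf

theorem tendsto_integral_regWeight (f : LaurentPoly P) :
    Filter.Tendsto (fun ε => ∫ t, torusEval b f t * regWeight b k ε t ∂torusMeasure b.support)
      (nhdsWithin 0 (Set.Ioi 0)) (nhds (weightFunctional b hk0 f)) := by
  refine tendsto_integral_filter_of_dominated_convergence
    (fun t => ‖torusEval b f t‖ * ∏ i, (5 : ℝ) ^ (k i / 2)) ?_ ?_ ?_ ?_
  · filter_upwards [self_mem_nhdsWithin] with ε hε
    exact (integrable_torus ((continuous_torusEval b f).mul
      (Complex.continuous_ofReal.comp (continuous_regWeight hε)))).aestronglyMeasurable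
  · filter_upwards [self_mem_nhdsWithin, nhdsWithin_le_nhds (Iic_mem_nhds (zero_lt_one' ℝ))]
      with ε hε hε1
    refine Filter.Eventually.of_forall fun t => ?_
    rw [norm_mul, Complex.norm_real, Real.norm_of_nonneg (regWeight_nonneg ε t)]
    exact mul_le_mul_of_nonneg_left (regWeight_le hk0 hε hε1 t) (norm_nonneg _)
  · exact integrable_torus ((continuous_torusEval b f).norm.mul continuous_const)
  · refine Filter.Eventually.of_forall fun t => ?_
    exact tendsto_const_nhds.mul
      ((Complex.continuous_ofReal.tendsto _).comp (tendsto_regWeight hk0 t))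

/-- The factor `k_α x / (x + ε)` with `x = |1 - e^{-α}|²` tends to `k_α` off the zero set of the
weight function. -/
theorem tendsto_mul_regWeight (hk0 : ∀ i, 0 ≤ k i) (i : ι) (t : UnitAddTorus b.support) :
    Filter.Tendsto (fun ε => k i * (normSqFun b i t / (normSqFun b i t + ε)) * regWeight b k ε t)
      (nhdsWithin 0 (Set.Ioi 0)) (nhds (k i * torusWeight b k t)) := by
  have h0 := tendsto_regWeight hk0 t
  by_cases hx : normSqFun b i t = 0
  · by_cases hi : k i = 0
    · simp [hi]
    · have h1 : torusWeight b k t = 0 := by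
        rw [torusWeight_eq_prod]
        refine Finset.prod_eq_zero (Finset.mem_univ i) ?_
        rw [hx, Real.zero_rpow (div_ne_zero hi two_ne_zero)]
      simp [h1, hx]
  · refine Filter.Tendsto.mul ?_ h0
    have h1 : Filter.Tendsto (fun ε : ℝ => k i * (normSqFun b i t / (normSqFun b i t + ε)))
        (nhds 0) (nhds (k i * (normSqFun b i t / (normSqFun b i t + 0)))) :=
      tendsto_const_nhds.mul (tendsto_const_nhds.div (tendsto_const_nhds.add Filter.tendsto_id)
        (by rwa [add_zero]))
    rw [add_zero, div_self hx, mul_one] at h1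
    exact h1.mono_left nhdsWithin_le_nhds

theorem tendsto_integral_mul_regWeight (i : ι) (f : LaurentPoly P) :
    Filter.Tendsto (fun ε => ∫ t, torusEval b f t *
        (k i * (normSqFun b i t / (normSqFun b i t + ε)) * regWeight b k ε t : ℝ)
        ∂torusMeasure b.support)
      (nhdsWithin 0 (Set.Ioi 0)) (nhds (k i * weightFunctional b hk0 f)) := by
  have h0 : (k i : ℂ) * weightFunctional b hk0 f =
      ∫ t, torusEval b f t * ((k i * torusWeight b k t : ℝ) : ℂ) ∂torusMeasure b.support := by
    rw [weightFunctional_apply, ← integral_const_mul]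
    congr 1
    funext t
    push_cast
    ring
  rw [h0]
  refine tendsto_integral_filter_of_dominated_convergence
    (fun t => ‖torusEval b f t‖ * (k i * ∏ i, (5 : ℝ) ^ (k i / 2))) ?_ ?_ ?_ ?_
  · filter_upwards [self_mem_nhdsWithin] with ε hε
    refine (integrable_torus ((continuous_torusEval b f).mul (Complex.continuous_ofReal.comp
      ((continuous_const.mul ((continuous_normSqFun b i).div
        ((continuous_normSqFun b i).add continuous_const) fun t => ?_)).mul
          (continuous_regWeight hε))))).aestronglyMeasurable
    exact (add_pos_of_nonneg_of_pos (normSqFun_nonneg b i t) hε).ne'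
  · filter_upwards [self_mem_nhdsWithin, nhdsWithin_le_nhds (Iic_mem_nhds (zero_lt_one' ℝ))]
      with ε hε hε1
    refine Filter.Eventually.of_forall fun t => ?_
    have hε' : 0 < ε := hε
    have h1 : 0 ≤ normSqFun b i t / (normSqFun b i t + ε) :=
      div_nonneg (normSqFun_nonneg b i t) (add_nonneg (normSqFun_nonneg b i t) hε'.le)
    have h2 : normSqFun b i t / (normSqFun b i t + ε) ≤ 1 :=
      div_le_one_of_le₀ (by linarith) (add_nonneg (normSqFun_nonneg b i t) hε'.le)
    rw [norm_mul, Complex.norm_real, Real.norm_of_nonneg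
      (mul_nonneg (mul_nonneg (hk0 i) h1) (regWeight_nonneg ε t))]
    refine mul_le_mul_of_nonneg_left ?_ (norm_nonneg _)
    exact mul_le_mul (mul_le_of_le_one_right (hk0 i) h2) (regWeight_le hk0 hε hε1 t)
      (regWeight_nonneg ε t) (hk0 i)
  · exact integrable_torus ((continuous_torusEval b f).norm.mul continuous_const)
  · refine Filter.Eventually.of_forall fun t => ?_
    exact tendsto_const_nhds.mul
      ((Complex.continuous_ofReal.tendsto _).comp (tendsto_mul_regWeight hk0 i t))

/-- Integration by parts: the term of each root `α` is combined with that of `-α`. -/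
theorem weightFunctional_deriv (hk : ∀ i j, k (P.reflectionPerm i j) = k j) (η : N)
    (f : LaurentPoly P) :
    open scoped Classical in
    weightFunctional b hk0 (derivLin P ((1 : ℂ) ⊗ₜ η) f) =
      -∑ i with b.IsPos i, (1 / 2 : ℂ) * (cplxFunctional P (P.root i) ((1 : ℂ) ⊗ₜ η) * k i) *
        weightFunctional b hk0 ((1 + expo P (-rootWeight P i)) * divDiff P i f) := by
  classical
  have h1 := tendsto_integral_regWeight (b := b) hk0 (derivLin P ((1 : ℂ) ⊗ₜ η) f)
  have h2 : Filter.Tendsto (fun ε => -∑ i, (1 / 4 : ℂ) *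
        (cplxFunctional P (P.root i) ((1 : ℂ) ⊗ₜ η)) *
        ∫ t, torusEval b ((1 + expo P (-rootWeight P i)) * divDiff P i f) t *
          (k i * (normSqFun b i t / (normSqFun b i t + ε)) * regWeight b k ε t : ℝ)
          ∂torusMeasure b.support) (nhdsWithin 0 (Set.Ioi 0))
      (nhds (-∑ i, (1 / 4 : ℂ) * (cplxFunctional P (P.root i) ((1 : ℂ) ⊗ₜ η)) *
        (k i * weightFunctional b hk0 ((1 + expo P (-rootWeight P i)) * divDiff P i f)))) :=
    (tendsto_finsetSum _ fun i _ => tendsto_const_nhds.mul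
      (tendsto_integral_mul_regWeight hk0 i _)).neg
  have h3 := tendsto_nhds_unique_of_eventuallyEq h1 h2 (by
    filter_upwards [self_mem_nhdsWithin] with ε hε
    exact integral_deriv_regWeight hk hε η f)
  rw [h3, sum_eq_sum_isPos b]
  congr 1
  refine Finset.sum_congr rfl fun i _ => ?_
  have h4 : cplxFunctional P (-P.root i) = -cplxFunctional P (P.root i) :=
    map_neg (cplxFunctionalHom P) (P.root i)
  rw [divDiff_neg, hk, root_neg, h4, map_neg, LinearMap.neg_apply]
  ring

theorem isWeightFunctional (hk : ∀ i j, k (P.reflectionPerm i j) = k j) :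
    IsWeightFunctional b k (weightFunctional b hk0) where
  invariant := weightFunctional_weyl hk0 hk
  conj := weightFunctional_star hk0
  definite := weightFunctional_definite hk0
  deriv η f := by
    convert weightFunctional_deriv hk0 hk η f

end Weight

end Integration

section Jacobi

variable {ι M N : Type*} [Fintype ι] [AddCommGroup M] [Module ℝ M] [AddCommGroup N] [Module ℝ N]
  {P : RootPairing ι ℝ M N} [P.IsRootSystem] [P.IsCrystallographic] {b : P.Base}
  {I : Set b.support} {k : ι → ℝ}

local notation "σ" => RootPairing.weylGroup.ofIdx P

/-! ### Invariant Laurent polynomials -/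

/-- The space `ℂ[P]^{W_I}`. -/
def invLaurent (b : P.Base) (I : Set b.support) : Submodule ℂ (LaurentPoly P) where
  carrier := {f | ∀ w ∈ parabolic b I, weylLaurent P w f = f}
  add_mem' {f g} hf hg w hw := by rw [map_add, hf w hw, hg w hw]
  zero_mem' w _ := map_zero _
  smul_mem' c f hf w hw := by rw [map_smul (weylLaurent P w), hf w hw]

theorem laurent_ext {f g : LaurentPoly P} (h : ∀ μ, f.coeff μ = g.coeff μ) : f = g :=
  AddMonoidAlgebra.coeff_injective (Finsupp.ext h)

theorem mem_invLaurent_iff_coeff {f : LaurentPoly P} :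
    f ∈ invLaurent b I ↔ ∀ w ∈ parabolic b I, ∀ μ, f.coeff (w • μ) = f.coeff μ := by
  constructor
  · intro h w hw μ
    rw [← coeff_weylLaurent w f μ, h w hw]
  · intro h w hw
    refine laurent_ext fun μ => ?_
    rw [← smul_inv_smul w μ, coeff_weylLaurent, h w hw]

theorem invLaurent_empty : invLaurent b ∅ = ⊤ := by
  refine eq_top_iff.2 fun f _ w hw => ?_
  rw [parabolic_empty, Subgroup.mem_bot] at hw
  rw [hw, weylLaurent_one]

theorem coeff_domRep {f : LaurentPoly P} (hf : f ∈ invLaurent b I) (μ : weightLattice P) :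
    f.coeff (domRep b I μ) = f.coeff μ := by
  obtain ⟨w, hw, h⟩ := exists_domRep_eq (I := I) μ
  rw [h, mem_invLaurent_iff_coeff.1 hf w hw]

theorem finite_orbit (x : weightLattice P) : {y | ∃ w ∈ parabolic b I, y = w • x}.Finite :=
  (Set.finite_range fun w : P.weylGroup => w • x).subset fun _ ⟨w, _, h⟩ => ⟨w, h.symm⟩

theorem mem_orbit_iff {x : weightLattice P} (hx : x ∈ domWeights b I) (y : weightLattice P) :
    (∃ w ∈ parabolic b I, y = w • x) ↔ domRep b I y = x := by
  constructor
  · rintro ⟨w, hw, rfl⟩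
    rw [domRep_smul hw, domRep_of_mem hx]
  · rintro rfl
    obtain ⟨w, hw, h⟩ := exists_domRep_eq (I := I) y
    exact ⟨w⁻¹, inv_mem hw, by rw [h, inv_smul_smul]⟩

theorem coeff_sum_expo (s : Finset (weightLattice P)) (μ : weightLattice P) [Decidable (μ ∈ s)] :
    (∑ y ∈ s, expo P y).coeff μ = if μ ∈ s then 1 else 0 := by
  classical
  rw [AddMonoidAlgebra.coeff_sum, Finsupp.finsetSum_apply]
  simp only [coeff_expo, Finset.sum_ite_eq']
  congr

open scoped Classical in
theorem coeff_orbitSum {x : weightLattice P} (hx : x ∈ domWeights b I) (μ : weightLattice P) :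
    (orbitSum b I x).coeff μ = if domRep b I μ = x then 1 else 0 := by
  rw [orbitSum, finsum_mem_eq_finite_toFinset_sum _ (finite_orbit x), coeff_sum_expo]
  simp only [Set.Finite.mem_toFinset, Set.mem_ofPred_eq, mem_orbit_iff hx]

theorem orbitSum_mem_invLaurent {x : weightLattice P} (hx : x ∈ domWeights b I) :
    orbitSum b I x ∈ invLaurent b I := by
  rw [mem_invLaurent_iff_coeff]
  intro w hw μ
  rw [coeff_orbitSum hx, coeff_orbitSum hx, domRep_smul hw]

theorem eq_sum_orbitSum {f : LaurentPoly P} (hf : f ∈ invLaurent b I) :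
    f = ∑ᶠ y ∈ domRep b I '' f.coeff.support, f.coeff y • orbitSum b I y := by
  classical
  have hfin : (domRep b I '' (f.coeff.support : Set (weightLattice P))).Finite :=
    (Finset.finite_toSet _).image _
  rw [finsum_mem_eq_finite_toFinset_sum _ hfin]
  refine laurent_ext fun μ => ?_
  rw [AddMonoidAlgebra.coeff_sum, Finsupp.finsetSum_apply]
  have h1 : ∀ y ∈ hfin.toFinset, (f.coeff y • orbitSum b I y).coeff μ =
      if domRep b I μ = y then f.coeff μ else 0 := by
    intro y hy
    obtain ⟨z, -, rfl⟩ := hfin.mem_toFinset.1 hy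
    rw [AddMonoidAlgebra.coeff_smul, Finsupp.smul_apply, coeff_orbitSum (domRep_mem z),
      smul_eq_mul, mul_ite, mul_one, mul_zero]
    split_ifs with h
    · rw [← h, coeff_domRep hf]
    · rfl
  rw [Finset.sum_congr rfl h1, Finset.sum_ite_eq]
  split_ifs with h
  · rfl
  · by_contra hne
    exact h (hfin.mem_toFinset.2 ⟨μ, Finsupp.mem_support_iff.2 hne, rfl⟩)

/-- The span of the `m_I(y)`, `y < x`. -/
def lowerSpan (b : P.Base) (I : Set b.support) (x : weightLattice P) :
    Submodule ℂ (LaurentPoly P) :=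
  Submodule.span ℂ (orbitSum b I '' {y | y ∈ domWeights b I ∧ weightLE b y x ∧ y ≠ x})

theorem mem_lowerSpan {x : weightLattice P} {f : LaurentPoly P} :
    f ∈ lowerSpan b I x ↔ f ∈ invLaurent b I ∧
      f ∈ suppIn {μ | weightLE b (domRep b I μ) x ∧ domRep b I μ ≠ x} := by
  constructor
  · intro hf
    suffices h : lowerSpan b I x ≤ invLaurent b I ⊓
        suppIn {μ | weightLE b (domRep b I μ) x ∧ domRep b I μ ≠ x} from h hf
    refine Submodule.span_le.2 ?_
    rintro _ ⟨y, ⟨hy, hyx, hne⟩, rfl⟩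
    refine ⟨orbitSum_mem_invLaurent hy, fun μ hμ => ?_⟩
    rw [coeff_orbitSum hy] at hμ
    have h : domRep b I μ = y := by
      by_contra h
      exact hμ (if_neg h)
    rw [Set.mem_ofPred_eq, h]
    exact ⟨hyx, hne⟩
  · rintro ⟨hf, hs⟩
    rw [eq_sum_orbitSum hf, finsum_mem_eq_finite_toFinset_sum _ ((Finset.finite_toSet _).image _)]
    refine Submodule.sum_mem _ fun y hy => Submodule.smul_mem _ _ (Submodule.subset_span ?_)
    obtain ⟨z, hz, rfl⟩ := (Set.Finite.mem_toFinset _).1 hy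
    obtain ⟨h1, h2⟩ := hs z (Finsupp.mem_support_iff.1 hz)
    exact ⟨_, ⟨domRep_mem z, h1, h2⟩, rfl⟩

/-- Induction along the ordering of the weight lattice. -/
theorem weightLE_induction (b : P.Base) {p : weightLattice P → Prop}
    (h : ∀ x, (∀ y, weightLE b y x → y ≠ x → p y) → p x) (x : weightLattice P) : p x := by
  induction hn : {y | weightLE b y x}.ncard using Nat.strong_induction_on generalizing x with
  | _ n ih =>
    refine h x fun y hy hne => ih _ ?_ y rfl
    rw [← hn]
    refine Set.ncard_lt_ncard ⟨fun z hz => weightLE_trans hz hy, fun hsub => ?_⟩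
      (finite_weightLE b x)
    exact hne (weightLE_antisymm hy (hsub (weightLE_refl x)))

/-! ### Existence and uniqueness of the Jacobi polynomials -/

variable {L : LaurentPoly P →ₗ[ℂ] ℂ}

theorem IsWeightFunctional.conj_mul (hL : IsWeightFunctional b k L) (f g : LaurentPoly P) :
    L (starLaurent P g * f) = starRingEnd ℂ (L (starLaurent P f * g)) := by
  rw [← hL.conj, map_mul (starLaurent P), starLaurent_starLaurent, mul_comm]

theorem IsWeightFunctional.mul_eq_zero_comm (hL : IsWeightFunctional b k L) {f g : LaurentPoly P} :
    L (starLaurent P f * g) = 0 ↔ L (starLaurent P g * f) = 0 := by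
  rw [hL.conj_mul f g, map_eq_zero (starRingEnd ℂ)]

theorem IsWeightFunctional.eq_of_forall (hL : IsWeightFunctional b k L) {f g : LaurentPoly P}
    (h : ∀ u, L (starLaurent P u * f) = L (starLaurent P u * g)) : f = g := by
  refine sub_eq_zero.1 (hL.definite _ ?_)
  rw [mul_sub, map_sub, h, sub_self]

/-- Orthogonal projection onto the span of finitely many linearly independent elements. -/
theorem IsWeightFunctional.exists_orthogonal (hL : IsWeightFunctional b k L) {S : Type*} [Finite S]
    {v : S → LaurentPoly P} (hv : LinearIndependent ℂ v) (g : LaurentPoly P) :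
    ∃ q ∈ Submodule.span ℂ (Set.range v), ∀ y, L (starLaurent P (v y) * (g + q)) = 0 := by
  have := Fintype.ofFinite S
  let G : (S → ℂ) →ₗ[ℂ] (S → ℂ) := LinearMap.pi fun y =>
    L ∘ₗ LinearMap.mulLeft ℂ (starLaurent P (v y)) ∘ₗ Fintype.linearCombination ℂ v
  have hG : ∀ c y, G c y = L (starLaurent P (v y) * Fintype.linearCombination ℂ v c) :=
    fun c y => rfl
  have hinj : Function.Injective G := by
    rw [injective_iff_map_eq_zero]
    intro c hc
    have h1 : Fintype.linearCombination ℂ v c = 0 := by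
      apply hL.definite
      have h2 : ∀ y, L (starLaurent P (v y) * Fintype.linearCombination ℂ v c) = 0 :=
        fun y => (hG c y).symm.trans (congrFun hc y)
      conv_lhs => rw [Fintype.linearCombination_apply ℂ v c, map_sum, Finset.sum_mul, map_sum]
      refine Finset.sum_eq_zero fun y _ => ?_
      rw [starLaurent_smul, smul_mul_assoc, map_smul, ← Fintype.linearCombination_apply ℂ v c, h2,
        smul_zero]
    rw [Fintype.linearCombination_apply] at h1
    exact funext (Fintype.linearIndependent_iff.1 hv c h1)
  obtain ⟨c, hc⟩ := (LinearMap.injective_iff_surjective.1 hinj)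
    fun y => -L (starLaurent P (v y) * g)
  refine ⟨Fintype.linearCombination ℂ v c, ?_, fun y => ?_⟩
  · rw [← Fintype.range_linearCombination]
    exact LinearMap.mem_range_self _ _
  · rw [mul_add, map_add, ← hG, hc, add_neg_cancel]

theorem linearIndependent_orbitSum (S : Set (weightLattice P)) (hS : S ⊆ domWeights b I) :
    LinearIndependent ℂ fun y : S => orbitSum b I (y : weightLattice P) := by
  classical
  rw [linearIndependent_iff']
  intro s g hg y hy
  have h1 := congrArg (fun f : LaurentPoly P => f.coeff (y : weightLattice P)) hg
  simp only [AddMonoidAlgebra.coeff_sum, AddMonoidAlgebra.coeff_smul, Finsupp.finsetSum_apply,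
    Finsupp.smul_apply, AddMonoidAlgebra.coeff_zero, Finsupp.zero_apply] at h1
  have h2 : ∀ z : S, (orbitSum b I (z : weightLattice P)).coeff (y : weightLattice P) =
      if y = z then 1 else 0 := by
    intro z
    rw [coeff_orbitSum (hS z.2), domRep_of_mem (hS y.2)]
    simp only [Subtype.ext_iff]
  simp only [h2, smul_eq_mul, mul_ite, mul_one, mul_zero] at h1
  rw [Finset.sum_ite_eq, if_pos hy] at h1
  exact h1

/-- The defining property of the Jacobi polynomials, for the form `(f, g) ↦ L(f̄ g)`. -/
def IsOrthogonalTop (b : P.Base) (I : Set b.support) (L : LaurentPoly P →ₗ[ℂ] ℂ)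
    (x : weightLattice P) (p : LaurentPoly P) : Prop :=
  p - orbitSum b I x ∈ lowerSpan b I x ∧ ∀ f ∈ lowerSpan b I x, L (starLaurent P p * f) = 0

/-- Orthogonality to the lower orbit sums is orthogonality to their span. -/
theorem isJacobi_iff (hkL : ∀ f g, innerProd b k f g = L (starLaurent P f * g))
    {x : weightLattice P} {p : LaurentPoly P} :
    IsJacobi b I k x p ↔ IsOrthogonalTop b I L x p := by
  refine and_congr Iff.rfl ⟨fun h f hf => ?_, fun h y hy hyx hne => ?_⟩
  · have h1 : lowerSpan b I x ≤
        LinearMap.ker (L ∘ₗ LinearMap.mulLeft ℂ (starLaurent P p)) := by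
      refine Submodule.span_le.2 ?_
      rintro _ ⟨y, ⟨hy, hyx, hne⟩, rfl⟩
      have := h y hy hyx hne
      rw [hkL] at this
      exact this
    exact h1 hf
  · rw [hkL]
    exact h _ (Submodule.subset_span ⟨y, ⟨hy, hyx, hne⟩, rfl⟩)

theorem IsOrthogonalTop.unique (hL : IsWeightFunctional b k L) {x : weightLattice P}
    {p q : LaurentPoly P} (hp : IsOrthogonalTop b I L x p) (hq : IsOrthogonalTop b I L x q) :
    p = q := by
  have h1 : p - q ∈ lowerSpan b I x := by
    have := Submodule.sub_mem _ hp.1 hq.1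
    rwa [sub_sub_sub_cancel_right] at this
  refine sub_eq_zero.1 (hL.definite _ ?_)
  rw [map_sub, sub_mul, map_sub, hp.2 _ h1, hq.2 _ h1, sub_self]

/-- The Jacobi polynomial is the component of `m_I(x)` orthogonal to the finitely many lower orbit
sums. -/
theorem exists_isOrthogonalTop (hL : IsWeightFunctional b k L) (x : weightLattice P) :
    ∃ p, IsOrthogonalTop b I L x p := by
  let S := {y | y ∈ domWeights b I ∧ weightLE b y x ∧ y ≠ x}
  have hfin : Finite S := ((finite_weightLE b x).subset fun y hy => hy.2.1).to_subtype
  have hli : LinearIndependent ℂ fun y : S => orbitSum b I (y : weightLattice P) :=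
    linearIndependent_orbitSum S fun y hy => hy.1
  obtain ⟨q, hq, h⟩ := hL.exists_orthogonal hli (orbitSum b I x)
  have hS : Set.range (fun y : S => orbitSum b I (y : weightLattice P)) = orbitSum b I '' S := by
    rw [Set.image_eq_range]
  rw [hS] at hq
  refine ⟨orbitSum b I x + q, by rwa [add_sub_cancel_left], fun f hf => ?_⟩
  have h1 : lowerSpan b I x ≤
      LinearMap.ker (L ∘ₗ LinearMap.mulLeft ℂ (starLaurent P (orbitSum b I x + q))) := by
    refine Submodule.span_le.2 ?_
    rintro _ ⟨y, hy, rfl⟩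
    exact hL.mul_eq_zero_comm.1 (h ⟨y, hy⟩)
  exact h1 hf

theorem IsOrthogonalTop.mem_invLaurent {x : weightLattice P} (hx : x ∈ domWeights b I)
    {p : LaurentPoly P} (hp : IsOrthogonalTop b I L x p) : p ∈ invLaurent b I := by
  rw [← sub_add_cancel p (orbitSum b I x)]
  exact Submodule.add_mem _ (mem_lowerSpan.1 hp.1).1 (orbitSum_mem_invLaurent hx)

open scoped Classical in
theorem IsOrthogonalTop.coeff {x : weightLattice P} (hx : x ∈ domWeights b I)
    {p : LaurentPoly P} (hp : IsOrthogonalTop b I L x p) {μ : weightLattice P}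
    (hμ : domRep b I μ = x) : p.coeff μ = 1 := by
  have h1 := (mem_lowerSpan.1 hp.1).2 μ
  rw [AddMonoidAlgebra.coeff_sub, Finsupp.sub_apply, coeff_orbitSum hx, if_pos hμ] at h1
  by_contra h
  exact (h1 (sub_ne_zero.2 h)).2 hμ

theorem IsOrthogonalTop.mem_suppIn {x : weightLattice P} (hx : x ∈ domWeights b I)
    {p : LaurentPoly P} (hp : IsOrthogonalTop b I L x p) :
    p ∈ suppIn {μ | weightLE b (domRep b I μ) x} := by
  classical
  rw [← sub_add_cancel p (orbitSum b I x)]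
  refine Submodule.add_mem _ (suppIn_mono (fun μ hμ => hμ.1) (mem_lowerSpan.1 hp.1).2) ?_
  intro μ hμ
  rw [coeff_orbitSum hx] at hμ
  have h : domRep b I μ = x := by
    by_contra h
    exact hμ (if_neg h)
  rw [Set.mem_ofPred_eq, h]
  exact weightLE_refl x

theorem IsOrthogonalTop.span_eq {p : domWeights b I → LaurentPoly P}
    (hp : ∀ x : domWeights b I, IsOrthogonalTop b I L x (p x)) :
    Submodule.span ℂ (Set.range p) = invLaurent b I := by
  refine le_antisymm (Submodule.span_le.2 ?_) fun f hf => ?_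
  · rintro _ ⟨x, rfl⟩
    exact (hp x).mem_invLaurent x.2
  · have h1 : ∀ x, x ∈ domWeights b I → orbitSum b I x ∈ Submodule.span ℂ (Set.range p) := by
      intro x
      induction x using weightLE_induction b with
      | _ x ih =>
        intro hx
        have h2 : lowerSpan b I x ≤ Submodule.span ℂ (Set.range p) := by
          refine Submodule.span_le.2 ?_
          rintro _ ⟨y, ⟨hy, hyx, hne⟩, rfl⟩
          exact ih y hyx hne hy
        rw [← sub_sub_cancel (p ⟨x, hx⟩) (orbitSum b I x)]
        exact Submodule.sub_mem _ (Submodule.subset_span ⟨_, rfl⟩) (h2 (hp ⟨x, hx⟩).1)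
    rw [eq_sum_orbitSum hf, finsum_mem_eq_finite_toFinset_sum _ ((Finset.finite_toSet _).image _)]
    refine Submodule.sum_mem _ fun y hy => Submodule.smul_mem _ _ (h1 y ?_)
    obtain ⟨z, -, rfl⟩ := (Set.Finite.mem_toFinset _).1 hy
    exact domRep_mem z

theorem IsOrthogonalTop.linearIndependent {p : domWeights b I → LaurentPoly P}
    (hp : ∀ x : domWeights b I, IsOrthogonalTop b I L x (p x)) : LinearIndependent ℂ p := by
  classical
  rw [linearIndependent_iff']
  intro s g hg
  by_contra! hne
  obtain ⟨x0, hx0, hgx0⟩ := hne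
  -- Compare coefficients at a maximal weight that occurs.
  obtain ⟨x, hx, hmax⟩ := (s.filter fun x => g x ≠ 0).exists_minimalFor
    (fun x : domWeights b I => -({y | weightLE b y x}.ncard : ℤ))
    ⟨x0, Finset.mem_filter.2 ⟨hx0, hgx0⟩⟩
  have h1 := congrArg (fun f : LaurentPoly P => f.coeff (x : weightLattice P)) hg
  simp only [AddMonoidAlgebra.coeff_sum, AddMonoidAlgebra.coeff_smul, Finsupp.finsetSum_apply,
    Finsupp.smul_apply, AddMonoidAlgebra.coeff_zero, Finsupp.zero_apply] at h1
  rw [Finset.sum_eq_single x] at h1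
  · rw [(hp x).coeff x.2 (domRep_of_mem x.2), smul_eq_mul, mul_one] at h1
    exact (Finset.mem_filter.1 hx).2 h1
  · intro y hy hyx
    by_contra h2
    have h3 := (hp y).mem_suppIn y.2 x (right_ne_zero_of_smul h2)
    rw [Set.mem_ofPred_eq, domRep_of_mem x.2] at h3
    have h4 := hmax (Finset.mem_filter.2 ⟨hy, left_ne_zero_of_smul h2⟩)
    have h5 : {z | weightLE b z x}.ncard < {z | weightLE b z y}.ncard := by
      refine Set.ncard_lt_ncard ⟨fun z hz => weightLE_trans hz h3, fun hsub => ?_⟩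
        (finite_weightLE b _)
      exact hyx (Subtype.ext (weightLE_antisymm (hsub (weightLE_refl _)) h3))
    have := h4 (by simp only [neg_le_neg_iff, Nat.cast_le]; exact h5.le)
    simp only [neg_le_neg_iff, Nat.cast_le] at this
    omega
  · exact fun h => absurd (Finset.mem_filter.1 hx).1 h

/-! ### The Jacobi polynomials as eigenfunctions -/

/-- An invariant operator that is triangular, and whose adjoint is, acts on the Jacobi polynomials
by scalars. -/
theorem IsOrthogonalTop.map_tensor (hL : IsWeightFunctional b k L) {x : weightLattice P}
    (hx : x ∈ domWeights b I) {p : LaurentPoly P} (hp : IsOrthogonalTop b I L x p)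
    (y : TensorAlgebra ℂ (CplxSpace N))
    (hy : ∀ w ∈ parabolic b I, ∀ f,
      TensorAlgebra.lift ℂ (cherednikLaurent b k) y (weylLaurent P w f) =
        weylLaurent P w (TensorAlgebra.lift ℂ (cherednikLaurent b k) y f)) :
    ∃ c : ℂ, TensorAlgebra.lift ℂ (cherednikLaurent b k) y p = c • p := by
  set T := TensorAlgebra.lift ℂ (cherednikLaurent b k) y with hT
  obtain ⟨y', hy'⟩ := hL.exists_adjoint y
  set T' := TensorAlgebra.lift ℂ (cherednikLaurent b k) y' with hT'
  have hT'w : ∀ w ∈ parabolic b I, ∀ f, T' (weylLaurent P w f) = weylLaurent P w (T' f) := by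
    intro w hw f
    refine hL.eq_of_forall fun u => ?_
    rw [← hy', ← hL.weyl w⁻¹, map_mul (weylLaurent P _), ← starLaurent_weylLaurent, ← hy _ (inv_mem hw),
      ← weylLaurent_mul, inv_mul_cancel, weylLaurent_one, hy', ← hL.weyl w,
      map_mul (weylLaurent P _),
      ← starLaurent_weylLaurent, ← weylLaurent_mul, mul_inv_cancel, weylLaurent_one]
  -- The adjoint is triangular as well, and thus preserves the span of the lower orbit sums.
  have hT'low : ∀ f ∈ lowerSpan b I x, T' f ∈ lowerSpan b I x := by
    suffices h : lowerSpan b I x ≤ (lowerSpan b I x).comap T' from fun f hf => h hf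
    refine Submodule.span_le.2 ?_
    rintro _ ⟨z, ⟨hz, hzx, hne⟩, rfl⟩
    refine mem_lowerSpan.2 ⟨fun w hw => ?_, ?_⟩
    · rw [← hT'w w hw, orbitSum_mem_invLaurent hz w hw]
    · have h1 : orbitSum b I z ∈ suppIn {μ | weightLE b (domRep b I μ) z} := by
        classical
        intro μ hμ
        rw [coeff_orbitSum hz] at hμ
        have h : domRep b I μ = z := by
          by_contra h
          exact hμ (if_neg h)
        rw [Set.mem_ofPred_eq, h]
        exact weightLE_refl z
      have h2 : {μ | weightLE b (domRep b I μ) z} ⊆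
          {μ | weightLE b (domRep b I μ) x ∧ domRep b I μ ≠ x} := by
        refine fun μ hμ => ⟨weightLE_trans hμ hzx, ?_⟩
        rintro rfl
        exact hne (weightLE_antisymm hzx hμ)
      exact suppIn_mono h2 (stable_tensor (stableSet_domRep_le b I z) y' h1)
  have hTinv : T p ∈ invLaurent b I := fun w hw => by
    rw [← hy w hw, hp.mem_invLaurent hx w hw]
  have hTsupp : T p ∈ suppIn {μ | weightLE b (domRep b I μ) x} :=
    stable_tensor (stableSet_domRep_le b I x) y (hp.mem_suppIn hx)
  refine ⟨(T p).coeff x, sub_eq_zero.1 (hL.definite _ ?_)⟩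
  -- The remainder lies in the span of the lower orbit sums, and is orthogonal to it.
  have hlow : T p - (T p).coeff x • p ∈ lowerSpan b I x := by
    refine mem_lowerSpan.2 ⟨Submodule.sub_mem _ hTinv
      (Submodule.smul_mem _ _ (hp.mem_invLaurent hx)), fun μ hμ => ⟨?_, fun h => hμ ?_⟩⟩
    · exact Submodule.sub_mem _ hTsupp (Submodule.smul_mem _ _ (hp.mem_suppIn hx)) μ hμ
    · rw [AddMonoidAlgebra.coeff_sub, Finsupp.sub_apply, AddMonoidAlgebra.coeff_smul,
        Finsupp.smul_apply, hp.coeff hx h, ← coeff_domRep hTinv, h, smul_eq_mul, mul_one, sub_self]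
  rw [map_sub, sub_mul, map_sub, hy', hp.2 _ (hT'low _ hlow), starLaurent_smul, smul_mul_assoc,
    map_smul, hp.2 _ hlow, smul_zero, sub_zero]

/-- The eigenvalues are read off at a maximal weight of the orbit. -/
theorem IsOrthogonalTop.eigenvalue {x : weightLattice P}
    (hx : x ∈ domWeights b I) {p : LaurentPoly P} (hp : IsOrthogonalTop b I L x p) :
    ∃ μ, domRep b I μ = x ∧ ∀ (y : TensorAlgebra ℂ (CplxSpace N)) (c : ℂ),
      TensorAlgebra.lift ℂ (cherednikLaurent b k) y p = c • p →
        c = TensorAlgebra.lift ℂ (cplxFunctional P (spectralVec b k μ)) y := by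
  classical
  have hfin : {μ | domRep b I μ = x}.Finite := by
    refine (finite_orbit (b := b) (I := I) x).subset fun μ hμ => (mem_orbit_iff hx μ).2 hμ
  obtain ⟨μ, hμ, hmax⟩ := Set.exists_max_image _ (fun μ => {z | weightLE b z μ}.ncard) hfin
    ⟨x, domRep_of_mem hx⟩
  have hμ' : domRep b I μ = x := hμ
  have hmax' : ∀ ν, domRep b I ν = x → weightLE b μ ν → ν = μ := by
    intro ν hν hle
    by_contra hne
    refine (hmax ν hν).not_gt (Set.ncard_lt_ncard ⟨fun z hz => weightLE_trans hz hle,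
      fun hsub => hne ?_⟩ (finite_weightLE b _))
    exact weightLE_antisymm (hsub (weightLE_refl ν)) hle
  refine ⟨μ, hμ, fun y c hc => ?_⟩
  have h1 := congrArg (fun f : LaurentPoly P => f.coeff μ) hc
  simp only [AddMonoidAlgebra.coeff_smul, Finsupp.smul_apply, hp.coeff hx hμ', smul_eq_mul,
    mul_one] at h1
  have h2 : TensorAlgebra.lift ℂ (cherednikLaurent b k) y p =
      ∑ ν ∈ p.coeff.support, p.coeff ν • TensorAlgebra.lift ℂ (cherednikLaurent b k) y (expo P ν) := by
    conv_lhs => rw [eq_sum_coeff p, map_sum]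
    exact Finset.sum_congr rfl fun ν _ => map_smul _ _ _
  have h3 : ∀ ν, (TensorAlgebra.lift ℂ (cherednikLaurent b k) y (expo P ν)).coeff μ ≠ 0 →
      weightLE b μ ν ∧ weightLE b (domRep b I μ) (domRep b I ν) := by
    intro ν hν
    constructor
    · by_contra hnot
      have h4 := triangular_tensor (b := b) (k := k) y ν μ
      have h5 : ν ≠ μ := by
        rintro rfl
        exact hnot (weightLE_refl _)
      rw [AddMonoidAlgebra.coeff_sub, Finsupp.sub_apply, AddMonoidAlgebra.coeff_smul,
        Finsupp.smul_apply, coeff_expo, if_neg h5, smul_zero, sub_zero] at h4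
      exact hnot (h4 hν).1
    · exact stable_tensor (k := k) (stableSet_domRep_le b I (domRep b I ν)) y
        (expo_mem_suppIn (S := {κ | weightLE b (domRep b I κ) (domRep b I ν)})
          (weightLE_refl _)) μ hν
  -- By maximality of `μ`, only the exponential `e^μ` contributes to the coefficient at `μ`.
  rw [h2, AddMonoidAlgebra.coeff_sum, Finsupp.finsetSum_apply, Finset.sum_eq_single μ] at h1
  · rw [AddMonoidAlgebra.coeff_smul, Finsupp.smul_apply, hp.coeff hx hμ', one_smul] at h1
    rw [← h1]
    have h4 := triangular_tensor (b := b) (k := k) y μ μ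
    by_contra hne
    refine (h4 ?_).2 rfl
    rw [AddMonoidAlgebra.coeff_sub, Finsupp.sub_apply, AddMonoidAlgebra.coeff_smul,
      Finsupp.smul_apply, coeff_expo, if_pos rfl, smul_eq_mul, mul_one]
    exact sub_ne_zero.2 hne
  · intro ν hν hne
    by_contra h4
    rw [AddMonoidAlgebra.coeff_smul, Finsupp.smul_apply] at h4
    obtain ⟨h5, h6⟩ := h3 ν (right_ne_zero_of_smul h4)
    rw [hμ'] at h6
    have h7 := hp.mem_suppIn hx ν (Finsupp.mem_support_iff.1 hν)
    exact hne (hmax' ν (weightLE_antisymm h7 h6) h5)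
  · intro hnot
    rw [Finsupp.notMem_support_iff.1 hnot, zero_smul]
    rfl

/-- The Cherednik operators commute on `ℂ[P]`, as they are simultaneously diagonalized by the
nonsymmetric Jacobi polynomials. -/
theorem commute_cherednikLaurent (hL : IsWeightFunctional b k L) (ξ η : CplxSpace N) :
    Commute (cherednikLaurent b k ξ) (cherednikLaurent b k η) := by
  choose p hp using fun x : domWeights b ∅ => exists_isOrthogonalTop (I := ∅) hL (x : weightLattice P)
  have htriv : ∀ (y : TensorAlgebra ℂ (CplxSpace N)), ∀ w ∈ parabolic b ∅, ∀ f,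
      TensorAlgebra.lift ℂ (cherednikLaurent b k) y (weylLaurent P w f) =
        weylLaurent P w (TensorAlgebra.lift ℂ (cherednikLaurent b k) y f) := by
    intro y w hw f
    rw [parabolic_empty, Subgroup.mem_bot] at hw
    rw [hw, weylLaurent_one, weylLaurent_one]
  have hspan : Submodule.span ℂ (Set.range p) = ⊤ := by
    rw [IsOrthogonalTop.span_eq hp, invLaurent_empty]
  have heig : ∀ (ζ : CplxSpace N) x, ∃ c : ℂ, cherednikLaurent b k ζ (p x) = c • p x := by
    intro ζ x
    have := (hp x).map_tensor hL x.2 (TensorAlgebra.ι ℂ ζ) (htriv _)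
    rwa [TensorAlgebra.lift_ι_apply] at this
  refine LinearMap.ext_on_range hspan fun x => ?_
  obtain ⟨c, hc⟩ := heig ξ x
  obtain ⟨d, hd⟩ := heig η x
  rw [Module.End.mul_apply, Module.End.mul_apply, hc, hd, map_smul, map_smul, hc, hd, smul_comm]

end Jacobi

section SymEval

variable {ι M N : Type*} [AddCommGroup M] [Module ℝ M] [AddCommGroup N] [Module ℝ N]
  {P : RootPairing ι ℝ M N}

/-! ### The action of the Weyl group on `S(𝔥)` -/

/-- Evaluation of an element of `S(𝔥)` at a vector. -/
def symEval (P : RootPairing ι ℝ M N) (v : M) : SymmetricAlgebra ℂ (CplxSpace N) →ₐ[ℂ] ℂ :=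
  SymmetricAlgebra.lift (cplxFunctional P v)

theorem symEval_ι (v : M) (ξ : CplxSpace N) :
    symEval P v (SymmetricAlgebra.ι ℂ _ ξ) = cplxFunctional P v ξ :=
  SymmetricAlgebra.lift_ι_apply _ _

theorem symEval_algHom (v : M) (y : TensorAlgebra ℂ (CplxSpace N)) :
    symEval P v (SymmetricAlgebra.algHom ℂ _ y) =
      TensorAlgebra.lift ℂ (cplxFunctional P v) y := by
  have h : (symEval P v).comp (SymmetricAlgebra.algHom ℂ (CplxSpace N)) =
      TensorAlgebra.lift ℂ (cplxFunctional P v) := by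
    refine TensorAlgebra.hom_ext (LinearMap.ext fun ξ => ?_)
    rw [LinearMap.comp_apply, LinearMap.comp_apply]
    exact (symEval_ι v ξ).trans (TensorAlgebra.lift_ι_apply _ _).symm
  exact DFunLike.congr_fun h y

theorem cplxFunctional_weylCplx (w : P.weylGroup) (v : M) (ξ : CplxSpace N) :
    cplxFunctional P v (weylCplx P w ξ) = cplxFunctional P (w⁻¹ • v) ξ := by
  induction ξ using TensorProduct.induction_on with
  | zero => simp
  | add ξ η hξ hη => rw [map_add, map_add, map_add, hξ, hη]
  | tmul c η =>
    rw [weylCplx, LinearMap.baseChange_tmul, cplxFunctional_tmul, cplxFunctional_tmul]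
    congr 1
    congr 1
    have h := RootPairing.Hom.weight_coweight_transpose_apply P P η
      ((w⁻¹ : P.weylGroup) : P.Aut).toHom
    exact (LinearMap.congr_fun h v).symm

theorem weylSym_ι (w : P.weylGroup) (ξ : CplxSpace N) :
    weylSym P w (SymmetricAlgebra.ι ℂ _ ξ) = SymmetricAlgebra.ι ℂ _ (weylCplx P w ξ) :=
  SymmetricAlgebra.lift_ι_apply _ _

theorem symEval_weylSym (w : P.weylGroup) (v : M) (q : SymmetricAlgebra ℂ (CplxSpace N)) :
    symEval P v (weylSym P w q) = symEval P (w⁻¹ • v) q := by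
  have h : (symEval P v).comp (weylSym P w) = symEval P (w⁻¹ • v) := by
    refine SymmetricAlgebra.algHom_ext (LinearMap.ext fun ξ => ?_)
    change symEval P v (weylSym P w (SymmetricAlgebra.ι ℂ _ ξ)) =
      symEval P (w⁻¹ • v) (SymmetricAlgebra.ι ℂ _ ξ)
    rw [weylSym_ι, symEval_ι, symEval_ι, cplxFunctional_weylCplx]
  exact DFunLike.congr_fun h q

theorem weylCplx_mul (v w : P.weylGroup) (ξ : CplxSpace N) :
    weylCplx P (v * w) ξ = weylCplx P v (weylCplx P w ξ) := by
  rw [weylCplx, weylCplx, weylCplx, mul_inv_rev, ← LinearMap.comp_apply,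
    ← LinearMap.baseChange_comp]
  rfl

theorem weylSym_mul (v w : P.weylGroup) (q : SymmetricAlgebra ℂ (CplxSpace N)) :
    weylSym P (v * w) q = weylSym P v (weylSym P w q) := by
  have h : (weylSym P v).comp (weylSym P w) = weylSym P (v * w) := by
    refine SymmetricAlgebra.algHom_ext (LinearMap.ext fun ξ => ?_)
    change weylSym P v (weylSym P w (SymmetricAlgebra.ι ℂ _ ξ)) =
      weylSym P (v * w) (SymmetricAlgebra.ι ℂ _ ξ)
    rw [weylSym_ι, weylSym_ι, weylSym_ι, weylCplx_mul]
  exact (DFunLike.congr_fun h q).symm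

end SymEval

section Separation

variable {ι M N : Type*} [Fintype ι] [AddCommGroup M] [Module ℝ M] [AddCommGroup N] [Module ℝ N]
  {P : RootPairing ι ℝ M N} [P.IsRootSystem] [P.IsCrystallographic] {b : P.Base}
  {I : Set b.support} {k : ι → ℝ}

local notation "σ" => RootPairing.weylGroup.ofIdx P

/-! ### Separation of the eigenvalues -/

theorem apply_smul_idx (b : P.Base) (hk : ∀ i j, k (P.reflectionPerm i j) = k j) (w : P.weylGroup)
    (i : ι) : k (w • i) = k i := by
  obtain ⟨l, rfl⟩ := exists_wordProd b w
  induction l with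
  | nil => exact congrArg k (one_smul _ i)
  | cons j t ih => rw [wordProd_cons, mul_smul, ofIdx_smul_idx, hk, ih]

open scoped Classical in
theorem smul_rhoVec (hk : ∀ i j, k (P.reflectionPerm i j) = k j) (w : P.weylGroup) :
    w • rhoVec b k = (1 / 2 : ℝ) • ∑ i with b.IsPos i,
      (if b.IsPos (w⁻¹ • i) then k i • P.root i else -(k i • P.root i)) := by
  have h1 : w • rhoVec b k = (1 / 2 : ℝ) • ∑ i with b.IsPos i, k i • P.root (w • i) := by
    rw [rhoVec, smul_comm w (1 / 2 : ℝ), Finset.smul_sum]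
    congr 1
    refine Finset.sum_congr rfl fun i _ => ?_
    rw [smul_comm w (k i : ℝ), smul_root]
  rw [h1]
  congr 1
  have h2 : ∑ i with b.IsPos i, k i • P.root (w • i) =
      ∑ i, if b.IsPos (w⁻¹ • i) then k i • P.root i else 0 := by
    rw [Finset.sum_filter]
    refine Fintype.sum_equiv (MulAction.toPerm w) _ _ fun i => ?_
    simp only [MulAction.toPerm_apply, inv_smul_smul, apply_smul_idx b hk]
  rw [h2, sum_eq_sum_isPos b]
  refine Finset.sum_congr rfl fun i _ => ?_
  rw [smul_neg_idx, isPos_neg_iff b, root_neg, hk]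
  by_cases h : b.IsPos (w⁻¹ • i)
  · simp [h]
  · simp [h]

theorem rhoVec_sub_smul_mem_posCone (hk : ∀ i j, k (P.reflectionPerm i j) = k j)
    (hk0 : ∀ i, 0 ≤ k i) (w : P.weylGroup) : rhoVec b k - w • rhoVec b k ∈ posCone b := by
  classical
  rw [smul_rhoVec hk, rhoVec, ← smul_sub, ← Finset.sum_sub_distrib]
  refine smul_mem_posCone b (by norm_num) (AddSubmonoid.sum_mem _ fun i hi => ?_)
  have hi' := (Finset.mem_filter.1 hi).2
  have h1 : k i • P.root i ∈ posCone b :=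
    smul_mem_posCone b (hk0 i) (closure_le_posCone b (root_mem_closure b hi'))
  split_ifs with h
  · rw [sub_self]
    exact zero_mem _
  · rw [sub_neg_eq_add]
    exact add_mem h1 h1

/-- If `u` is the shortest element that maps a dominant weight `ν` to `-μ`, then `-(ν + ρ(k))` is
conjugate by `u` to the spectral vector of `μ`. -/
theorem exists_neg_spectralVec (hk : ∀ i j, k (P.reflectionPerm i j) = k j) (μ : weightLattice P) :
    ∃ u : P.weylGroup, ∃ ν ∈ dominant b, -μ = u • ν ∧
      -spectralVec b k μ = u • ((ν : M) + rhoVec b k) := by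
  classical
  obtain ⟨ν, hν, u, hu⟩ := exists_dominant_isShortest b (-μ)
  refine ⟨u, ν, hν, hu.1.symm, ?_⟩
  have h1 : u • (ν : M) = -(μ : M) := by
    rw [← coe_weyl_smul, hu.1]
    rfl
  rw [smul_add, h1, smul_rhoVec hk, spectralVec, rhoVec, neg_sub, sub_eq_add_neg, neg_add,
    add_comm ((1 / 2 : ℝ) • _), add_assoc]
  congr 1
  rw [← sub_eq_neg_add, Finset.smul_sum, ← Finset.sum_sub_distrib, Finset.smul_sum]
  refine Finset.sum_congr rfl fun i hi => ?_
  have h2 := hu.minAt.isPos_iff hν (Finset.mem_filter.1 hi).2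
  rw [hu.1, pairInt_neg, neg_nonneg] at h2
  by_cases h : 0 < pairInt i μ
  · rw [if_pos h, if_neg (fun h3 => absurd (h2.1 h3) (not_le.2 h))]
    module
  · rw [if_neg h, if_pos (h2.2 (not_lt.1 h))]
    module

/-- The spectral vectors of weights in distinct orbits are in distinct orbits. -/
theorem eq_smul_of_spectralVec (hk : ∀ i j, k (P.reflectionPerm i j) = k j)
    (hk0 : ∀ i, 0 ≤ k i) {μ μ' : weightLattice P} {w : P.weylGroup}
    (h : spectralVec b k μ = w • spectralVec b k μ') : μ = w • μ' := by
  obtain ⟨u, ν, hν, h1, h2⟩ := exists_neg_spectralVec (b := b) hk μ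
  obtain ⟨u', ν', hν', h1', h2'⟩ := exists_neg_spectralVec (b := b) hk μ'
  have hcone : ∀ ν ∈ dominant b, ∀ g : P.weylGroup,
      (ν : M) - g • (ν : M) ∈ posCone b := fun ν hν g => sub_smul_mem_posCone hν g
  have hcone2 : ∀ ν ∈ dominant b, ∀ g : P.weylGroup,
      ((ν : M) + rhoVec b k) - g • ((ν : M) + rhoVec b k) ∈ posCone b := by
    intro ν hν g
    rw [smul_add, add_sub_add_comm]
    exact add_mem (hcone ν hν g) (rhoVec_sub_smul_mem_posCone hk hk0 g)
  set g := u⁻¹ * w * u' with hg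
  have h3 : (ν : M) + rhoVec b k = g • ((ν' : M) + rhoVec b k) := by
    rw [hg, mul_smul, mul_smul, ← h2', smul_neg w (spectralVec b k μ' : M), ← h, h2, inv_smul_smul]
  have h4 : (ν' : M) + rhoVec b k = g⁻¹ • ((ν : M) + rhoVec b k) := by
    rw [h3, inv_smul_smul]
  -- Two dominant vectors in the same orbit are equal.
  have h5 : (ν : M) + rhoVec b k = (ν' : M) + rhoVec b k := by
    have h6 := hcone2 ν hν g⁻¹
    have h7 := hcone2 ν' hν' g
    rw [← h4] at h6
    rw [← h3] at h7
    refine sub_eq_zero.1 (eq_zero_of_mem_posCone b h6 ?_)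
    rwa [neg_sub]
  have h8 : ν = ν' := Subtype.ext (add_right_cancel h5)
  subst h8
  -- As `ν` and `ρ(k)` are dominant, a stabilizer of their sum fixes both.
  have h9 : (ν : M) - g • (ν : M) = 0 := by
    refine eq_zero_of_mem_posCone b (hcone ν hν g) ?_
    have h10 := rhoVec_sub_smul_mem_posCone (b := b) hk hk0 g
    have h11 : -((ν : M) - g • (ν : M)) = rhoVec b k - g • rhoVec b k := by
      rw [smul_add] at h3
      rw [neg_sub, sub_eq_sub_iff_add_eq_add, ← h3, add_comm]
    rwa [h11]
  have h12 : ν = g • ν := Subtype.ext (sub_eq_zero.1 h9)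
  have h13 : u • ν = w • (u' • ν) := by
    conv_lhs => rw [h12]
    rw [hg, ← mul_smul, ← mul_smul]
    congr 1
    group
  rw [← h1, ← h1', smul_neg] at h13
  exact neg_injective h13

/-- A finite group of symmetries: the orbits of `v` and `v'` under `W_I` are separated by an
element of `S(𝔥)^{W_I}`. -/
theorem exists_sym_separating {v v' : M} (h : ∀ w ∈ parabolic b I, v ≠ w • v') :
    ∃ q : SymmetricAlgebra ℂ (CplxSpace N), (∀ w ∈ parabolic b I, weylSym P w q = q) ∧
      symEval P v q = 0 ∧ symEval P v' q ≠ 0 := by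
  classical
  have := Fintype.ofFinite P.weylGroup
  have := Fintype.ofFinite (parabolic b I)
  -- The squared distance to `v`.
  let q0 : SymmetricAlgebra ℂ (CplxSpace N) := ∑ i : ι,
    (SymmetricAlgebra.ι ℂ _ ((1 : ℂ) ⊗ₜ P.coroot i) -
      algebraMap ℂ _ ((P.coroot' i v : ℝ) : ℂ)) ^ 2
  have hq0 : ∀ u, symEval P u q0 = ((∑ i, (P.coroot' i u - P.coroot' i v) ^ 2 : ℝ) : ℂ) := by
    intro u
    simp only [q0, map_sum, map_pow, map_sub, symEval_ι, cplxFunctional_tmul, one_mul,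
      AlgHom.commutes]
    push_cast
    rfl
  have hq0' : ∀ u, symEval P u q0 = 0 → u = v := by
    intro u hu
    rw [hq0, Complex.ofReal_eq_zero, Finset.sum_eq_zero_iff_of_nonneg fun i _ => sq_nonneg _] at hu
    have h1 : ∀ i, P.coroot' i u = P.coroot' i v := fun i =>
      sub_eq_zero.1 (pow_eq_zero_iff two_ne_zero |>.1 (hu i (Finset.mem_univ i)))
    have h2 : P.toLinearMap u = P.toLinearMap v := by
      refine LinearMap.ext_on_range (v := P.coroot) ?_ h1
      exact RootPairing.IsRootSystem.span_coroot_eq_top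
    exact LinearMap.IsPerfPair.bijective_left P.toLinearMap |>.injective h2
  refine ⟨∏ w : parabolic b I, weylSym P w q0, fun w hw => ?_, ?_, ?_⟩
  · rw [map_prod]
    refine Fintype.prod_equiv (Equiv.mulLeft (⟨w, hw⟩ : parabolic b I)) _ _ fun u => ?_
    rw [← weylSym_mul]
    rfl
  · rw [map_prod]
    refine Finset.prod_eq_zero (Finset.mem_univ 1) ?_
    rw [symEval_weylSym, OneMemClass.coe_one, inv_one, one_smul, hq0]
    simp
  · rw [map_prod, Finset.prod_ne_zero_iff]
    intro w _ h0
    rw [symEval_weylSym] at h0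
    exact h _ (inv_mem w.2) (hq0' _ h0).symm

/-- Distinct Jacobi polynomials are separated by the eigenvalues of the operators `q(D(k))` with
`q ∈ S(𝔥)^{W_I}`. -/
theorem exists_tensor_separating (hk : ∀ i j, k (P.reflectionPerm i j) = k j)
    (hk0 : ∀ i, 0 ≤ k i) {μ μ' : weightLattice P} (h : domRep b I μ ≠ domRep b I μ') :
    ∃ y : TensorAlgebra ℂ (CplxSpace N),
      (∀ w ∈ parabolic b I, weylSym P w (SymmetricAlgebra.algHom ℂ (CplxSpace N) y) =
        SymmetricAlgebra.algHom ℂ (CplxSpace N) y) ∧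
      TensorAlgebra.lift ℂ (cplxFunctional P (spectralVec b k μ)) y ≠
        TensorAlgebra.lift ℂ (cplxFunctional P (spectralVec b k μ')) y := by
  obtain ⟨q, hq, h1, h2⟩ := exists_sym_separating (P := P) (b := b) (I := I)
    (v := spectralVec b k μ) (v' := spectralVec b k μ') fun w hw h3 => h (by
      rw [eq_smul_of_spectralVec hk hk0 h3, domRep_smul hw])
  obtain ⟨y, rfl⟩ := SymmetricAlgebra.algHom_surjective ℂ (CplxSpace N) q
  rw [symEval_algHom] at h1 h2
  exact ⟨y, hq, by rw [h1]; exact h2.symm⟩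

end Separation

section Rational

variable {ι M N : Type*} [Finite ι] [AddCommGroup M] [Module ℝ M] [AddCommGroup N] [Module ℝ N]
  {P : RootPairing ι ℝ M N} [P.IsRootSystem] [P.IsCrystallographic] {b : P.Base}
  {I : Set b.support} {k : ι → ℝ}

local notation "σ" => RootPairing.weylGroup.ofIdx P

/-! ### The action of the Weyl group on rational functions -/

theorem weylRat_algebraMap (w : P.weylGroup) (f : LaurentPoly P) :
    weylRat P w (algebraMap _ (RatFun P) f) = algebraMap _ (RatFun P) (weylLaurent P w f) :=
  IsLocalization.algEquivOfAlgEquiv_eq _ f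

theorem ratFun_ext {S T : RatFun P →+* RatFun P}
    (h : ∀ f : LaurentPoly P, S (algebraMap _ _ f) = T (algebraMap _ _ f)) : S = T :=
  IsLocalization.ringHom_ext (nonZeroDivisors (LaurentPoly P)) (RingHom.ext h)

variable (P) in
/-- The action of the Weyl group on the field of fractions of `ℂ[P]`, as linear operators. -/
def weylEnd :
    P.weylGroup →* Module.End ℂ (RatFun P) where
  toFun w := (weylRat P w).toLinearMap
  map_one' := by
    have h : ((weylRat P 1 : RatFun P ≃ₐ[ℂ] RatFun P) : RatFun P →+* RatFun P) = RingHom.id _ :=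
      ratFun_ext fun f => by
        change weylRat P 1 (algebraMap _ _ f) = algebraMap _ _ f
        rw [weylRat_algebraMap, weylLaurent_one]
    exact LinearMap.ext fun f => RingHom.congr_fun h f
  map_mul' v w := by
    have h : ((weylRat P (v * w) : RatFun P ≃ₐ[ℂ] RatFun P) : RatFun P →+* RatFun P) =
        ((weylRat P v : RatFun P ≃ₐ[ℂ] RatFun P) : RatFun P →+* RatFun P).comp
        ((weylRat P w : RatFun P ≃ₐ[ℂ] RatFun P) : RatFun P →+* RatFun P) :=
      ratFun_ext fun f => by
        change weylRat P (v * w) (algebraMap _ _ f) = weylRat P v (weylRat P w (algebraMap _ _ f))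
        rw [weylRat_algebraMap, weylRat_algebraMap, weylRat_algebraMap, weylLaurent_mul]
    exact LinearMap.ext fun f => RingHom.congr_fun h f

theorem weylEnd_apply (w : P.weylGroup) (f : RatFun P) : weylEnd P w f = weylRat P w f :=
  rfl

theorem weylEnd_algebraMap (w : P.weylGroup) (f : LaurentPoly P) :
    weylEnd P w (algebraMap _ _ f) = algebraMap _ _ (weylLaurent P w f) :=
  weylRat_algebraMap w f

theorem weylEnd_mul_apply (w : P.weylGroup) (f g : RatFun P) :
    weylEnd P w (f * g) = weylEnd P w f * weylEnd P w g :=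
  map_mul (weylRat P w) f g

theorem weylEnd_inv_smul (w : P.weylGroup) (f : RatFun P) :
    weylEnd P w (weylEnd P w⁻¹ f) = f := by
  rw [← Module.End.mul_apply, ← map_mul, mul_inv_cancel, map_one, Module.End.one_apply]

/-- Conjugation of operators by an element of the Weyl group. -/
def conjOp (w : P.weylGroup) : Module.End ℂ (RatFun P) →ₐ[ℂ] Module.End ℂ (RatFun P) :=
  AlgHom.ofLinearMap (LinearMap.mulLeft ℂ (weylEnd P w) ∘ₗ LinearMap.mulRight ℂ (weylEnd P w⁻¹))
    (by simp [← map_mul])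
    (fun S T => by
      simp only [LinearMap.comp_apply, LinearMap.mulLeft_apply, LinearMap.mulRight_apply]
      have h : weylEnd P w⁻¹ * weylEnd P w = 1 := by rw [← map_mul, inv_mul_cancel, map_one]
      calc weylEnd P w * (S * T * weylEnd P w⁻¹)
          = weylEnd P w * (S * 1 * T * weylEnd P w⁻¹) := by rw [mul_one]
        _ = _ := by rw [← h]; simp only [mul_assoc])

theorem conjOp_apply (w : P.weylGroup) (T : Module.End ℂ (RatFun P)) :
    conjOp w T = weylEnd P w * T * weylEnd P w⁻¹ :=
  (mul_assoc _ _ _).symm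

theorem conjOp_mul_weylEnd (w : P.weylGroup) (T : Module.End ℂ (RatFun P)) :
    conjOp w T * weylEnd P w = weylEnd P w * T := by
  rw [conjOp_apply, mul_assoc, ← map_mul, inv_mul_cancel, map_one, mul_one]

theorem conjOp_conjOp (v w : P.weylGroup) (T : Module.End ℂ (RatFun P)) :
    conjOp v (conjOp w T) = conjOp (v * w) T := by
  simp only [conjOp_apply, map_mul (weylEnd P), mul_inv_rev, mul_assoc]

theorem conjOp_weylEnd (w v : P.weylGroup) :
    conjOp w (weylEnd P v) = weylEnd P (w * v * w⁻¹) := by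
  rw [conjOp_apply, map_mul, map_mul]

theorem conjOp_lmul (w : P.weylGroup) (f : RatFun P) :
    conjOp w (Algebra.lmul ℂ _ f) = Algebra.lmul ℂ _ (weylEnd P w f) := by
  refine LinearMap.ext fun g => ?_
  rw [conjOp_apply, Module.End.mul_apply, Module.End.mul_apply]
  change weylEnd P w (f * weylEnd P w⁻¹ g) = weylEnd P w f * g
  rw [weylEnd_mul_apply, weylEnd_inv_smul]

theorem conjOp_eq_iff_commute (w : P.weylGroup) (T : Module.End ℂ (RatFun P)) :
    conjOp w T = T ↔ Commute T (weylEnd P w) := by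
  constructor
  · intro h
    have := conjOp_mul_weylEnd w T
    rwa [h] at this
  · intro h
    rw [conjOp_apply, ← h.eq, mul_assoc, ← map_mul, mul_inv_cancel, map_one, mul_one]

theorem algebraMap_injective : Function.Injective (algebraMap (LaurentPoly P) (RatFun P)) :=
  IsFractionRing.injective _ _

/-! ### The order of a differential operator -/

section Order

variable {K : Type*} [Field K] [Algebra ℂ K]

/-- The operator `T` is a differential operator of order less than `n` in the sense of
Grothendieck: its `n`-fold commutators with functions vanish. -/
def OrderLT : ℕ → Module.End ℂ K → Prop
  | 0, T => T = 0
  | n + 1, T => ∀ f : K, OrderLT n (T * Algebra.lmul ℂ K f - Algebra.lmul ℂ K f * T)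

theorem orderLT_zero (n : ℕ) : OrderLT n (0 : Module.End ℂ K) := by
  induction n with
  | zero => rfl
  | succ n ih =>
    intro f
    rw [zero_mul, mul_zero, sub_zero]
    exact ih

theorem OrderLT.succ {n : ℕ} {T : Module.End ℂ K} (h : OrderLT n T) : OrderLT (n + 1) T := by
  induction n generalizing T with
  | zero =>
    rw [show T = 0 from h]
    exact orderLT_zero 1
  | succ n ih => exact fun f => ih (h f)

theorem OrderLT.mono {n m : ℕ} {T : Module.End ℂ K} (h : OrderLT n T) (hnm : n ≤ m) :
    OrderLT m T := by
  induction hnm with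
  | refl => exact h
  | step _ ih => exact ih.succ

theorem OrderLT.add {n : ℕ} {S T : Module.End ℂ K} (hS : OrderLT n S) (hT : OrderLT n T) :
    OrderLT n (S + T) := by
  induction n generalizing S T with
  | zero =>
    rw [show S = 0 from hS, show T = 0 from hT, add_zero]
    rfl
  | succ n ih =>
    intro f
    rw [add_mul, mul_add, add_sub_add_comm]
    exact ih (hS f) (hT f)

theorem OrderLT.lmul_mul {n : ℕ} {T : Module.End ℂ K} (g : K) (hT : OrderLT n T) :
    OrderLT n (Algebra.lmul ℂ K g * T) := by
  induction n generalizing T with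
  | zero =>
    rw [show T = 0 from hT, mul_zero]
    rfl
  | succ n ih =>
    intro f
    have h : Algebra.lmul ℂ K g * T * Algebra.lmul ℂ K f -
        Algebra.lmul ℂ K f * (Algebra.lmul ℂ K g * T) =
        Algebra.lmul ℂ K g * (T * Algebra.lmul ℂ K f - Algebra.lmul ℂ K f * T) := by
      rw [mul_sub, ← mul_assoc, ← mul_assoc, ← mul_assoc, ← map_mul, ← map_mul, mul_comm f g]
    rw [h]
    exact ih (hT f)

/-- Leibniz rule for commutators with functions. The orders are strict bounds, so that the sharp
bound `n + m - 1` is weakened to avoid the subtraction. -/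
theorem OrderLT.mul {n m : ℕ} {S T : Module.End ℂ K} (hS : OrderLT n S) (hT : OrderLT m T) :
    OrderLT (n + m) (S * T) := by
  induction hs : n + m generalizing n m S T with
  | zero =>
    obtain rfl : n = 0 := by omega
    rw [show S = 0 from hS, zero_mul]
    rfl
  | succ l ih =>
    intro f
    have h : S * T * Algebra.lmul ℂ K f - Algebra.lmul ℂ K f * (S * T) =
        S * (T * Algebra.lmul ℂ K f - Algebra.lmul ℂ K f * T) +
        (S * Algebra.lmul ℂ K f - Algebra.lmul ℂ K f * S) * T := by
      rw [mul_sub, sub_mul]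
      simp only [mul_assoc]
      rw [sub_add_sub_cancel]
    rw [h]
    refine OrderLT.add ?_ ?_
    · cases m with
      | zero =>
        rw [show T = 0 from hT, zero_mul, mul_zero, sub_zero, mul_zero]
        exact orderLT_zero l
      | succ m => exact ih hS (hT f) (by omega)
    · cases n with
      | zero =>
        rw [show S = 0 from hS, zero_mul, mul_zero, sub_zero, zero_mul]
        exact orderLT_zero l
      | succ n => exact ih (hS f) hT (by omega)

theorem orderLT_lmul (g : K) : OrderLT 1 (Algebra.lmul ℂ K g) := by
  intro f
  rw [← map_mul, ← map_mul, mul_comm f g, sub_self]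
  rfl

theorem orderLT_derivation (D : Derivation ℂ K K) : OrderLT 2 (D : K →ₗ[ℂ] K) := by
  intro f
  have h : (D : K →ₗ[ℂ] K) * Algebra.lmul ℂ K f - Algebra.lmul ℂ K f * (D : K →ₗ[ℂ] K) =
      Algebra.lmul ℂ K (D f) := by
    refine LinearMap.ext fun g => ?_
    change D (f * g) - f * D g = D f * g
    rw [D.leibniz, smul_eq_mul, smul_eq_mul]
    ring
  rw [h]
  exact orderLT_lmul _

end Order

theorem exists_orderLT {T : Module.End ℂ (RatFun P)} (hT : T ∈ diffOps b) :
    ∃ n, OrderLT n T := by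
  induction hT using Algebra.adjoin_induction with
  | mem T hT =>
    rcases hT with ⟨f, -, rfl⟩ | ⟨ξ, rfl⟩
    · exact ⟨1, orderLT_lmul f⟩
    · exact ⟨2, orderLT_derivation _⟩
  | algebraMap c =>
    refine ⟨1, ?_⟩
    have h : algebraMap ℂ (Module.End ℂ (RatFun P)) c =
        Algebra.lmul ℂ (RatFun P) (algebraMap ℂ _ c) := (AlgHom.commutes _ c).symm
    rw [h]
    exact orderLT_lmul _
  | add S T _ _ hS hT =>
    obtain ⟨n, hn⟩ := hS
    obtain ⟨m, hm⟩ := hT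
    exact ⟨max n m, (hn.mono (le_max_left _ _)).add (hm.mono (le_max_right _ _))⟩
  | mul S T _ _ hS hT =>
    obtain ⟨n, hn⟩ := hS
    obtain ⟨m, hm⟩ := hT
    exact ⟨n + m, hn.mul hm⟩

theorem OrderLT.conjOp {n : ℕ} {T : Module.End ℂ (RatFun P)} (hT : OrderLT n T)
    (w : P.weylGroup) : OrderLT n (conjOp w T) := by
  induction n generalizing T with
  | zero =>
    rw [show T = 0 from hT, map_zero]
    rfl
  | succ n ih =>
    intro f
    have h1 : Algebra.lmul ℂ _ f = JacobiPoly.conjOp w (Algebra.lmul ℂ _ (weylEnd P w⁻¹ f)) := by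
      rw [conjOp_lmul, weylEnd_inv_smul]
    rw [h1, ← map_mul, ← map_mul, ← map_sub]
    exact ih (hT _)

/-- An operator that commutes with the Laurent polynomials is a multiplication. -/
theorem eq_lmul_of_forall {T : Module.End ℂ (RatFun P)}
    (hT : ∀ f : LaurentPoly P, T * Algebra.lmul ℂ _ (algebraMap _ _ f) =
      Algebra.lmul ℂ _ (algebraMap _ _ f) * T) : T = Algebra.lmul ℂ _ (T 1) := by
  have h1 : ∀ (f : LaurentPoly P) (g : RatFun P),
      T (algebraMap _ _ f * g) = algebraMap _ _ f * T g := fun f g =>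
    LinearMap.congr_fun (hT f) g
  refine LinearMap.ext fun g => ?_
  obtain ⟨a, s, hs, rfl⟩ := IsFractionRing.div_surjective (A := LaurentPoly P) g
  have hs' : algebraMap (LaurentPoly P) (RatFun P) s ≠ 0 := by
    simpa using nonZeroDivisors.ne_zero hs
  change _ = T 1 * _
  apply mul_left_cancel₀ hs'
  rw [← h1, mul_div_cancel₀ _ hs', ← mul_one (algebraMap _ _ a), h1, mul_one]
  field_simp

/-- A differential operator is determined by its action on Laurent polynomials. -/
theorem OrderLT.eq_zero {n : ℕ} {T : Module.End ℂ (RatFun P)} (hT : OrderLT n T)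
    (h : ∀ f : LaurentPoly P, T (algebraMap _ _ f) = 0) : T = 0 := by
  induction n generalizing T with
  | zero => exact hT
  | succ n ih =>
    rw [eq_lmul_of_forall (T := T) fun f => sub_eq_zero.1 (ih (hT _) fun g => ?_),
      ← map_one (algebraMap (LaurentPoly P) (RatFun P)), h, map_zero]
    change T (algebraMap _ _ f * algebraMap _ _ g) - algebraMap _ _ f * T (algebraMap _ _ g) = 0
    rw [← map_mul, h, h, mul_zero, sub_zero]

instance : Fintype P.weylGroup := Fintype.ofFinite _

theorem exists_weylLaurent_ne {v w : P.weylGroup} (h : v ≠ w) :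
    ∃ f : LaurentPoly P, weylLaurent P v f ≠ weylLaurent P w f := by
  by_contra! hall
  refine h (weyl_ext fun x => ?_)
  have hx : x ∈ Submodule.span ℝ (Set.range P.root) := by
    rw [RootPairing.IsRootSystem.span_root_eq_top]
    trivial
  induction hx using Submodule.span_induction with
  | mem x hx =>
    obtain ⟨i, rfl⟩ := hx
    have h1 := hall (expo P (rootWeight P i))
    rw [weylLaurent_expo, weylLaurent_expo] at h1
    exact congrArg Subtype.val (expo_injective h1)
  | zero => rw [smul_zero, smul_zero]
  | add x y _ _ hx hy => rw [smul_add, smul_add, hx, hy]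
  | smul a x _ hx => rw [smul_comm v (a : ℝ), smul_comm w (a : ℝ), hx]

/-- The elements of the Weyl group are linearly independent over the differential operators, even
as operators on Laurent polynomials. Commutators with functions reduce this to the independence of
distinct homomorphisms into a field. -/
theorem eq_zero_of_sum_mul_weylEnd (n : P.weylGroup → ℕ)
    (D : P.weylGroup → Module.End ℂ (RatFun P)) (hD : ∀ w, OrderLT (n w) (D w))
    (h : ∀ f : LaurentPoly P, ∑ w, (D w * weylEnd P w) (algebraMap _ _ f) = 0) (w : P.weylGroup) :
    D w = 0 := by
  classical
  induction hs : ∑ w, n w using Nat.strong_induction_on generalizing n D w with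
  | _ s ih =>
    -- All coefficients are multiplications.
    have h1 : ∀ v, D v = Algebra.lmul ℂ _ (D v 1) := by
      intro v
      rcases hn : n v with _ | m
      · have h2 := hD v
        rw [hn] at h2
        rw [show D v = 0 from h2, LinearMap.zero_apply, map_zero]
      · refine eq_lmul_of_forall fun g => ?_
        -- The commutator with `f` where `v f = g`.
        set f := weylLaurent P v⁻¹ g with hf
        have hvf : weylLaurent P v f = g := by
          rw [hf, ← weylLaurent_mul, mul_inv_cancel, weylLaurent_one]
        set a : P.weylGroup → Module.End ℂ (RatFun P) := fun w =>
          Algebra.lmul ℂ _ (algebraMap _ _ (weylLaurent P w f)) with ha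
        have h3 : ∀ w, OrderLT (Function.update n v m w) (D w * a w - a v * D w) := by
          intro w
          by_cases hw : w = v
          · subst hw
            have h2 := hD w
            rw [hn] at h2
            rw [Function.update_self]
            exact h2 _
          · rw [Function.update_of_ne hw]
            have h4 : D w * a w - a v * D w =
                (D w * a w - a w * D w) + Algebra.lmul ℂ _ (algebraMap _ _
                  (weylLaurent P w f) - algebraMap _ _ (weylLaurent P v f)) * D w := by
              rw [map_sub, sub_mul, sub_add_sub_cancel]
            rw [h4]
            refine OrderLT.add ?_ ((hD w).lmul_mul _)
            rcases hnw : n w with _ | l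
            · have h2 := hD w
              rw [hnw] at h2
              rw [show D w = 0 from h2, zero_mul, mul_zero, sub_zero]
              rfl
            · have h2 := hD w
              rw [hnw] at h2
              exact (h2 _).succ
        have h5 := ih (∑ w, Function.update n v m w) ?_ (Function.update n v m)
          (fun w => D w * a w - a v * D w) h3 ?_ v rfl
        · simp only [ha, hvf] at h5
          exact sub_eq_zero.1 h5
        · rw [← hs]
          refine Finset.sum_lt_sum (fun w _ => ?_) ⟨v, Finset.mem_univ v, ?_⟩
          · by_cases hw : w = v
            · subst hw
              rw [Function.update_self, hn]
              exact Nat.le_succ m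
            · rw [Function.update_of_ne hw]
          · rw [Function.update_self, hn]
            exact Nat.lt_succ_self m
        · intro u
          have h6 : ∀ w, ((D w * a w - a v * D w) * weylEnd P w) (algebraMap _ _ u) =
              (D w * weylEnd P w) (algebraMap _ _ (f * u)) - algebraMap _ _ (weylLaurent P v f) *
                (D w * weylEnd P w) (algebraMap _ _ u) := by
            intro w
            rw [sub_mul, LinearMap.sub_apply]
            simp only [Module.End.mul_apply, weylEnd_algebraMap, map_mul (weylLaurent P w)]
            rw [map_mul (algebraMap _ _)]
            rfl
          simp only [h6]
          rw [Finset.sum_sub_distrib, h, ← Finset.mul_sum, h, mul_zero, sub_zero]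
    -- Independence of the homomorphisms `f ↦ w f`.
    have h7 := linearIndependent_monoidHom (LaurentPoly P) (RatFun P)
    let φ : P.weylGroup → (LaurentPoly P →* RatFun P) := fun w =>
      ((algebraMap (LaurentPoly P) (RatFun P)) : LaurentPoly P →* RatFun P).comp
        ((weylLaurent P w : LaurentPoly P ≃ₐ[ℂ] LaurentPoly P) : LaurentPoly P →* LaurentPoly P)
    have hφ : Function.Injective φ := by
      intro v w hvw
      by_contra hne
      obtain ⟨f, hf⟩ := exists_weylLaurent_ne hne
      exact hf (algebraMap_injective (DFunLike.congr_fun hvw f))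
    have h8 := Fintype.linearIndependent_iff.1 (h7.comp φ hφ) (fun w => D w 1) (by
      funext f
      have h9 := h f
      rw [Finset.sum_apply]
      refine Eq.trans (Finset.sum_congr rfl fun w _ => ?_) h9
      rw [Module.End.mul_apply, weylEnd_algebraMap, h1 w]
      simp [φ]) w
    rw [h1 w, h8, map_zero]

end Rational

section ReflOps

variable {ι M N : Type*} [Finite ι] [AddCommGroup M] [Module ℝ M] [AddCommGroup N] [Module ℝ N]
  {P : RootPairing ι ℝ M N} [P.IsRootSystem] [P.IsCrystallographic] {b : P.Base}
  {I : Set b.support}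

local notation "σ" => RootPairing.weylGroup.ofIdx P

/-! ### Differential-reflection operators -/

theorem invOneSub_eq (i : ι) : invOneSub P i = (algebraMap _ (RatFun P) (oneSub P i))⁻¹ := by
  rw [invOneSub, oneSub, map_sub, map_one]

theorem algebraMap_oneSub_ne_zero (i : ι) : algebraMap _ (RatFun P) (oneSub P i) ≠ 0 :=
  (map_ne_zero_iff _ algebraMap_injective).2 (oneSub_ne_zero i)

theorem weylLaurent_oneSub_smul (w : P.weylGroup) (i : ι) :
    weylLaurent P w (oneSub P i) = oneSub P (w • i) := by
  rw [oneSub, oneSub, map_sub, map_one, weylLaurent_expo, smul_neg, smul_rootWeight]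

theorem weylEnd_invOneSub (w : P.weylGroup) (i : ι) :
    weylEnd P w (invOneSub P i) = invOneSub P (w • i) := by
  rw [invOneSub_eq, invOneSub_eq, weylEnd_apply, map_inv₀, weylRat_algebraMap,
    weylLaurent_oneSub_smul]

theorem invOneSub_neg (i : ι) : invOneSub P (P.reflectionPerm i i) = 1 - invOneSub P i := by
  have h1 := algebraMap_oneSub_ne_zero (P := P) i
  have h2 := algebraMap_oneSub_ne_zero (P := P) (P.reflectionPerm i i)
  rw [invOneSub_eq, invOneSub_eq, eq_sub_iff_add_eq, inv_add_inv h2 h1, div_eq_one_iff_eq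
    (mul_ne_zero h2 h1), ← map_add, ← map_mul]
  congr 1
  rw [oneSub, oneSub, rootWeight_neg, neg_neg]
  linear_combination -expo_mul_expo_neg (rootWeight P i)

theorem invOneSub_mem_coeffAlg (i : ι) : invOneSub P i ∈ coeffAlg b := by
  by_cases hi : b.IsPos i
  · exact Algebra.subset_adjoin ⟨i, hi, rfl⟩
  · have h1 : invOneSub P (P.reflectionPerm i i) ∈ coeffAlg b :=
      Algebra.subset_adjoin ⟨_, (isPos_neg_iff b).2 hi, rfl⟩
    rw [invOneSub_neg] at h1
    have h2 := sub_mem (one_mem (coeffAlg b)) h1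
    rwa [sub_sub_cancel] at h2

theorem weylEnd_mem_coeffAlg (w : P.weylGroup) {f : RatFun P} (hf : f ∈ coeffAlg b) :
    weylEnd P w f ∈ coeffAlg b := by
  suffices h : (coeffAlg b).map (weylRat P w : RatFun P →ₐ[ℂ] RatFun P) ≤ coeffAlg b from
    h ⟨f, hf, rfl⟩
  rw [coeffAlg, AlgHom.map_adjoin]
  refine Algebra.adjoin_le ?_
  rintro _ ⟨_, ⟨i, -, rfl⟩, rfl⟩
  exact (weylEnd_invOneSub w i).symm ▸ invOneSub_mem_coeffAlg (w • i)

theorem derivRat_algebraMap (ξ : CplxSpace N) (f : LaurentPoly P) :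
    derivRat P ξ (algebraMap _ _ f) = algebraMap _ _ (derivLin P ξ f) :=
  fracDerivation_algebraMap (derivLaurent P ξ) f

theorem weylLaurent_derivLin (w : P.weylGroup) (ξ : CplxSpace N) (f : LaurentPoly P) :
    weylLaurent P w (derivLin P ξ f) = derivLin P (weylCplx P w ξ) (weylLaurent P w f) := by
  induction f using laurent_induction with
  | smul c μ =>
    rw [map_smul, map_smul (weylLaurent P w), map_smul (weylLaurent P w), map_smul, derivLin_expo,
      map_smul (weylLaurent P w), weylLaurent_expo, derivLin_expo, cplxFunctional_weylCplx,
      coe_weyl_smul, inv_smul_smul]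
  | add f g hf hg => rw [map_add, map_add, map_add, map_add, hf, hg]

theorem conjOp_derivRat (w : P.weylGroup) (ξ : CplxSpace N) :
    conjOp w (derivRat P ξ) = derivRat P (weylCplx P w ξ) := by
  have h1 : OrderLT 2 (conjOp w (derivRat P ξ) + derivRat P (-weylCplx P w ξ)) :=
    ((orderLT_derivation _).conjOp w).add (orderLT_derivation _)
  have h2 := h1.eq_zero fun f => by
    rw [LinearMap.add_apply, conjOp_apply, Module.End.mul_apply, Module.End.mul_apply,
      weylEnd_algebraMap, derivRat_algebraMap, weylEnd_algebraMap, weylLaurent_derivLin,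
      ← weylLaurent_mul, mul_inv_cancel, weylLaurent_one, map_neg, LinearMap.neg_apply,
      derivRat_algebraMap, add_neg_cancel]
  rw [map_neg] at h2
  exact eq_of_sub_eq_zero ((sub_eq_add_neg _ _).trans h2)

theorem lmul_mem_diffOps {f : RatFun P} (hf : f ∈ coeffAlg b) :
    Algebra.lmul ℂ (RatFun P) f ∈ diffOps b :=
  Algebra.subset_adjoin (Or.inl ⟨f, hf, rfl⟩)

theorem derivRat_mem_diffOps (ξ : CplxSpace N) : derivRat P ξ ∈ diffOps b :=
  Algebra.subset_adjoin (Or.inr ⟨ξ, rfl⟩)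

theorem conjOp_mem_diffOps (w : P.weylGroup) {T : Module.End ℂ (RatFun P)} (hT : T ∈ diffOps b) :
    conjOp w T ∈ diffOps b := by
  suffices h : (diffOps b).map (conjOp w) ≤ diffOps b from h ⟨T, hT, rfl⟩
  rw [diffOps, AlgHom.map_adjoin]
  refine Algebra.adjoin_le ?_
  rintro _ ⟨_, ⟨f, hf, rfl⟩ | ⟨ξ, rfl⟩, rfl⟩
  · change conjOp w _ ∈ diffOps b
    rw [conjOp_lmul]
    exact lmul_mem_diffOps (weylEnd_mem_coeffAlg w hf)
  · change conjOp w _ ∈ diffOps b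
    rw [conjOp_derivRat]
    exact derivRat_mem_diffOps _

/-- The product of differential-reflection operators. -/
theorem sum_mul_sum_weylEnd (D E : P.weylGroup → Module.End ℂ (RatFun P)) :
    (∑ w, D w * weylEnd P w) * ∑ v, E v * weylEnd P v =
      ∑ u, (∑ w, D w * conjOp w (E (w⁻¹ * u))) * weylEnd P u := by
  have h1 : ∀ w v, D w * weylEnd P w * (E v * weylEnd P v) =
      D w * conjOp w (E v) * weylEnd P (w * v) := by
    intro w v
    rw [map_mul, ← mul_assoc (D w * conjOp w (E v)), mul_assoc (D w) (conjOp w _),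
      conjOp_mul_weylEnd]
    simp only [mul_assoc]
  rw [Finset.sum_mul_sum]
  simp only [h1, Finset.sum_mul]
  rw [Finset.sum_comm (s := Finset.univ) (t := Finset.univ)
    (f := fun u w => D w * conjOp w (E (w⁻¹ * u)) * weylEnd P u)]
  refine Finset.sum_congr rfl fun w _ => ?_
  refine Fintype.sum_equiv (Equiv.mulLeft w) _ _ fun v => ?_
  rw [Equiv.coe_mulLeft, inv_mul_cancel_left]

/-- The operators `∑_w D_w w` with scalar differential operators `D_w`. -/
def reflOps (b : P.Base) : Subalgebra ℂ (Module.End ℂ (RatFun P)) where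
  carrier := {T | ∃ D : P.weylGroup → Module.End ℂ (RatFun P), (∀ w, D w ∈ diffOps b) ∧
    T = ∑ w, D w * weylEnd P w}
  mul_mem' := by
    rintro _ _ ⟨D, hD, rfl⟩ ⟨E, hE, rfl⟩
    refine ⟨_, fun u => ?_, sum_mul_sum_weylEnd D E⟩
    exact sum_mem fun w _ => mul_mem (hD w) (conjOp_mem_diffOps w (hE _))
  add_mem' := by
    rintro _ _ ⟨D, hD, rfl⟩ ⟨E, hE, rfl⟩
    refine ⟨D + E, fun u => add_mem (hD u) (hE u), ?_⟩
    simp only [Pi.add_apply, add_mul, Finset.sum_add_distrib]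
  algebraMap_mem' c := by
    classical
    refine ⟨Pi.single 1 (algebraMap _ _ c), fun w => ?_, ?_⟩
    · by_cases h : w = 1
      · rw [h, Pi.single_eq_same]
        exact Subalgebra.algebraMap_mem _ c
      · rw [Pi.single_eq_of_ne h]
        exact zero_mem _
    · rw [Finset.sum_eq_single 1 (fun w _ h => by rw [Pi.single_eq_of_ne h, zero_mul])
        (fun h => absurd (Finset.mem_univ _) h), Pi.single_eq_same, map_one, mul_one]

theorem mul_weylEnd_mem_reflOps {D : Module.End ℂ (RatFun P)} (hD : D ∈ diffOps b)
    (w : P.weylGroup) : D * weylEnd P w ∈ reflOps b := by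
  classical
  refine ⟨Pi.single w D, fun v => ?_, ?_⟩
  · by_cases h : v = w
    · rw [h, Pi.single_eq_same]
      exact hD
    · rw [Pi.single_eq_of_ne h]
      exact zero_mem _
  · rw [Finset.sum_eq_single w (fun v _ h => by rw [Pi.single_eq_of_ne h, zero_mul])
      (fun h => absurd (Finset.mem_univ _) h), Pi.single_eq_same]

theorem diffOps_le_reflOps : diffOps b ≤ reflOps b := fun D hD => by
  have := mul_weylEnd_mem_reflOps hD 1
  rwa [map_one, mul_one] at this

theorem weylEnd_mem_reflOps (w : P.weylGroup) : weylEnd P w ∈ reflOps b := by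
  have := mul_weylEnd_mem_reflOps (one_mem (diffOps b)) w
  rwa [one_mul] at this

theorem conjOp_mem_reflOps (w : P.weylGroup) {T : Module.End ℂ (RatFun P)} (hT : T ∈ reflOps b) :
    conjOp w T ∈ reflOps b := by
  rw [conjOp_apply]
  exact mul_mem (mul_mem (weylEnd_mem_reflOps w) hT) (weylEnd_mem_reflOps _)

theorem coeff_eq_zero_of_algebraMap {D : P.weylGroup → Module.End ℂ (RatFun P)}
    (hD : ∀ w, D w ∈ diffOps b)
    (h : ∀ f : LaurentPoly P, (∑ w, D w * weylEnd P w) (algebraMap _ _ f) = 0) (w : P.weylGroup) :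
    D w = 0 := by
  choose n hn using fun w => exists_orderLT (hD w)
  refine eq_zero_of_sum_mul_weylEnd n D hn (fun f => ?_) w
  rw [← LinearMap.sum_apply]
  exact h f

theorem eq_of_forall_algebraMap {S T : Module.End ℂ (RatFun P)} (hS : S ∈ reflOps b)
    (hT : T ∈ reflOps b)
    (h : ∀ f : LaurentPoly P, S (algebraMap _ _ f) = T (algebraMap _ _ f)) : S = T := by
  obtain ⟨D, hD, hDeq⟩ := sub_mem hS hT
  rw [← sub_eq_zero, hDeq]
  refine Finset.sum_eq_zero fun w _ => ?_
  rw [coeff_eq_zero_of_algebraMap hD (fun f => ?_) w, zero_mul]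
  rw [← hDeq, LinearMap.sub_apply, h, sub_self]

/-- The coefficients of a differential-reflection operator are unique. -/
theorem coeff_unique {D E : P.weylGroup → Module.End ℂ (RatFun P)}
    (hD : ∀ w, D w ∈ diffOps b) (hE : ∀ w, E w ∈ diffOps b)
    (h : ∑ w, D w * weylEnd P w = ∑ w, E w * weylEnd P w) (w : P.weylGroup) : D w = E w := by
  refine sub_eq_zero.1 (coeff_eq_zero_of_algebraMap (b := b) (D := fun w => D w - E w)
    (fun w => sub_mem (hD w) (hE w)) (fun f => ?_) w)
  simp only [sub_mul, Finset.sum_sub_distrib, h, sub_self, LinearMap.zero_apply]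

end ReflOps

section Cherednik

variable {ι M N : Type*} [Fintype ι] [AddCommGroup M] [Module ℝ M] [AddCommGroup N] [Module ℝ N]
  {P : RootPairing ι ℝ M N} [P.IsRootSystem] [P.IsCrystallographic] {b : P.Base}
  {I : Set b.support} {k : ι → ℝ}

local notation "σ" => RootPairing.weylGroup.ofIdx P

/-! ### The Cherednik operators on rational functions -/

variable (P) in
/-- The operator `f ↦ (f - s_α f) / (1 - e^{-α})` on rational functions. -/
def divDiffRat (i : ι) : Module.End ℂ (RatFun P) :=
  Algebra.lmul ℂ (RatFun P) (invOneSub P i) * (1 - weylEnd P (σ i))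

open scoped Classical in
theorem cherednik_eq (ξ : CplxSpace N) :
    cherednik b k ξ = derivRat P ξ + ∑ i with b.IsPos i,
      (k i * cplxFunctional P (P.root i) ξ) • divDiffRat P i -
        cplxFunctional P (rhoVec b k) ξ • (1 : Module.End ℂ (RatFun P)) := by
  simp only [cherednik, LinearMap.sub_apply, LinearMap.add_apply, LinearMap.sum_apply,
    LinearMap.smulRight_apply, smul_smul, mul_comm (k _ : ℂ)]
  rfl

theorem divDiffRat_algebraMap (i : ι) (f : LaurentPoly P) :
    divDiffRat P i (algebraMap _ _ f) = algebraMap _ _ (divDiff P i f) := by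
  change invOneSub P i * (algebraMap _ _ f - weylEnd P (σ i) (algebraMap _ _ f)) = _
  rw [weylEnd_algebraMap, ← map_sub, ← oneSub_mul_divDiff, map_mul, invOneSub_eq,
    inv_mul_cancel_left₀ (algebraMap_oneSub_ne_zero i)]

theorem smul_algebraMap (c : ℂ) (f : LaurentPoly P) :
    c • algebraMap _ (RatFun P) f = algebraMap _ _ (c • f) :=
  (map_smul (IsScalarTower.toAlgHom ℂ (LaurentPoly P) (RatFun P)) c f).symm

theorem cherednik_algebraMap (ξ : CplxSpace N) (f : LaurentPoly P) :
    cherednik b k ξ (algebraMap _ _ f) = algebraMap _ _ (cherednikLaurent b k ξ f) := by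
  classical
  rw [cherednik_eq, cherednikLaurent_apply]
  simp only [LinearMap.sub_apply, LinearMap.add_apply, LinearMap.sum_apply, LinearMap.smul_apply,
    derivRat_algebraMap, divDiffRat_algebraMap, Module.End.one_apply, smul_algebraMap, map_add,
    map_sub, map_sum, mul_comm (k _ : ℂ)]

theorem lift_cherednik_algebraMap (y : TensorAlgebra ℂ (CplxSpace N)) (f : LaurentPoly P) :
    TensorAlgebra.lift ℂ (cherednik b k) y (algebraMap _ _ f) =
      algebraMap _ _ (TensorAlgebra.lift ℂ (cherednikLaurent b k) y f) := by
  induction y using TensorAlgebra.induction generalizing f with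
  | algebraMap r =>
    rw [AlgHom.commutes, AlgHom.commutes, Module.algebraMap_end_apply,
      Module.algebraMap_end_apply, smul_algebraMap]
  | ι ξ => rw [TensorAlgebra.lift_ι_apply, TensorAlgebra.lift_ι_apply, cherednik_algebraMap]
  | mul x y hx hy =>
    rw [map_mul, map_mul, Module.End.mul_apply, Module.End.mul_apply, hy, hx]
  | add x y hx hy =>
    rw [map_add, map_add, LinearMap.add_apply, LinearMap.add_apply, hy, hx, map_add]

theorem divDiffRat_mem_reflOps (i : ι) : divDiffRat P i ∈ reflOps b :=
  mul_mem (diffOps_le_reflOps (lmul_mem_diffOps (invOneSub_mem_coeffAlg i)))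
    (sub_mem (one_mem _) (weylEnd_mem_reflOps _))

theorem cherednik_mem_reflOps (ξ : CplxSpace N) : cherednik b k ξ ∈ reflOps b := by
  classical
  rw [cherednik_eq]
  refine sub_mem (add_mem (diffOps_le_reflOps (derivRat_mem_diffOps ξ)) (sum_mem fun i _ => ?_))
    (Subalgebra.smul_mem _ (one_mem _) _)
  exact Subalgebra.smul_mem _ (divDiffRat_mem_reflOps i) _

theorem lift_cherednik_mem_reflOps (y : TensorAlgebra ℂ (CplxSpace N)) :
    TensorAlgebra.lift ℂ (cherednik b k) y ∈ reflOps b := by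
  induction y using TensorAlgebra.induction with
  | algebraMap r =>
    rw [AlgHom.commutes]
    exact Subalgebra.algebraMap_mem _ r
  | ι ξ =>
    rw [TensorAlgebra.lift_ι_apply]
    exact cherednik_mem_reflOps ξ
  | mul x y hx hy =>
    rw [map_mul]
    exact mul_mem hx hy
  | add x y hx hy =>
    rw [map_add]
    exact add_mem hx hy

/-- A differential-reflection operator is determined by its restriction to `ℂ[P]`. -/
theorem commute_cherednik {L : LaurentPoly P →ₗ[ℂ] ℂ} (hL : IsWeightFunctional b k L)
    (ξ η : CplxSpace N) : Commute (cherednik b k ξ) (cherednik b k η) := by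
  refine eq_of_forall_algebraMap (b := b) (mul_mem (cherednik_mem_reflOps ξ)
    (cherednik_mem_reflOps η)) (mul_mem (cherednik_mem_reflOps η) (cherednik_mem_reflOps ξ))
    fun f => ?_
  rw [Module.End.mul_apply, Module.End.mul_apply, cherednik_algebraMap, cherednik_algebraMap,
    cherednik_algebraMap, cherednik_algebraMap, ← Module.End.mul_apply,
    (commute_cherednikLaurent hL ξ η).eq, Module.End.mul_apply]

/-! ### Commutation with simple reflections -/

theorem conjOp_divDiffRat (w : P.weylGroup) (i : ι) :
    conjOp w (divDiffRat P i) = divDiffRat P (w • i) := by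
  rw [divDiffRat, divDiffRat, map_mul, conjOp_lmul, weylEnd_invOneSub, map_sub, map_one,
    conjOp_weylEnd, ← ofIdx_smul_eq]

theorem divDiffRat_neg (i : ι) :
    divDiffRat P (P.reflectionPerm i i) = 1 - weylEnd P (σ i) - divDiffRat P i := by
  rw [divDiffRat, divDiffRat, invOneSub_neg, ofIdx_neg, map_sub, map_one, sub_mul, one_mul]

open scoped Classical in
/-- A simple reflection permutes the positive roots other than the simple root itself. -/
theorem sum_isPos_ofIdx_smul {X : Type*} [AddCommMonoid X] {i : ι} (hi : i ∈ b.support)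
    (F : ι → X) : ∑ j with b.IsPos j, F (σ i • j) + F i =
      ∑ j with b.IsPos j, F j + F (P.reflectionPerm i i) := by
  have hpos : b.IsPos i := b.isPos_of_mem_support hi
  have hii : i ∈ Finset.univ.filter b.IsPos := Finset.mem_filter.2 ⟨Finset.mem_univ _, hpos⟩
  rw [← Finset.add_sum_erase _ _ hii, ← Finset.add_sum_erase _ _ hii, ofIdx_smul_idx]
  have h1 : ∑ j ∈ (Finset.univ.filter b.IsPos).erase i, F (σ i • j) =
      ∑ j ∈ (Finset.univ.filter b.IsPos).erase i, F j := by
    have hmem : ∀ j ∈ (Finset.univ.filter b.IsPos).erase i,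
        σ i • j ∈ (Finset.univ.filter b.IsPos).erase i := by
      intro j hj
      obtain ⟨hne, hj⟩ := Finset.mem_erase.1 hj
      have hj' := (Finset.mem_filter.1 hj).2
      refine Finset.mem_erase.2 ⟨fun h => ?_, Finset.mem_filter.2
        ⟨Finset.mem_univ _, isPos_ofIdx_smul b hj' hi hne⟩⟩
      have h2 : j = P.reflectionPerm i i := (ofIdx_smul_ofIdx_smul (P := P) i j).symm.trans
        ((congrArg (σ i • ·) h).trans (ofIdx_smul_idx i i))
      rw [h2, isPos_neg_iff b] at hj'
      exact hj' hpos
    refine Finset.sum_nbij' (fun j => σ i • j) (fun j => σ i • j) hmem hmem ?_ ?_ ?_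
    · exact fun j _ => ofIdx_smul_ofIdx_smul i j
    · exact fun j _ => ofIdx_smul_ofIdx_smul i j
    · exact fun j _ => rfl
  rw [h1]
  abel

theorem ofIdx_smul_rhoVec (hk : ∀ i j, k (P.reflectionPerm i j) = k j) {i : ι}
    (hi : i ∈ b.support) : σ i • rhoVec b k = rhoVec b k - k i • P.root i := by
  classical
  have h1 := sum_isPos_ofIdx_smul hi fun j => k j • P.root j
  simp only [ofIdx_smul_idx, hk] at h1
  have h2 : σ i • rhoVec b k =
      (1 / 2 : ℝ) • ∑ j with b.IsPos j, k j • P.root (P.reflectionPerm i j) := by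
    rw [rhoVec, smul_comm (σ i) (1 / 2 : ℝ), Finset.smul_sum]
    congr 1
    refine Finset.sum_congr rfl fun j _ => ?_
    rw [smul_comm (σ i) (k j : ℝ), smul_root, ofIdx_smul_idx]
  rw [h2, eq_sub_of_add_eq h1, root_neg, rhoVec]
  module

theorem cplxFunctional_smul_weylCplx (w : P.weylGroup) (v : M) (ξ : CplxSpace N) :
    cplxFunctional P (w • v) (weylCplx P w ξ) = cplxFunctional P v ξ := by
  rw [cplxFunctional_weylCplx, inv_smul_smul]

/-- The cross relation of the degenerate affine Hecke algebra. -/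
theorem conjOp_cherednik (hk : ∀ i j, k (P.reflectionPerm i j) = k j) {i : ι}
    (hi : i ∈ b.support) (ξ : CplxSpace N) :
    conjOp (σ i) (cherednik b k ξ) = cherednik b k (weylCplx P (σ i) ξ) -
      (k i * cplxFunctional P (P.root i) ξ) • weylEnd P (σ i) := by
  classical
  set ξ' := weylCplx P (σ i) ξ with hξ'
  have h1 := sum_isPos_ofIdx_smul hi fun j =>
    (k j * cplxFunctional P (P.root j) ξ') • divDiffRat P j
  have h2 : ∀ j, (k (σ i • j) * cplxFunctional P (P.root (σ i • j)) ξ') =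
      k j * cplxFunctional P (P.root j) ξ := by
    intro j
    rw [← smul_root, hξ', cplxFunctional_smul_weylCplx, ofIdx_smul_idx, hk]
  have h3 : cplxFunctional P (P.root i) ξ' = -cplxFunctional P (P.root i) ξ := by
    rw [hξ', cplxFunctional_weylCplx, ofIdx_inv, smul_root, ofIdx_smul_idx, root_neg]
    exact LinearMap.congr_fun (map_neg (cplxFunctionalHom P) (P.root i)) ξ
  have h4 : cplxFunctional P (P.root (P.reflectionPerm i i)) ξ' =
      cplxFunctional P (P.root i) ξ := by
    rw [← ofIdx_smul_idx, ← smul_root, hξ', cplxFunctional_smul_weylCplx]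
  have h5 : cplxFunctional P (rhoVec b k) ξ' =
      cplxFunctional P (rhoVec b k) ξ - k i * cplxFunctional P (P.root i) ξ := by
    rw [hξ', cplxFunctional_weylCplx, ofIdx_inv, ofIdx_smul_rhoVec hk hi, cplxFunctional_sub,
      cplxFunctional_smul]
    simp
  simp only [h2] at h1
  rw [h3, h4, hk, divDiffRat_neg] at h1
  rw [cherednik_eq, cherednik_eq, map_sub, map_add, conjOp_derivRat, map_sum, map_smul, map_one,
    h5]
  simp only [map_smul, conjOp_divDiffRat]
  rw [eq_sub_of_add_eq h1]
  module

theorem weylEnd_mul_cherednik (hk : ∀ i j, k (P.reflectionPerm i j) = k j) {i : ι}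
    (hi : i ∈ b.support) (ξ : CplxSpace N) :
    weylEnd P (σ i) * cherednik b k ξ = cherednik b k (weylCplx P (σ i) ξ) * weylEnd P (σ i) -
      (k i * cplxFunctional P (P.root i) ξ) • 1 := by
  rw [← conjOp_mul_weylEnd, conjOp_cherednik hk hi, sub_mul, smul_mul_assoc, ← map_mul,
    ofIdx_mul_self, map_one]

theorem weylCplx_ofIdx (i : ι) (ξ : CplxSpace N) : weylCplx P (σ i) ξ =
    ξ - cplxFunctional P (P.root i) ξ • ((1 : ℂ) ⊗ₜ P.coroot i) := by
  induction ξ using TensorProduct.induction_on with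
  | zero => simp
  | add ξ η hξ hη =>
    rw [map_add, map_add, hξ, hη, add_smul]
    abel
  | tmul c η =>
    have h : ((((σ i)⁻¹ : P.weylGroup) : P.Aut).coweightMap : N →ₗ[ℝ] N) η =
        η - P.toLinearMap (P.root i) η • P.coroot i := by
      rw [ofIdx_inv]
      rfl
    rw [weylCplx, LinearMap.baseChange_tmul, h, cplxFunctional_tmul, TensorProduct.tmul_sub,
      TensorProduct.tmul_smul, TensorProduct.smul_tmul', TensorProduct.smul_tmul', smul_eq_mul,
      mul_one, Complex.real_smul, mul_comm]

end Cherednik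

section Invariants

variable {ι M N : Type*} [Fintype ι] [AddCommGroup M] [Module ℝ M] [AddCommGroup N] [Module ℝ N]
  {P : RootPairing ι ℝ M N} [P.IsRootSystem] [P.IsCrystallographic] {b : P.Base}
  {I : Set b.support} {k : ι → ℝ}

local notation "σ" => RootPairing.weylGroup.ofIdx P

/-! ### Invariant polynomials in the Cherednik operators -/

open scoped IsMulCommutative in
/-- Polynomials in commuting operators. -/
theorem exists_symmetricAlgebra_hom {V A : Type*} [AddCommGroup V] [Module ℂ V] [Ring A]
    [Algebra ℂ A] (φ : V →ₗ[ℂ] A) (hφ : ∀ ξ η, Commute (φ ξ) (φ η)) :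
    ∃ Φ : SymmetricAlgebra ℂ V →ₐ[ℂ] A,
      ∀ y, Φ (SymmetricAlgebra.algHom ℂ V y) = TensorAlgebra.lift ℂ φ y := by
  have hcomm : IsMulCommutative (Algebra.adjoin ℂ (Set.range φ)) :=
    Algebra.isMulCommutative_adjoin ℂ (by
      rintro _ ⟨ξ, rfl⟩ _ ⟨η, rfl⟩
      exact hφ ξ η)
  let φ' : V →ₗ[ℂ] Algebra.adjoin ℂ (Set.range φ) :=
    φ.codRestrict (Subalgebra.toSubmodule (Algebra.adjoin ℂ (Set.range φ)))
      fun ξ => Algebra.subset_adjoin ⟨ξ, rfl⟩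
  refine ⟨(Algebra.adjoin ℂ (Set.range φ)).val.comp (SymmetricAlgebra.lift φ'), fun y => ?_⟩
  have h : ((Algebra.adjoin ℂ (Set.range φ)).val.comp (SymmetricAlgebra.lift φ')).comp
      (SymmetricAlgebra.algHom ℂ V) = TensorAlgebra.lift ℂ φ := by
    refine TensorAlgebra.hom_ext (LinearMap.ext fun ξ => ?_)
    have h1 := SymmetricAlgebra.lift_ι_apply φ' ξ
    have h2 := TensorAlgebra.lift_ι_apply φ ξ
    exact (congrArg Subtype.val h1).trans h2.symm
  exact DFunLike.congr_fun h y

/-- The elements of `S(𝔥)` fixed by `s_α` are polynomials in the kernel of `α` and the square of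
the coroot. -/
theorem mem_adjoin_of_weylSym_ofIdx {i : ι} {q : SymmetricAlgebra ℂ (CplxSpace N)}
    (hq : weylSym P (σ i) q = q) :
    q ∈ Algebra.adjoin ℂ (SymmetricAlgebra.ι ℂ _ '' {ξ | cplxFunctional P (P.root i) ξ = 0} ∪
      {SymmetricAlgebra.ι ℂ _ ((1 : ℂ) ⊗ₜ P.coroot i) ^ 2}) := by
  set B := Algebra.adjoin ℂ (SymmetricAlgebra.ι ℂ (CplxSpace N) ''
    {ξ | cplxFunctional P (P.root i) ξ = 0} ∪
      {SymmetricAlgebra.ι ℂ _ ((1 : ℂ) ⊗ₜ P.coroot i) ^ 2}) with hB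
  set x := SymmetricAlgebra.ι ℂ (CplxSpace N) ((1 : ℂ) ⊗ₜ P.coroot i) with hx
  have hxx : x ^ 2 ∈ B := Algebra.subset_adjoin (Or.inr rfl)
  have hroot : cplxFunctional P (P.root i) ((1 : ℂ) ⊗ₜ P.coroot i) = 2 := by
    rw [cplxFunctional_tmul, one_mul]
    have := P.root_coroot_two i
    rw [this]
    norm_num
  have hsx : weylSym P (σ i) x = -x := by
    rw [hx, weylSym_ι, weylCplx_ofIdx, hroot, two_smul, sub_add_cancel_left, map_neg]
  have hsB : ∀ p ∈ B, weylSym P (σ i) p = p := by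
    suffices h : B ≤ AlgHom.equalizer (weylSym P (σ i)) (AlgHom.id ℂ _) from fun p hp => h hp
    refine Algebra.adjoin_le ?_
    rintro _ (⟨ξ, hξ, rfl⟩ | rfl)
    · change weylSym P (σ i) _ = _
      rw [weylSym_ι, weylCplx_ofIdx, show cplxFunctional P (P.root i) ξ = 0 from hξ, zero_smul,
        sub_zero]
      rfl
    · change weylSym P (σ i) (x ^ 2) = x ^ 2
      rw [map_pow, hsx, neg_sq]
  -- Every element is a sum of an even and an odd part with respect to the coroot.
  have hdecomp : ∃ p ∈ B, ∃ r ∈ B, q = p + x * r := by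
    clear hq
    induction q using SymmetricAlgebra.induction with
    | algebraMap c => exact ⟨_, Subalgebra.algebraMap_mem B c, 0, zero_mem B, by simp⟩
    | ι ξ =>
      set c := cplxFunctional P (P.root i) ξ / 2 with hc
      refine ⟨SymmetricAlgebra.ι ℂ _ (ξ - c • ((1 : ℂ) ⊗ₜ P.coroot i)),
        Algebra.subset_adjoin (Or.inl ⟨_, ?_, rfl⟩), algebraMap ℂ _ c,
        Subalgebra.algebraMap_mem B c, ?_⟩
      · change cplxFunctional P (P.root i) _ = 0
        rw [map_sub, map_smul, hroot, hc, smul_eq_mul, div_mul_cancel₀ _ two_ne_zero, sub_self]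
      · rw [map_sub, map_smul, mul_comm, ← Algebra.smul_def, sub_add_cancel]
    | mul q q' h h' =>
      obtain ⟨p, hp, r, hr, rfl⟩ := h
      obtain ⟨p', hp', r', hr', rfl⟩ := h'
      exact ⟨p * p' + x ^ 2 * (r * r'), add_mem (mul_mem hp hp') (mul_mem hxx (mul_mem hr hr')),
        p * r' + r * p', add_mem (mul_mem hp hr') (mul_mem hr hp'), by ring⟩
    | add q q' h h' =>
      obtain ⟨p, hp, r, hr, rfl⟩ := h
      obtain ⟨p', hp', r', hr', rfl⟩ := h'
      exact ⟨p + p', add_mem hp hp', r + r', add_mem hr hr', by ring⟩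
  obtain ⟨p, hp, r, hr, rfl⟩ := hdecomp
  rw [map_add, map_mul, hsx, hsB p hp, hsB r hr] at hq
  have h2 : (2 : ℂ) • (p + x * r) = (2 : ℂ) • p := by
    rw [two_smul, two_smul]
    linear_combination -hq
  have h3 : p + x * r = p := by
    have := congrArg (fun z => (2 : ℂ)⁻¹ • z) h2
    simpa only [smul_smul, inv_mul_cancel₀ (two_ne_zero' ℂ), one_smul] using this
  rw [h3]
  exact hp

variable (hc : ∀ ξ η : CplxSpace N, Commute (cherednik b k ξ) (cherednik b k η))

include hc in
/-- By the cross relation, `s_α` commutes with `D_ξ` for `α(ξ) = 0` and with the square of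
`D_{α^∨}`. -/
theorem commute_ofIdx_of_weylSym (hk : ∀ i j, k (P.reflectionPerm i j) = k j) {i : ι}
    (hi : i ∈ b.support) {y : TensorAlgebra ℂ (CplxSpace N)}
    (hy : weylSym P (σ i) (SymmetricAlgebra.algHom ℂ _ y) = SymmetricAlgebra.algHom ℂ _ y) :
    Commute (TensorAlgebra.lift ℂ (cherednik b k) y) (weylEnd P (σ i)) := by
  obtain ⟨Φ, hΦ⟩ := exists_symmetricAlgebra_hom (cherednik b k) hc
  have hΦι : ∀ ξ, Φ (SymmetricAlgebra.ι ℂ _ ξ) = cherednik b k ξ := fun ξ =>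
    (hΦ (TensorAlgebra.ι ℂ ξ)).trans (TensorAlgebra.lift_ι_apply _ _)
  rw [← hΦ]
  have hroot : cplxFunctional P (P.root i) ((1 : ℂ) ⊗ₜ P.coroot i) = 2 := by
    rw [cplxFunctional_tmul, one_mul]
    have := P.root_coroot_two i
    rw [this]
    norm_num
  suffices h : Algebra.adjoin ℂ (SymmetricAlgebra.ι ℂ (CplxSpace N) ''
      {ξ | cplxFunctional P (P.root i) ξ = 0} ∪
      {SymmetricAlgebra.ι ℂ _ ((1 : ℂ) ⊗ₜ P.coroot i) ^ 2}) ≤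
      (Subalgebra.centralizer ℂ {weylEnd P (σ i)}).comap Φ from
    ((Subalgebra.mem_centralizer_iff ℂ).1 (h (mem_adjoin_of_weylSym_ofIdx hy)) _ rfl).symm
  refine Algebra.adjoin_le ?_
  rintro _ (⟨ξ, hξ, rfl⟩ | rfl)
  · refine (Subalgebra.mem_centralizer_iff ℂ).2 ?_
    rintro _ rfl
    change weylEnd P (σ i) * Φ _ = Φ _ * weylEnd P (σ i)
    rw [hΦι, weylEnd_mul_cherednik hk hi, weylCplx_ofIdx,
      show cplxFunctional P (P.root i) ξ = 0 from hξ, zero_smul, sub_zero, mul_zero, zero_smul,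
      sub_zero]
  · refine (Subalgebra.mem_centralizer_iff ℂ).2 ?_
    rintro _ rfl
    change weylEnd P (σ i) * Φ _ = Φ _ * weylEnd P (σ i)
    rw [map_pow, hΦι]
    set D := cherednik b k ((1 : ℂ) ⊗ₜ P.coroot i) with hD
    have h1 : weylEnd P (σ i) * D = -D * weylEnd P (σ i) - ((k i : ℂ) * 2) • 1 := by
      rw [hD, weylEnd_mul_cherednik hk hi, weylCplx_ofIdx, hroot, two_smul, sub_add_cancel_left,
        map_neg]
    rw [pow_two, ← mul_assoc, h1, sub_mul, mul_assoc, h1, mul_sub, smul_mul_assoc, one_mul,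
      mul_smul_comm, mul_one, smul_neg, sub_neg_eq_add, add_sub_cancel_right, ← mul_assoc]
    exact congrArg (· * weylEnd P (σ i)) (neg_mul_neg D D)

include hc in
/-- The operators `q(D(k))` with `q ∈ S(𝔥)^{W_I}` commute with `W_I`. -/
theorem commute_weylEnd_of_weylSym (hk : ∀ i j, k (P.reflectionPerm i j) = k j)
    {y : TensorAlgebra ℂ (CplxSpace N)}
    (hy : ∀ w ∈ parabolic b I, weylSym P w (SymmetricAlgebra.algHom ℂ _ y) =
      SymmetricAlgebra.algHom ℂ _ y) {w : P.weylGroup} (hw : w ∈ parabolic b I) :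
    Commute (TensorAlgebra.lift ℂ (cherednik b k) y) (weylEnd P w) := by
  refine parabolic_induction (p := fun w => Commute (TensorAlgebra.lift ℂ (cherednik b k) y)
    (weylEnd P w)) ?_ ?_ hw
  · rw [map_one]
    exact Commute.one_right _
  · intro w _ j hj _ ih
    rw [map_mul]
    exact ih.mul_right (commute_ofIdx_of_weylSym hc hk j.2 (hy _ (ofIdx_mem_parabolic hj)))

end Invariants

section Matrices

variable {ι M N : Type*} [Fintype ι] [AddCommGroup M] [Module ℝ M] [AddCommGroup N] [Module ℝ N]
  {P : RootPairing ι ℝ M N} [P.IsRootSystem] [P.IsCrystallographic] {b : P.Base}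
  {I : Set b.support} {k : ι → ℝ}

local notation "σ" => RootPairing.weylGroup.ofIdx P

/-! ### Coefficients of differential-reflection operators -/

open scoped Classical in
/-- The coefficient `D_w` of the operator `∑_w D_w w`. -/
def reflCoeff (b : P.Base) (T : Module.End ℂ (RatFun P)) (w : P.weylGroup) : diffOps b :=
  if h : T ∈ reflOps b then ⟨h.choose w, h.choose_spec.1 w⟩ else 0

theorem sum_reflCoeff {T : Module.End ℂ (RatFun P)} (hT : T ∈ reflOps b) :
    ∑ w, (reflCoeff b T w : Module.End ℂ (RatFun P)) * weylEnd P w = T := by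
  simp only [reflCoeff, dif_pos hT]
  exact hT.choose_spec.2.symm

theorem reflCoeff_eq {T : Module.End ℂ (RatFun P)} {D : P.weylGroup → diffOps b}
    (h : ∑ w, (D w : Module.End ℂ (RatFun P)) * weylEnd P w = T) (w : P.weylGroup) :
    reflCoeff b T w = D w := by
  have hT : T ∈ reflOps b := ⟨_, fun w => (D w).2, h.symm⟩
  exact Subtype.ext (coeff_unique (fun w => (reflCoeff b T w).2) (fun w => (D w).2)
    ((sum_reflCoeff hT).trans h.symm) w)

theorem reflCoeff_add {S T : Module.End ℂ (RatFun P)} (hS : S ∈ reflOps b) (hT : T ∈ reflOps b)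
    (w : P.weylGroup) : reflCoeff b (S + T) w = reflCoeff b S w + reflCoeff b T w := by
  refine reflCoeff_eq (D := fun w => reflCoeff b S w + reflCoeff b T w) ?_ w
  simp only [AddMemClass.coe_add, add_mul, Finset.sum_add_distrib, sum_reflCoeff hS,
    sum_reflCoeff hT]

theorem reflCoeff_smul (c : ℂ) {T : Module.End ℂ (RatFun P)} (hT : T ∈ reflOps b)
    (w : P.weylGroup) : reflCoeff b (c • T) w = c • reflCoeff b T w := by
  refine reflCoeff_eq (D := fun w => c • reflCoeff b T w) ?_ w
  simp only [Subalgebra.coe_smul, smul_mul_assoc, ← Finset.smul_sum, sum_reflCoeff hT]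

open scoped Classical in
theorem reflCoeff_one (w : P.weylGroup) : reflCoeff b 1 w = if w = 1 then 1 else 0 := by
  refine reflCoeff_eq (D := fun w => if w = 1 then 1 else 0) ?_ w
  rw [Finset.sum_eq_single 1]
  · rw [if_pos rfl, map_one, mul_one, OneMemClass.coe_one]
  · intro w _ hw
    rw [if_neg hw, ZeroMemClass.coe_zero, zero_mul]
  · exact fun h => absurd (Finset.mem_univ _) h

theorem reflCoeff_mul {S T : Module.End ℂ (RatFun P)} (hS : S ∈ reflOps b) (hT : T ∈ reflOps b)
    (u : P.weylGroup) : (reflCoeff b (S * T) u : Module.End ℂ (RatFun P)) =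
      ∑ w, (reflCoeff b S w : Module.End ℂ (RatFun P)) *
        conjOp w (reflCoeff b T (w⁻¹ * u)) := by
  have h := sum_mul_sum_weylEnd (fun w => (reflCoeff b S w : Module.End ℂ (RatFun P)))
    (fun w => (reflCoeff b T w : Module.End ℂ (RatFun P)))
  rw [sum_reflCoeff hS, sum_reflCoeff hT] at h
  exact congrArg Subtype.val (reflCoeff_eq (b := b)
    (D := fun u => ⟨_, sum_mem fun w _ => mul_mem (reflCoeff b S w).2
      (conjOp_mem_diffOps w (reflCoeff b T (w⁻¹ * u)).2)⟩) h.symm u)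

theorem reflCoeff_conjOp (w : P.weylGroup) {T : Module.End ℂ (RatFun P)} (hT : T ∈ reflOps b)
    (v : P.weylGroup) : (reflCoeff b (conjOp w T) v : Module.End ℂ (RatFun P)) =
      conjOp w (reflCoeff b T (w⁻¹ * v * w)) := by
  refine congrArg Subtype.val (reflCoeff_eq (b := b)
    (D := fun v => ⟨_, conjOp_mem_diffOps w (reflCoeff b T (w⁻¹ * v * w)).2⟩) ?_ v)
  conv_rhs => rw [← sum_reflCoeff hT, map_sum]
  refine Fintype.sum_equiv (MulAut.conj w⁻¹).toEquiv _ _ fun v => ?_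
  rw [map_mul, conjOp_weylEnd]
  simp [mul_assoc]

/-! ### The operators commuting with a parabolic subgroup -/

/-- The differential-reflection operators that commute with `W_I`. -/
def invReflOps (b : P.Base) (I : Set b.support) : Subalgebra ℂ (Module.End ℂ (RatFun P)) :=
  reflOps b ⊓ Subalgebra.centralizer ℂ (weylEnd P '' parabolic b I)

theorem mem_invReflOps {T : Module.End ℂ (RatFun P)} :
    T ∈ invReflOps b I ↔ T ∈ reflOps b ∧ ∀ w ∈ parabolic b I, conjOp w T = T := by
  refine and_congr Iff.rfl ?_
  rw [SetLike.mem_coe, Subalgebra.mem_centralizer_iff, Set.forall_mem_image]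
  refine forall₂_congr fun w _ => ?_
  rw [conjOp_eq_iff_commute]
  exact eq_comm

/-- The conjugate of an operator by a representative of a coset. -/
def cosetConj (c : Cosets b I) : Module.End ℂ (RatFun P) →ₐ[ℂ] Module.End ℂ (RatFun P) :=
  conjOp c.out

theorem cosetConj_mk {T : Module.End ℂ (RatFun P)} (hT : T ∈ invReflOps b I) (u : P.weylGroup) :
    cosetConj (u : Cosets b I) T = conjOp u T := by
  obtain ⟨h, hh⟩ := QuotientGroup.mk_out_eq_mul (parabolic b I) u
  rw [cosetConj, hh, ← conjOp_conjOp, (mem_invReflOps.1 hT).2 _ h.2]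

theorem conjOp_cosetConj {T : Module.End ℂ (RatFun P)} (hT : T ∈ invReflOps b I)
    (w : P.weylGroup) (c : Cosets b I) : conjOp w (cosetConj c T) = cosetConj (w • c) T := by
  induction c using QuotientGroup.induction_on with
  | H u =>
    rw [cosetConj_mk hT, conjOp_conjOp, ← smul_eq_mul, ← cosetConj_mk hT]
    rfl

theorem cosetConj_mem {T : Module.End ℂ (RatFun P)} (hT : T ∈ invReflOps b I) (c : Cosets b I) :
    cosetConj c T ∈ reflOps b :=
  conjOp_mem_reflOps _ (mem_invReflOps.1 hT).1

/-- The matrix of differential operators `β(γ(T))`. If `∑_w D_w w` is the conjugate of `T` at the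
coset `c`, then the `c`-component of `γ(T) Φ` is `∑_w D_w w(Φ_c)`, and `w(Φ_c)` is the component
of `w Φ` at `w c`; hence `D_w` contributes to the entry `(c, w c)`. -/
def opMatrix (b : P.Base) (I : Set b.support) (T : Module.End ℂ (RatFun P)) : MatDiffOps b I :=
  Matrix.of fun c d => ∑ w with w • c = d, reflCoeff b (cosetConj c T) w

theorem opMatrix_apply (T : Module.End ℂ (RatFun P)) (c d : Cosets b I) :
    opMatrix b I T c d = ∑ w with w • c = d, reflCoeff b (cosetConj c T) w :=
  rfl

theorem opMatrix_mul {S T : Module.End ℂ (RatFun P)} (hS : S ∈ invReflOps b I)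
    (hT : T ∈ invReflOps b I) : opMatrix b I (S * T) = opMatrix b I S * opMatrix b I T := by
  classical
  refine Matrix.ext fun c d => ?_
  -- Sum over the group element that moves `c` to the intermediate coset.
  have h1 : (opMatrix b I S * opMatrix b I T) c d =
      ∑ w, reflCoeff b (cosetConj c S) w * opMatrix b I T (w • c) d := by
    rw [Matrix.mul_apply]
    simp only [opMatrix_apply (T := S), Finset.sum_mul]
    rw [← Finset.sum_fiberwise (s := Finset.univ) (g := fun w : P.weylGroup => w • c)]
    refine Finset.sum_congr rfl fun e _ => Finset.sum_congr rfl fun w hw => ?_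
    rw [(Finset.mem_filter.1 hw).2]
  rw [h1, opMatrix_apply]
  apply Subtype.ext
  rw [AddSubmonoidClass.coe_finsetSum, AddSubmonoidClass.coe_finsetSum]
  simp only [map_mul, reflCoeff_mul (cosetConj_mem hS c) (cosetConj_mem hT c)]
  rw [Finset.sum_comm]
  refine Finset.sum_congr rfl fun w _ => ?_
  rw [MulMemClass.coe_mul, ← Finset.mul_sum, opMatrix_apply, AddSubmonoidClass.coe_finsetSum]
  congr 1
  refine Finset.sum_nbij' (fun u => u * w⁻¹) (fun u => u * w) ?_ ?_ ?_ ?_ ?_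
  · intro u hu
    have := (Finset.mem_filter.1 hu).2
    exact Finset.mem_filter.2 ⟨Finset.mem_univ _, by rw [mul_smul, inv_smul_smul, this]⟩
  · intro u hu
    have := (Finset.mem_filter.1 hu).2
    exact Finset.mem_filter.2 ⟨Finset.mem_univ _, by rw [mul_smul, this]⟩
  · exact fun u _ => inv_mul_cancel_right u w
  · exact fun u _ => mul_inv_cancel_right u w
  · intro u _
    rw [← conjOp_cosetConj hT, reflCoeff_conjOp w (cosetConj_mem hT c)]
    simp only [mul_assoc, inv_mul_cancel, mul_one]

/-- The map `T ↦ β(γ(T))` is a homomorphism of algebras. -/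
def opHom (b : P.Base) (I : Set b.support) : invReflOps b I →ₐ[ℂ] MatDiffOps b I :=
  AlgHom.ofLinearMap
    { toFun := fun T => opMatrix b I T
      map_add' := fun S T => Matrix.ext fun c d => by
        simp only [opMatrix_apply, Matrix.add_apply, AddMemClass.coe_add, map_add,
          reflCoeff_add (cosetConj_mem S.2 c) (cosetConj_mem T.2 c), Finset.sum_add_distrib]
      map_smul' := fun a T => Matrix.ext fun c d => by
        simp only [opMatrix_apply, Matrix.smul_apply, Subalgebra.coe_smul, map_smul,
          reflCoeff_smul a (cosetConj_mem T.2 c), Finset.smul_sum, RingHom.id_apply] }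
    (Matrix.ext fun c d => by
      classical
      change opMatrix b I 1 c d = _
      rw [opMatrix_apply, map_one]
      simp only [reflCoeff_one]
      rw [Finset.sum_ite_eq', Matrix.one_apply]
      simp only [Finset.mem_filter, Finset.mem_univ, true_and, one_smul])
    (fun S T => opMatrix_mul S.2 T.2)

/-! ### Matrix-valued operators -/

theorem weylVec_apply (w : P.weylGroup) (Φ : VecFun b I) (c : Cosets b I) :
    weylVec b I w Φ c = weylEnd P w (Φ (w⁻¹ • c)) :=
  rfl

theorem matAct_apply (D : MatDiffOps b I) (Φ : VecFun b I) (c : Cosets b I) :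
    matAct b I D Φ c = ∑ d, (D c d : Module.End ℂ (RatFun P)) (Φ d) := by
  simp [matAct, LinearMap.sum_apply]

theorem reflAct_apply (Q : MatReflOps b I) (Φ : VecFun b I) :
    reflAct b I Q Φ = ∑ w, matAct b I (Q w) (weylVec b I w Φ) := by
  rw [reflAct, Finsupp.sum_fintype, LinearMap.sum_apply]
  · rfl
  · intro w
    have h : matAct b I (0 : MatDiffOps b I) = 0 :=
      LinearMap.ext fun Φ => funext fun c => by simp [matAct_apply]
    rw [h, zero_mul]

theorem reflAct_apply_apply (Q : MatReflOps b I) (Φ : VecFun b I) (c : Cosets b I) :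
    reflAct b I Q Φ c =
      ∑ e, (∑ w, (Q w c (w • e) : Module.End ℂ (RatFun P)) * weylEnd P w) (Φ e) := by
  rw [reflAct_apply, Finset.sum_apply]
  simp only [matAct_apply, LinearMap.sum_apply]
  rw [Finset.sum_comm (s := Finset.univ (α := Cosets b I))]
  refine Finset.sum_congr rfl fun w _ => ?_
  refine (Fintype.sum_equiv (MulAction.toPerm w) _ _ fun e => ?_).symm
  rw [MulAction.toPerm_apply, weylVec_apply, inv_smul_smul, Module.End.mul_apply]

/-- A matrix-valued differential-reflection operator is determined by its action. -/
theorem reflAct_injective : Function.Injective (reflAct b I) := by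
  classical
  intro Q Q' h
  refine Finsupp.ext fun w₀ => Matrix.ext fun c d => ?_
  -- Evaluate at the vectors supported at a single coset.
  have hQ : ∀ (Q : MatReflOps b I) (e : Cosets b I) (g : RatFun P),
      reflAct b I Q (Pi.single e g) c =
        (∑ w, (Q w c (w • e) : Module.End ℂ (RatFun P)) * weylEnd P w) g := by
    intro Q e g
    rw [reflAct_apply_apply, Finset.sum_eq_single e, Pi.single_eq_same]
    · intro e' _ he
      rw [Pi.single_eq_of_ne he, map_zero]
    · exact fun h => absurd (Finset.mem_univ _) h
  have h1 : ∑ w, (Q w c (w • w₀⁻¹ • d) : Module.End ℂ (RatFun P)) * weylEnd P w =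
      ∑ w, (Q' w c (w • w₀⁻¹ • d) : Module.End ℂ (RatFun P)) * weylEnd P w :=
    LinearMap.ext fun g => by rw [← hQ, ← hQ, h]
  have h2 := coeff_unique (b := b) (fun w => (Q w c (w • w₀⁻¹ • d)).2)
    (fun w => (Q' w c (w • w₀⁻¹ • d)).2) h1 w₀
  rw [smul_inv_smul] at h2
  exact Subtype.ext h2

theorem betaOp_eq (Q : MatReflOps b I) : betaOp b I Q = ∑ w, Q w :=
  Finsupp.sum_fintype _ _ fun _ => rfl

theorem matAct_betaOp (Q : MatReflOps b I) {Φ : VecFun b I} (hΦ : ∀ w, weylVec b I w Φ = Φ) :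
    matAct b I (betaOp b I Q) Φ = reflAct b I Q Φ := by
  rw [reflAct_apply, betaOp_eq]
  simp only [hΦ]
  refine funext fun c => ?_
  rw [Finset.sum_apply]
  simp only [matAct_apply, Matrix.sum_apply]
  rw [Finset.sum_comm]
  refine Finset.sum_congr rfl fun d _ => ?_
  rw [AddSubmonoidClass.coe_finsetSum, LinearMap.sum_apply]

theorem exists_minReps_mk_eq (c : Cosets b I) : ∃ u ∈ minReps b I, (u : Cosets b I) = c := by
  obtain ⟨v, hv, h⟩ := exists_mem_minReps (b := b) (I := I) c.out
  refine ⟨v, hv, ?_⟩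
  rw [← QuotientGroup.out_eq' c]
  exact (QuotientGroup.eq.2 h).symm

theorem gammaOp_apply {T : Module.End ℂ (RatFun P)} (hT : T ∈ invReflOps b I) (Φ : VecFun b I)
    (c : Cosets b I) : gammaOp b I T Φ c = cosetConj c T (Φ c) := by
  classical
  obtain ⟨u, hu, rfl⟩ := exists_minReps_mk_eq c
  have hfin : (minReps b I).Finite := Set.toFinite _
  rw [gammaOp, finsum_mem_eq_finite_toFinset_sum _ hfin, LinearMap.sum_apply, Finset.sum_apply,
    Finset.sum_eq_single u]
  · rw [cosetConj_mk hT, conjOp_apply]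
    simp only [LinearMap.comp_apply, LinearMap.single_apply, Pi.single_eq_same]
    rfl
  · intro v hv hne
    simp only [LinearMap.comp_apply, LinearMap.single_apply]
    refine Pi.single_eq_of_ne (fun h => hne ?_) _
    exact minReps_unique (hfin.mem_toFinset.1 hv) hu (QuotientGroup.eq.1 h.symm)
  · exact fun h => absurd (hfin.mem_toFinset.2 hu) h

/-- The element `γ(T)` of `𝔻_{I,ℛ} ⊗ ℂ[W]`. -/
def opRefl (b : P.Base) (I : Set b.support) (T : Module.End ℂ (RatFun P)) : MatReflOps b I :=
  Finsupp.equivFunOnFinite.symm fun w => Matrix.of fun c d =>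
    if w • c = d then reflCoeff b (cosetConj c T) w else 0

theorem opRefl_apply (T : Module.End ℂ (RatFun P)) (w : P.weylGroup) (c d : Cosets b I) :
    opRefl b I T w c d = if w • c = d then reflCoeff b (cosetConj c T) w else 0 :=
  rfl

theorem reflAct_opRefl {T : Module.End ℂ (RatFun P)} (hT : T ∈ invReflOps b I) :
    reflAct b I (opRefl b I T) = gammaOp b I T := by
  refine LinearMap.ext fun Φ => funext fun c => ?_
  rw [reflAct_apply_apply, gammaOp_apply hT, Finset.sum_eq_single c]
  · simp only [opRefl_apply, if_true]
    rw [sum_reflCoeff (cosetConj_mem hT c)]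
  · intro e _ he
    rw [Finset.sum_eq_zero, LinearMap.zero_apply]
    intro w _
    rw [opRefl_apply, if_neg (fun h => he (smul_left_cancel w h).symm), ZeroMemClass.coe_zero,
      zero_mul]
  · exact fun h => absurd (Finset.mem_univ _) h

theorem betaOp_opRefl (T : Module.End ℂ (RatFun P)) :
    betaOp b I (opRefl b I T) = opMatrix b I T := by
  refine Matrix.ext fun c d => ?_
  rw [betaOp_eq, Matrix.sum_apply, opMatrix_apply, Finset.sum_filter]
  exact Finset.sum_congr rfl fun w _ => opRefl_apply T w c d

theorem existsUnique_reflAct {T : Module.End ℂ (RatFun P)} (hT : T ∈ invReflOps b I) :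
    ∃! Q : MatReflOps b I, reflAct b I Q = gammaOp b I T :=
  ⟨_, reflAct_opRefl hT, fun _ hQ => reflAct_injective (hQ.trans (reflAct_opRefl hT).symm)⟩

end Matrices

section Vectors

variable {ι M N : Type*} [Fintype ι] [AddCommGroup M] [Module ℝ M] [AddCommGroup N] [Module ℝ N]
  {P : RootPairing ι ℝ M N} [P.IsRootSystem] [P.IsCrystallographic] {b : P.Base}
  {I : Set b.support} {k : ι → ℝ}

/-! ### Invariant vector-valued functions -/

theorem weylLaurent_eq_of_mk_eq {f : LaurentPoly P} (hf : f ∈ invLaurent b I) {u v : P.weylGroup}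
    (h : (u : Cosets b I) = v) : weylLaurent P u f = weylLaurent P v f := by
  have h1 := hf _ (QuotientGroup.eq.1 h)
  rw [weylLaurent_mul] at h1
  have h2 := congrArg (weylLaurent P u) h1
  rw [← weylLaurent_mul, mul_inv_cancel, weylLaurent_one] at h2
  exact h2.symm

theorem gammaVec_mk {f : LaurentPoly P} (hf : f ∈ invLaurent b I) (u : P.weylGroup) :
    gammaVec b I f u = algebraMap _ _ (weylLaurent P u f) := by
  classical
  obtain ⟨v, hv, h⟩ := exists_minReps_mk_eq (b := b) (I := I) u
  rw [weylLaurent_eq_of_mk_eq hf h.symm, ← h]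
  have hfin : (minReps b I).Finite := Set.toFinite _
  rw [gammaVec, finsum_mem_eq_finite_toFinset_sum _ hfin, Finset.sum_apply,
    Finset.sum_eq_single v]
  · rw [weylVec_apply, MulAction.Quotient.smul_coe, smul_eq_mul, inv_mul_cancel, Pi.single_eq_same,
      weylEnd_algebraMap]
  · intro w hw hne
    rw [weylVec_apply, Pi.single_eq_of_ne, map_zero]
    intro h1
    refine hne (minReps_unique (hfin.mem_toFinset.1 hw) hv (QuotientGroup.eq.1 ?_))
    rw [inv_smul_eq_iff, MulAction.Quotient.smul_coe, smul_eq_mul, mul_one] at h1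
    exact h1.symm
  · exact fun h => absurd (hfin.mem_toFinset.2 hv) h

theorem gammaVec_mem_invVec {f : LaurentPoly P} (hf : f ∈ invLaurent b I) :
    gammaVec b I f ∈ invVec b I := by
  refine ⟨fun c => ?_, fun w => funext fun c => ?_⟩
  · induction c using QuotientGroup.induction_on with
    | H u => exact ⟨_, gammaVec_mk hf u⟩
  · induction c using QuotientGroup.induction_on with
    | H u =>
      rw [weylVec_apply, MulAction.Quotient.smul_coe, gammaVec_mk hf, gammaVec_mk hf,
        weylEnd_algebraMap, ← weylLaurent_mul, smul_eq_mul, mul_inv_cancel_left]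

/-- An invariant vector-valued function is determined by its component at the trivial coset. -/
theorem exists_eq_gammaVec {Φ : VecFun b I} (hΦ : Φ ∈ invVec b I) :
    ∃ f ∈ invLaurent b I, Φ = gammaVec b I f := by
  obtain ⟨f, hf⟩ := hΦ.1 ((1 : P.weylGroup) : Cosets b I)
  have h1 : ∀ u : P.weylGroup, Φ u = algebraMap _ _ (weylLaurent P u f) := by
    intro u
    have h2 := congrFun (hΦ.2 u) (u : Cosets b I)
    rw [weylVec_apply, MulAction.Quotient.smul_coe, smul_eq_mul, inv_mul_cancel, hf,
      weylEnd_algebraMap] at h2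
    exact h2.symm
  have hinv : f ∈ invLaurent b I := by
    intro w hw
    have h2 : (w : Cosets b I) = (1 : P.weylGroup) :=
      (QuotientGroup.eq.2 (by rwa [inv_one, one_mul])).symm
    have h3 := h1 w
    rw [h2, hf] at h3
    exact (algebraMap_injective h3).symm
  refine ⟨f, hinv, funext fun c => ?_⟩
  induction c using QuotientGroup.induction_on with
  | H u => exact (h1 u).trans (gammaVec_mk hinv u).symm

/-- The map `Γ` on invariant Laurent polynomials, extended linearly by a choice of
representatives of the cosets. -/
def gammaLin (b : P.Base) (I : Set b.support) : LaurentPoly P →ₗ[ℂ] VecFun b I :=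
  LinearMap.pi fun c => (IsScalarTower.toAlgHom ℂ (LaurentPoly P) (RatFun P)).toLinearMap ∘ₗ
    (weylLaurent P c.out).toLinearMap

theorem gammaLin_eq {f : LaurentPoly P} (hf : f ∈ invLaurent b I) :
    gammaLin b I f = gammaVec b I f := by
  refine funext fun c => ?_
  have h : c = ((c.out : P.weylGroup) : Cosets b I) := (QuotientGroup.out_eq' c).symm
  conv_rhs => rw [h]
  rw [gammaVec_mk hf]
  rfl

theorem gammaVec_one {f : LaurentPoly P} (hf : f ∈ invLaurent b I) :
    gammaVec b I f ((1 : P.weylGroup) : Cosets b I) = algebraMap _ _ f := by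
  rw [gammaVec_mk hf, weylLaurent_one]

theorem gammaVec_injOn : Set.InjOn (gammaVec b I) (invLaurent b I : Set (LaurentPoly P)) := by
  intro f hf g hg h
  have h1 := congrFun h ((1 : P.weylGroup) : Cosets b I)
  rw [gammaVec_one hf, gammaVec_one hg] at h1
  exact algebraMap_injective h1

theorem linearIndependent_gammaVec {X : Type*} {p : X → LaurentPoly P}
    (hp : ∀ x, p x ∈ invLaurent b I) (hli : LinearIndependent ℂ p) :
    LinearIndependent ℂ fun x => gammaVec b I (p x) := by
  refine LinearIndependent.of_comp
    (LinearMap.proj ((1 : P.weylGroup) : Cosets b I) : VecFun b I →ₗ[ℂ] RatFun P) ?_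
  have h1 := hli.map' (IsScalarTower.toAlgHom ℂ (LaurentPoly P) (RatFun P)).toLinearMap
    (LinearMap.ker_eq_bot.2 algebraMap_injective)
  have h2 : (LinearMap.proj ((1 : P.weylGroup) : Cosets b I) : VecFun b I →ₗ[ℂ] RatFun P) ∘
      (fun x => gammaVec b I (p x)) =
      (IsScalarTower.toAlgHom ℂ (LaurentPoly P) (RatFun P)).toLinearMap ∘ p :=
    funext fun x => gammaVec_one (hp x)
  rw [h2]
  exact h1

theorem span_gammaVec {X : Type*} {p : X → LaurentPoly P}
    (hspan : Submodule.span ℂ (Set.range p) = invLaurent b I) :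
    Submodule.span ℂ (Set.range fun x => gammaVec b I (p x)) = invVec b I := by
  have hp : ∀ x, p x ∈ invLaurent b I := fun x => hspan ▸ Submodule.subset_span ⟨x, rfl⟩
  refine le_antisymm (Submodule.span_le.2 ?_) fun Φ hΦ => ?_
  · rintro _ ⟨x, rfl⟩
    exact gammaVec_mem_invVec (hp x)
  · obtain ⟨f, hf, rfl⟩ := exists_eq_gammaVec hΦ
    rw [← hspan] at hf
    have h1 := Submodule.mem_map_of_mem (f := gammaLin b I) hf
    rw [Submodule.map_span, ← Set.range_comp, gammaLin_eq (hspan ▸ hf)] at h1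
    have h2 : gammaLin b I ∘ p = fun x => gammaVec b I (p x) :=
      funext fun x => gammaLin_eq (hp x)
    rwa [h2] at h1

/-! ### The operators on invariant vector-valued functions -/

/-- The condition that the class of a tensor in `S(𝔥)` is invariant under `W_I`. -/
def IsSymInvariant (b : P.Base) (I : Set b.support) (y : TensorAlgebra ℂ (CplxSpace N)) : Prop :=
  ∀ w ∈ parabolic b I, weylSym P w (SymmetricAlgebra.algHom ℂ (CplxSpace N) y) =
    SymmetricAlgebra.algHom ℂ (CplxSpace N) y

variable {L : LaurentPoly P →ₗ[ℂ] ℂ}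

theorem lift_mem_invReflOps (hL : IsWeightFunctional b k L)
    (hk : ∀ i j, k (P.reflectionPerm i j) = k j) {y : TensorAlgebra ℂ (CplxSpace N)}
    (hy : IsSymInvariant b I y) : TensorAlgebra.lift ℂ (cherednik b k) y ∈ invReflOps b I :=
  mem_invReflOps.2 ⟨lift_cherednik_mem_reflOps y, fun _ hw => (conjOp_eq_iff_commute _ _).2
    (commute_weylEnd_of_weylSym (commute_cherednik hL) hk hy hw)⟩

theorem lift_cherednikLaurent_weyl (hL : IsWeightFunctional b k L)
    (hk : ∀ i j, k (P.reflectionPerm i j) = k j) {y : TensorAlgebra ℂ (CplxSpace N)}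
    (hy : IsSymInvariant b I y) {w : P.weylGroup} (hw : w ∈ parabolic b I) (f : LaurentPoly P) :
    TensorAlgebra.lift ℂ (cherednikLaurent b k) y (weylLaurent P w f) =
      weylLaurent P w (TensorAlgebra.lift ℂ (cherednikLaurent b k) y f) := by
  have h := LinearMap.congr_fun (commute_weylEnd_of_weylSym (commute_cherednik hL) hk hy hw).eq
    (algebraMap _ _ f)
  rw [Module.End.mul_apply, Module.End.mul_apply, weylEnd_algebraMap, lift_cherednik_algebraMap,
    lift_cherednik_algebraMap, weylEnd_algebraMap] at h
  exact algebraMap_injective h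

theorem lift_cherednikLaurent_mem (hL : IsWeightFunctional b k L)
    (hk : ∀ i j, k (P.reflectionPerm i j) = k j) {y : TensorAlgebra ℂ (CplxSpace N)}
    (hy : IsSymInvariant b I y) {f : LaurentPoly P} (hf : f ∈ invLaurent b I) :
    TensorAlgebra.lift ℂ (cherednikLaurent b k) y f ∈ invLaurent b I := fun w hw => by
  rw [← lift_cherednikLaurent_weyl hL hk hy hw, hf w hw]

theorem gammaOp_gammaVec (hL : IsWeightFunctional b k L)
    (hk : ∀ i j, k (P.reflectionPerm i j) = k j) {y : TensorAlgebra ℂ (CplxSpace N)}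
    (hy : IsSymInvariant b I y) {f : LaurentPoly P} (hf : f ∈ invLaurent b I) :
    gammaOp b I (TensorAlgebra.lift ℂ (cherednik b k) y) (gammaVec b I f) =
      gammaVec b I (TensorAlgebra.lift ℂ (cherednikLaurent b k) y f) := by
  have hT := lift_mem_invReflOps hL hk hy
  refine funext fun c => ?_
  induction c using QuotientGroup.induction_on with
  | H u =>
    rw [gammaOp_apply hT, cosetConj_mk hT, gammaVec_mk hf,
      gammaVec_mk (lift_cherednikLaurent_mem hL hk hy hf), ← weylEnd_algebraMap,
      ← weylEnd_algebraMap, ← lift_cherednik_algebraMap, ← Module.End.mul_apply,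
      conjOp_mul_weylEnd, Module.End.mul_apply]

theorem mem_opAlg_iff (hL : IsWeightFunctional b k L)
    (hk : ∀ i j, k (P.reflectionPerm i j) = k j) {D : MatDiffOps b I} :
    D ∈ opAlg b I k ↔ ∃ y, IsSymInvariant b I y ∧
      D = opMatrix b I (TensorAlgebra.lift ℂ (cherednik b k) y) := by
  constructor
  · rintro ⟨_, ⟨y, hy, rfl⟩, Q, hQ, rfl⟩
    refine ⟨y, hy, ?_⟩
    rw [reflAct_injective (hQ.trans (reflAct_opRefl (lift_mem_invReflOps hL hk hy)).symm),
      betaOp_opRefl]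
  · rintro ⟨y, hy, rfl⟩
    exact ⟨_, ⟨y, hy, rfl⟩, _, reflAct_opRefl (lift_mem_invReflOps hL hk hy),
      (betaOp_opRefl _).symm⟩

theorem matAct_opMatrix_gammaVec (hL : IsWeightFunctional b k L)
    (hk : ∀ i j, k (P.reflectionPerm i j) = k j) {y : TensorAlgebra ℂ (CplxSpace N)}
    (hy : IsSymInvariant b I y) {f : LaurentPoly P} (hf : f ∈ invLaurent b I) :
    matAct b I (opMatrix b I (TensorAlgebra.lift ℂ (cherednik b k) y)) (gammaVec b I f) =
      gammaVec b I (TensorAlgebra.lift ℂ (cherednikLaurent b k) y f) := by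
  rw [← betaOp_opRefl, matAct_betaOp _ (gammaVec_mem_invVec hf).2,
    reflAct_opRefl (lift_mem_invReflOps hL hk hy), gammaOp_gammaVec hL hk hy hf]

/-- The tensors whose classes in `S(𝔥)` are invariant under `W_I`. -/
def symInvariants (b : P.Base) (I : Set b.support) :
    Subalgebra ℂ (TensorAlgebra ℂ (CplxSpace N)) where
  carrier := {y | IsSymInvariant b I y}
  mul_mem' hx hy w hw := by rw [map_mul, map_mul, hx w hw, hy w hw]
  add_mem' hx hy w hw := by rw [map_add, map_add, hx w hw, hy w hw]
  algebraMap_mem' c w _ := by rw [AlgHom.commutes, AlgHom.commutes]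

theorem exists_subalgebra_eq_opAlg (hL : IsWeightFunctional b k L)
    (hk : ∀ i j, k (P.reflectionPerm i j) = k j) : ∃ A : Subalgebra ℂ (MatDiffOps b I),
      (A : Set (MatDiffOps b I)) = opAlg b I k ∧ ∀ D ∈ A, ∀ E ∈ A, D * E = E * D := by
  have hmem : ∀ y ∈ symInvariants b I,
      TensorAlgebra.lift ℂ (cherednik b k) y ∈ invReflOps b I :=
    fun y hy => lift_mem_invReflOps hL hk hy
  let φ : symInvariants b I →ₐ[ℂ] invReflOps b I :=
    ((TensorAlgebra.lift ℂ (cherednik b k)).comp (symInvariants b I).val).codRestrict _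
      fun y => hmem y y.2
  refine ⟨((opHom b I).comp φ).range, Set.ext fun D => ?_, ?_⟩
  · rw [mem_opAlg_iff hL hk]
    constructor
    · rintro ⟨y, rfl⟩
      exact ⟨y, y.2, rfl⟩
    · rintro ⟨y, hy, rfl⟩
      exact ⟨⟨y, hy⟩, rfl⟩
  · rintro _ ⟨x, rfl⟩ _ ⟨y, rfl⟩
    obtain ⟨Φ, hΦ⟩ := exists_symmetricAlgebra_hom (cherednik b k) (commute_cherednik hL)
    have h : φ x * φ y = φ y * φ x := by
      apply Subtype.ext
      change TensorAlgebra.lift ℂ (cherednik b k) x * TensorAlgebra.lift ℂ (cherednik b k) y =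
        TensorAlgebra.lift ℂ (cherednik b k) y * TensorAlgebra.lift ℂ (cherednik b k) x
      rw [← hΦ, ← hΦ]
      exact (map_mul Φ _ _).symm.trans ((congrArg Φ (mul_comm _ _)).trans (map_mul Φ _ _))
    change opHom b I (φ x) * opHom b I (φ y) = opHom b I (φ y) * opHom b I (φ x)
    exact (map_mul (opHom b I) _ _).symm.trans
      ((congrArg (opHom b I) h).trans (map_mul (opHom b I) _ _))

/-! ### Simultaneous eigenfunctions -/

/-- The coefficients of an eigenvector in a basis of eigenvectors vanish unless the eigenvalues
agree. -/
theorem eigenvalue_eq_of_coeff_ne_zero {X V : Type*} [AddCommGroup V] [Module ℂ V] {p : X → V}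
    (hp : LinearIndependent ℂ p) {T : Module.End ℂ V} {e : X → ℂ} (he : ∀ z, T (p z) = e z • p z)
    {a : X →₀ ℂ} {c : ℂ}
    (h : T (Finsupp.linearCombination ℂ p a) = c • Finsupp.linearCombination ℂ p a) {z : X}
    (hz : a z ≠ 0) : e z = c := by
  rw [Finsupp.linearCombination_apply, Finsupp.sum, map_sum, Finset.smul_sum, ← sub_eq_zero,
    ← Finset.sum_sub_distrib] at h
  have h1 : ∑ z ∈ a.support, (a z * (e z - c)) • p z = 0 := by
    rw [← h]
    refine Finset.sum_congr rfl fun z _ => ?_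
    rw [map_smul, he]
    module
  have h2 := linearIndependent_iff'.1 hp _ _ h1 z (Finsupp.mem_support_iff.2 hz)
  exact sub_eq_zero.1 ((mul_eq_zero.1 h2).resolve_left hz)

variable {p : domWeights b I → LaurentPoly P}

/-- The Jacobi polynomials are distinguished by their eigenvalues. -/
theorem eq_of_eigenvalues (hk : ∀ i j, k (P.reflectionPerm i j) = k j) (hk0 : ∀ i, 0 ≤ k i)
    (hp : ∀ x : domWeights b I, IsOrthogonalTop b I L x (p x)) {x z : domWeights b I}
    (h : ∀ y, IsSymInvariant b I y → ∃ c : ℂ,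
      TensorAlgebra.lift ℂ (cherednikLaurent b k) y (p x) = c • p x ∧
        TensorAlgebra.lift ℂ (cherednikLaurent b k) y (p z) = c • p z) : x = z := by
  obtain ⟨μ, hμ, hμe⟩ := (hp x).eigenvalue (k := k) x.2
  obtain ⟨ν, hν, hνe⟩ := (hp z).eigenvalue (k := k) z.2
  by_contra hne
  have hne' : domRep b I μ ≠ domRep b I ν := by
    rw [hμ, hν]
    exact fun h => hne (Subtype.ext h)
  obtain ⟨y, hy, hsep⟩ := exists_tensor_separating hk hk0 hne'
  obtain ⟨c, hc, hc'⟩ := h y hy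
  exact hsep ((hμe y c hc).symm.trans (hνe y c hc'))

theorem exists_linearCombination (hp : ∀ x : domWeights b I, IsOrthogonalTop b I L x (p x))
    {f : LaurentPoly P} (hf : f ∈ invLaurent b I) :
    ∃ a : domWeights b I →₀ ℂ, Finsupp.linearCombination ℂ p a = f := by
  rw [← IsOrthogonalTop.span_eq hp] at hf
  exact Finsupp.mem_span_range_iff_exists_finsupp.1 hf

/-- A simultaneous eigenvector has only one Jacobi polynomial in its expansion. -/
theorem eq_smul_of_eigenvector (hL : IsWeightFunctional b k L)
    (hk : ∀ i j, k (P.reflectionPerm i j) = k j) (hk0 : ∀ i, 0 ≤ k i)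
    (hp : ∀ x : domWeights b I, IsOrthogonalTop b I L x (p x)) {a : domWeights b I →₀ ℂ}
    (h : ∀ y, IsSymInvariant b I y → ∃ c : ℂ,
      TensorAlgebra.lift ℂ (cherednikLaurent b k) y (Finsupp.linearCombination ℂ p a) =
        c • Finsupp.linearCombination ℂ p a) {x : domWeights b I} (hx : a x ≠ 0) :
    Finsupp.linearCombination ℂ p a = a x • p x := by
  have hli := IsOrthogonalTop.linearIndependent hp
  have h1 : a = Finsupp.single x (a x) := by
    refine Finsupp.ext fun z => ?_
    by_cases hz : x = z
    · rw [← hz, Finsupp.single_eq_same]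
    · rw [Finsupp.single_eq_of_ne (Ne.symm hz)]
      by_contra haz
      refine hz (eq_of_eigenvalues hk hk0 hp fun y hy => ?_)
      obtain ⟨c, hc⟩ := h y hy
      choose e he using fun z : domWeights b I => (hp z).map_tensor hL z.2 y
        fun w hw f => lift_cherednikLaurent_weyl hL hk hy hw f
      refine ⟨c, ?_, ?_⟩
      · rw [he, eigenvalue_eq_of_coeff_ne_zero hli he hc hx]
      · rw [he, eigenvalue_eq_of_coeff_ne_zero hli he hc haz]
  conv_lhs => rw [h1]
  rw [Finsupp.linearCombination_single]

theorem smul_gammaVec (c : ℂ) {f : LaurentPoly P} (hf : f ∈ invLaurent b I) :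
    gammaVec b I (c • f) = c • gammaVec b I f := by
  rw [← gammaLin_eq hf, ← map_smul, gammaLin_eq (Submodule.smul_mem _ c hf)]

end Vectors

end JacobiPoly

end

open JacobiPoly in
theorem mainTheorem2 {ι M N : Type*} [Fintype ι] [AddCommGroup M] [Module ℝ M]
    [AddCommGroup N] [Module ℝ N] (P : RootPairing ι ℝ M N) [P.IsRootSystem]
    [P.IsCrystallographic] (b : P.Base) (I : Set b.support) (k : ι → ℝ)
    (hk : ∀ i j, k (P.reflectionPerm i j) = k j) (hk0 : ∀ i, 0 ≤ k i) :
    (∀ T ∈ JacobiPoly.invOperators b I k,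
      ∃! Q : JacobiPoly.MatReflOps b I, JacobiPoly.reflAct b I Q = JacobiPoly.gammaOp b I T) ∧
    (∃ A : Subalgebra ℂ (JacobiPoly.MatDiffOps b I),
      (A : Set (JacobiPoly.MatDiffOps b I)) = JacobiPoly.opAlg b I k ∧
      ∀ D ∈ A, ∀ E ∈ A, D * E = E * D) ∧
    (∀ D ∈ JacobiPoly.opAlg b I k, ∀ Φ ∈ JacobiPoly.invVec b I,
      JacobiPoly.matAct b I D Φ ∈ JacobiPoly.invVec b I) ∧
    ∃ p : JacobiPoly.domWeights b I → JacobiPoly.LaurentPoly P,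
      (∀ (x : JacobiPoly.domWeights b I) (f : JacobiPoly.LaurentPoly P),
        JacobiPoly.IsJacobi b I k (x : JacobiPoly.weightLattice P) f ↔ f = p x) ∧
      LinearIndependent ℂ (fun x => JacobiPoly.gammaVec b I (p x)) ∧
      Submodule.span ℂ (Set.range fun x => JacobiPoly.gammaVec b I (p x)) =
        JacobiPoly.invVec b I ∧
      (∀ x : JacobiPoly.domWeights b I, ∃ χ : JacobiPoly.MatDiffOps b I → ℂ,
        (∀ D ∈ JacobiPoly.opAlg b I k, JacobiPoly.matAct b I D (JacobiPoly.gammaVec b I (p x)) =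
          χ D • JacobiPoly.gammaVec b I (p x)) ∧
        ∀ Φ ∈ JacobiPoly.invVec b I,
          (∀ D ∈ JacobiPoly.opAlg b I k, JacobiPoly.matAct b I D Φ = χ D • Φ) →
          ∃ c : ℂ, Φ = c • JacobiPoly.gammaVec b I (p x)) ∧
      ∀ Φ ∈ JacobiPoly.invVec b I, Φ ≠ 0 →
        (∀ D ∈ JacobiPoly.opAlg b I k, ∃ c : ℂ, JacobiPoly.matAct b I D Φ = c • Φ) →
        ∃! x : JacobiPoly.domWeights b I, ∃ c : ℂ, Φ = c • JacobiPoly.gammaVec b I (p x) := by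
  classical
  have hL := isWeightFunctional (b := b) hk0 hk
  refine ⟨?_, exists_subalgebra_eq_opAlg hL hk, ?_, ?_⟩
  · rintro _ ⟨y, hy, rfl⟩
    exact existsUnique_reflAct (lift_mem_invReflOps hL hk hy)
  · intro D hD Φ hΦ
    obtain ⟨y, hy, rfl⟩ := (mem_opAlg_iff hL hk).1 hD
    obtain ⟨f, hf, rfl⟩ := exists_eq_gammaVec hΦ
    rw [matAct_opMatrix_gammaVec hL hk hy hf]
    exact gammaVec_mem_invVec (lift_cherednikLaurent_mem hL hk hy hf)
  choose p hp using fun x : domWeights b I =>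
    exists_isOrthogonalTop (I := I) hL (x : weightLattice P)
  have hinv : ∀ x, p x ∈ invLaurent b I := fun x => (hp x).mem_invLaurent x.2
  have hli := linearIndependent_gammaVec hinv (IsOrthogonalTop.linearIndependent hp)
  -- The expansion of a simultaneous eigenfunction.
  have key : ∀ Φ ∈ invVec b I, Φ ≠ 0 →
      (∀ D ∈ opAlg b I k, ∃ c : ℂ, matAct b I D Φ = c • Φ) →
      ∃ x, ∃ c : ℂ, Φ = c • gammaVec b I (p x) := by
    intro Φ hΦ hne h
    obtain ⟨f, hf, rfl⟩ := exists_eq_gammaVec hΦ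
    obtain ⟨a, rfl⟩ := exists_linearCombination hp hf
    have ha : a ≠ 0 := by
      rintro rfl
      refine hne ?_
      rw [map_zero, ← gammaLin_eq (zero_mem _), map_zero]
    obtain ⟨x, hx⟩ := Finsupp.ne_iff.1 ha
    refine ⟨x, a x, ?_⟩
    rw [eq_smul_of_eigenvector hL hk hk0 hp (fun y hy => ?_) hx, smul_gammaVec _ (hinv x)]
    obtain ⟨c, hc⟩ := h _ ((mem_opAlg_iff hL hk).2 ⟨y, hy, rfl⟩)
    refine ⟨c, ?_⟩
    rw [matAct_opMatrix_gammaVec hL hk hy hf, ← smul_gammaVec _ hf] at hc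
    exact gammaVec_injOn (lift_cherednikLaurent_mem hL hk hy hf) (Submodule.smul_mem _ c hf) hc
  have heig : ∀ x, ∀ D ∈ opAlg b I k, ∃ c : ℂ,
      matAct b I D (gammaVec b I (p x)) = c • gammaVec b I (p x) := by
    intro x D hD
    obtain ⟨y, hy, rfl⟩ := (mem_opAlg_iff hL hk).1 hD
    obtain ⟨c, hc⟩ := (hp x).map_tensor hL x.2 y
      fun w hw f => lift_cherednikLaurent_weyl hL hk hy hw f
    exact ⟨c, by rw [matAct_opMatrix_gammaVec hL hk hy (hinv x), hc, smul_gammaVec _ (hinv x)]⟩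
  refine ⟨p, fun x f => ?_, hli, span_gammaVec (IsOrthogonalTop.span_eq hp), fun x => ?_,
    fun Φ hΦ hne h => ?_⟩
  · rw [isJacobi_iff (innerProd_eq hk0)]
    exact ⟨fun hf => hf.unique hL (hp x), fun hf => hf ▸ hp x⟩
  · have hex : ∀ D, ∃ c : ℂ, D ∈ opAlg b I k →
        matAct b I D (gammaVec b I (p x)) = c • gammaVec b I (p x) := fun D => by
      by_cases hD : D ∈ opAlg b I k
      · obtain ⟨c, hc⟩ := heig x D hD
        exact ⟨c, fun _ => hc⟩
      · exact ⟨0, fun h => absurd h hD⟩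
    choose χ hχ using hex
    refine ⟨χ, hχ, fun Φ hΦ h => ?_⟩
    by_cases hne : Φ = 0
    · exact ⟨0, by rw [hne, zero_smul]⟩
    obtain ⟨z, c, rfl⟩ := key Φ hΦ hne fun D hD => ⟨_, h D hD⟩
    have hc : c ≠ 0 := by
      rintro rfl
      exact hne (zero_smul _ _)
    refine ⟨c, ?_⟩
    congr 2
    congr 1
    refine (eq_of_eigenvalues hk hk0 hp fun y hy => ?_).symm
    have hD := (mem_opAlg_iff (I := I) hL hk).2 ⟨y, hy, rfl⟩
    have h1 := h _ hD
    rw [map_smul, smul_comm] at h1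
    have h2 := hχ _ hD
    have h3 := smul_right_injective _ hc h1
    refine ⟨χ (opMatrix b I (TensorAlgebra.lift ℂ (cherednik b k) y)), ?_, ?_⟩
    · rw [matAct_opMatrix_gammaVec hL hk hy (hinv x), ← smul_gammaVec _ (hinv x)] at h2
      exact gammaVec_injOn (lift_cherednikLaurent_mem hL hk hy (hinv x))
        (Submodule.smul_mem _ _ (hinv x)) h2
    · rw [matAct_opMatrix_gammaVec hL hk hy (hinv z), ← smul_gammaVec _ (hinv z)] at h3
      exact gammaVec_injOn (lift_cherednikLaurent_mem hL hk hy (hinv z))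
        (Submodule.smul_mem _ _ (hinv z)) h3
  · obtain ⟨x, c, hc⟩ := key Φ hΦ hne h
    refine ⟨x, ⟨c, hc⟩, ?_⟩
    rintro z ⟨d, hd⟩
    by_contra hzx
    have hd0 : d ≠ 0 := by
      rintro rfl
      exact hne (hd.trans (zero_smul _ _))
    have h1 : d • gammaVec b I (p z) = c • gammaVec b I (p x) := hd.symm.trans hc
    have h2 : Finsupp.single z d = Finsupp.single x c :=
      hli (by simpa only [Finsupp.linearCombination_single] using h1)
    rcases (Finsupp.single_eq_single_iff _ _ _ _).1 h2 with h3 | h3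
    · exact hzx h3.1
    · exact hd0 h3.1
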